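/- Let $m>0$ and consider the sign-switching mass model for $\alpha(t,x)\in\mathbb C^2$, $x\in\mathbb R$, $$i\partial_t\alpha=\bigl(i\sigma_3\partial_x+\sigma_1\nu(t)\bigr)\alpha,\qquad \nu(t)=m\ \text{ for } t\in[2j,2j+1),\qquad \nu(t)=-m\ \text{ for } t\in[2j+1,2j+2),\quad j\in\mathbb Z,$$ with $\sigma_1=\begin{pmatrix}0&1\\1&0\end{pmatrix}$, $\sigma_3=\begin{pmatrix}1&0\\0&-1\end{pmatrix}$. Let $\mathcal U(t)$ be its solution operator, given by Fourier multipliers, and let $M=\mathcal U(2)=e^{-i(i\sigma_3\partial_x-m\sigma_1)}e^{-i(i\sigma_3\partial_x+m\sigma_1)}$ be the monodromy operator, so that $\mathcal U(2n)=M^n$. Put $$\theta(\xi)=\theta(\xi;m)=\arctan\left(\frac{\xi\sin\omega}{\sqrt{m^2+\xi^2\cos^2\omega}}\right),\quad \omega=\sqrt{m^2+\xi^2},\qquad \Sigma=\{m>0:\ \theta'''(0;m)=0\},\qquad \hat f(\xi)=\int_{\mathbb R} e^{-i\xi x}f(x)\,dx .$$ Suppose $m\notin\Sigma$. Then there is $\delta=\delta(m)>0$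 such that, for Schwartz functions $f=(f_1,f_2):\mathbb R\to\mathbb C^2$ with $\hat f$ supported in $[-\delta,\delta]$, for which $\mathcal U(t)f$ solves the system with data $f$, the following hold. (i) There is a constant $K$, independent of $f$ and $n$, with $\|M^nf\|_{L^\infty}\le K\,n^{-1/3}\|f\|_{L^1}$ for all $n\ge1$. (ii) Let $c=\mathrm{Ai}(0)\,|\theta'''(0)|^{-1/3}>0$, where $\mathrm{Ai}(0)=\bigl(3^{2/3}\Gamma(2/3)\bigr)^{-1}$. For $\varepsilon\in\{1,-1\}$ let $Q_\varepsilon=I$ if $\sin m=0$, and otherwise let $$Q_\varepsilon=\frac12\begin{pmatrix}1+\varepsilon\cos m&-i\varepsilon\sin m\\ i\varepsilon\sin m&1-\varepsilon\cos m\end{pmatrix},$$ a rank-one orthogonal projection. Along $x_n=ns_0$ with $s_0=-2\varepsilon\theta'(0)$ (which is nonzero when $\sin m\neq0$), $$(M^nf)(x_n)=c\,Q_\varepsilon\begin{pmatrix}\int_{\mathbb R} f_1\,dx\\ \int_{\mathbb R} f_2\,dx\end{pmatrix}n^{-1/3}+O(n^{-2/3}),\qquad n\ge1 .$$ The leading error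 term depends on $\hat f'(0)$: there are matrices $D_0$ and $D_1\ne0$, independent of $f$ and $n$, such that the error equals $\bigl(D_0\hat f(0)+D_1\hat f'(0)\bigr)n^{-2/3}+O(n^{-1})$. (iii) Consequently, for each such $f$ there are $s_0\in\{-2\theta'(0),2\theta'(0)\}$ and $C\in[c/\sqrt2,\,c]$, in particular $C\ne0$, such that, with the Euclidean norm of $\mathbb C^2$, $$\bigl|(M^nf)(ns_0)\bigr|=C\left|\begin{pmatrix}\int_{\mathbb R} f_1\,dx\\ \int_{\mathbb R} f_2\,dx\end{pmatrix}\right|n^{-1/3}+O(n^{-2/3}),\qquad n\ge1 .$$ The constants in the $O$-terms may depend on $f$ and $m$, but not on $n$. -/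

import Mathlib

open MeasureTheory Set
open scoped SchwartzMap

/-- Values of the wave function: `ℂ²` with its Euclidean norm. -/
abbrev Spinor : Type := EuclideanSpace ℂ (Fin 2)

/-- The Pauli matrix `σ₁`. -/
def pauli1 : Matrix (Fin 2) (Fin 2) ℂ := !![0, 1; 1, 0]

/-- The Pauli matrix `σ₃`. -/
def pauli3 : Matrix (Fin 2) (Fin 2) ℂ := !![1, 0; 0, -1]

noncomputable section

/-- The Fourier transform `∫ e^{-iξx} f(x) dx`. -/
def fourierT (f : ℝ → Spinor) (ξ : ℝ) : Spinor :=
  ∫ x : ℝ, Complex.exp (-(Complex.I * ξ * x)) • f x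

/-- The Fourier symbol of the constant mass Dirac operator `i σ₃ ∂ₓ + μ σ₁`
(where `∂ₓ` becomes multiplication by `iξ`). -/
def diracSymbol (μ ξ : ℝ) : Matrix (Fin 2) (Fin 2) ℂ :=
  (-(ξ : ℂ)) • pauli3 + (μ : ℂ) • pauli1

/-- The propagator `e^{-it(iσ₃∂ₓ + μσ₁)}` of the constant mass Dirac equation, as a Fourier
multiplier: `(1/2π) ∫ e^{iξx} e^{-it(-ξσ₃ + μσ₁)} f̂(ξ) dξ`. -/
def diracFlow (μ t : ℝ) (f : ℝ → Spinor) (x : ℝ) : Spinor :=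
  (1 / (2 * (Real.pi : ℂ))) • ∫ ξ : ℝ, Complex.exp (Complex.I * ξ * x) •
    Matrix.toEuclideanLin (NormedSpace.exp ((-(Complex.I * t)) • diracSymbol μ ξ)) (fourierT f ξ)

/-- The monodromy operator: mass `m` for one unit of time, then mass `-m` for one unit of time. -/
def monodromy (m : ℝ) (f : ℝ → Spinor) : ℝ → Spinor :=
  diracFlow (-m) 1 (diracFlow m 1 f)

/-- The solution operator `𝒰(t)`, `t ≥ 0`, of the sign-switching model: `⌊t/2⌋` full periods,
then the remaining time `r = t - 2⌊t/2⌋ ∈ [0, 2)`. -/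
def switchedFlow (m t : ℝ) (f : ℝ → Spinor) : ℝ → Spinor :=
  if t - 2 * ⌊t / 2⌋₊ < 1 then
    diracFlow m (t - 2 * ⌊t / 2⌋₊) ((monodromy m)^[⌊t / 2⌋₊] f)
  else
    diracFlow (-m) (t - 2 * ⌊t / 2⌋₊ - 1) (diracFlow m 1 ((monodromy m)^[⌊t / 2⌋₊] f))

/-- The switching mass: `m` on `[2j, 2j+1)` and `-m` on `[2j+1, 2j+2)`. -/
def switchingMass (m t : ℝ) : ℝ := if Even ⌊t⌋ then m else -m

/-- `α` solves `i ∂ₜα = (i σ₃ ∂ₓ + σ₁ ν(t)) α` for `t ≥ 0`, with data `f` at `t = 0`. The solution is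
jointly continuous, square integrable and `C¹` in `x`; as `ν` jumps at the integers and is
right-continuous, the time derivative is the one-sided derivative from the right. -/
structure IsDiracSolution (m : ℝ) (f : ℝ → Spinor) (α : ℝ → ℝ → Spinor) : Prop where
  initial : α 0 = f
  continuousOn : ContinuousOn (fun p : ℝ × ℝ => α p.1 p.2) (Ici 0 ×ˢ univ)
  memLp : ∀ t, 0 ≤ t → MemLp (α t) 2 volume
  contDiff : ∀ t, 0 ≤ t → ContDiff ℝ 1 (α t)
  equation : ∀ t, 0 ≤ t → ∀ x, HasDerivWithinAt (fun s => α s x)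
    ((-Complex.I) • (Complex.I • Matrix.toEuclideanLin pauli3 (deriv (α t) x)
      + (switchingMass m t : ℂ) • Matrix.toEuclideanLin pauli1 (α t x))) (Ici t) t

/-- `ω(ξ; m) = √(m² + ξ²)`. -/
def omegaFreq (m ξ : ℝ) : ℝ := Real.sqrt (m ^ 2 + ξ ^ 2)

/-- The dispersion relation
`θ(ξ; m) = arctan (ξ sin ω / √(m² + ξ² cos² ω))`, `ω = ω(ξ; m)`. -/
def theta (m ξ : ℝ) : ℝ :=
  Real.arctan (ξ * Real.sin (omegaFreq m ξ)
    / Real.sqrt (m ^ 2 + ξ ^ 2 * Real.cos (omegaFreq m ξ) ^ 2))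

/-- The set `Σ` of exceptional masses: `m > 0` with `θ'''(0; m) = 0`. -/
def exceptionalMasses : Set ℝ := {m | 0 < m ∧ iteratedDeriv 3 (theta m) 0 = 0}

/-- `Ai(0)`, the value at `0` of the Airy function. -/
def airyAtZero : ℝ := 1 / ((3 : ℝ) ^ (2 / 3 : ℝ) * Real.Gamma (2 / 3))

/-- The Airy-type constant `Ai(0) |θ'''(0; m)|^{-1/3}`. -/
def airyConst (m : ℝ) : ℝ :=
  airyAtZero * |iteratedDeriv 3 (theta m) 0| ^ (-(1 / 3) : ℝ)

/-- The polarization matrix at `ξ = 0` seen along the ray of slope `-2εθ'(0)`, `ε = ±1`. If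
`sin m ≠ 0` it is the orthogonal projection onto the branch `e^{2iεθ}` of the monodromy at
`ξ = 0`, which is spanned by `(i sin m, cos m - ε)`. If `sin m = 0` the two rays coincide, both
branches contribute, and the matrix is the identity. -/
def polarization (m ε : ℝ) : Matrix (Fin 2) (Fin 2) ℂ :=
  if Real.sin m = 0 then 1 else
    (1 / 2 : ℂ) • !![1 + (ε : ℂ) * Real.cos m, -(Complex.I * ε * Real.sin m);
                     Complex.I * ε * Real.sin m, 1 - (ε : ℂ) * Real.cos m]

/-- Schwartz data whose Fourier transform is supported in `[-δ, δ]`. -/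
def BandLimited (δ : ℝ) (f : 𝓢(ℝ, Spinor)) : Prop :=
  ∀ ξ : ℝ, δ < |ξ| → fourierT f ξ = 0

end

/-! On the Fourier side one period multiplies by a unitary `2 × 2` matrix with eigenvalues
`e^{±2iθ(ξ)}`. Writing `P_ε(ξ)` for the spectral projections, `Mⁿf(x)` is the sum over `ε = ±1` of
the oscillatory integrals `(1/2π) ∫ e^{i(xξ + 2εnθ(ξ))} P_ε(ξ) f̂(ξ) dξ`. Since `θ` is odd, `θ''(0)
= 0`, and `m ∉ Σ` says that `θ'''(0) ≠ 0`. Hence `θ''` vanishes to exactly first order at `0`, and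
along `x = -2εnθ'(0)` the phase of branch `ε` has a cubic stationary point there. This is where the
rate `n^{-1/3}` comes from.

Upper bound: each branch is a convolution, so a uniform bound on its kernel suffices. The interval
`|ξ| < n^{-1/3}` is estimated by its length and the rest by van der Corput's second derivative test;
a linear term `xξ` does not affect that test (`exists_branch_kernel_bound`,
`norm_branch_integral_le`).

Expansion: the resonant phase `ψ = 2ε(θ(ξ) - θ'(0)ξ)` is, up to sign, the cube of a local coordinate
`u`. Subtracting suitable multiples of `u'` and `uu'` from the amplitude leaves a remainder
divisible by `ψ'`, which one integration by parts makes `O(1/n)`. The subtracted terms become `∫ v^k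
e^{inv³} dv` with `k = 0, 1`, evaluated by Gamma functions; they give the orders `n^{-1/3}` and
`n^{-2/3}` (`exists_airy_expansion`). As `θ'(0) = sin m / m`, for `sin m ≠ 0` the other branch has
no stationary point near `0` and is `O(1/n)`. For `sin m = 0` both branches resonate on the ray `x =
0` and their projections add up to the identity (`exists_ray_expansion`).

Modulus: `P₁(0)` and `P₋₁(0)` are complementary orthogonal projections, so one of them keeps at
least half of the squared norm of `∫ f`. -/

/-! ### Fourier inversion in the `e^{-iξx}` normalization -/

section FourierInversion

open scoped FourierTransform

/-- The inverse Fourier transform `(1/2π) ∫ e^{iξx} h(ξ) dξ`. -/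
noncomputable def invFourierT (h : ℝ → Spinor) (x : ℝ) : Spinor :=
  (1 / (2 * (Real.pi : ℂ))) • ∫ ξ : ℝ, Complex.exp (Complex.I * ξ * x) • h ξ

/-- The transform `𝓕` has kernel `e^{-2πixξ}`, so every passage between the two conventions is a
dilation by `1/2π`. -/
theorem fourierT_eq_fourier (f : ℝ → Spinor) (ξ : ℝ) :
    fourierT f ξ = 𝓕 f (ξ * (2 * Real.pi)⁻¹) := by
  rw [Real.fourier_real_eq_integral_exp_smul]
  refine integral_congr_ae (.of_forall fun x => ?_)
  have hpi : (Real.pi : ℂ) ≠ 0 := by exact_mod_cast Real.pi_ne_zero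
  simp only
  congr 2
  push_cast
  field_simp

theorem invFourierT_eq_fourierInv (h : ℝ → Spinor) (x : ℝ) :
    invFourierT h x = (1 / (2 * (Real.pi : ℂ))) • 𝓕⁻ h (x * (2 * Real.pi)⁻¹) := by
  rw [Real.fourierInv_eq', invFourierT]
  congr 1
  refine integral_congr_ae (.of_forall fun ξ => ?_)
  have hpi : (Real.pi : ℂ) ≠ 0 := by exact_mod_cast Real.pi_ne_zero
  simp only [RCLike.inner_apply, conj_trivial]
  congr 2
  push_cast
  field_simp

/-- The dilation of a Schwartz function by `1/2π`. -/
theorem exists_schwartz_dilation (g : 𝓢(ℝ, Spinor)) :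
    ∃ G : 𝓢(ℝ, Spinor), ∀ x, G x = g (x * (2 * Real.pi)⁻¹) :=
  ⟨SchwartzMap.compCLMOfContinuousLinearEquiv ℝ (ContinuousLinearEquiv.unitsEquivAut ℝ
    (Units.mk0 (2 * Real.pi)⁻¹ (by positivity))) g, fun x => by simp⟩

theorem exists_schwartz_fourierT (f : 𝓢(ℝ, Spinor)) : ∃ F : 𝓢(ℝ, Spinor), ⇑F = fourierT f := by
  obtain ⟨G, hG⟩ := exists_schwartz_dilation (𝓕 f)
  refine ⟨G, funext fun ξ => ?_⟩
  rw [hG, fourierT_eq_fourier, SchwartzMap.fourier_coe]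

theorem exists_schwartz_invFourierT (h : 𝓢(ℝ, Spinor)) :
    ∃ F : 𝓢(ℝ, Spinor), ⇑F = invFourierT h := by
  obtain ⟨G, hG⟩ := exists_schwartz_dilation (𝓕⁻ h)
  refine ⟨(1 / (2 * (Real.pi : ℂ))) • G, funext fun ξ => ?_⟩
  rw [smul_apply, hG, invFourierT_eq_fourierInv, SchwartzMap.fourierInv_coe]

theorem invFourierT_fourierT (f : 𝓢(ℝ, Spinor)) : invFourierT (fourierT f) = f := by
  funext x
  have hpi : (2 * Real.pi) ≠ 0 := by positivity
  have h1 : ∀ ξ : ℝ, Complex.exp (Complex.I * ξ * x) • fourierT f ξ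
      = (fun η : ℝ => Complex.exp (↑(2 * Real.pi * inner ℝ η x) * Complex.I) • 𝓕 (f : ℝ → Spinor) η)
        (ξ / (2 * Real.pi)) := by
    intro ξ
    simp only [fourierT_eq_fourier, RCLike.inner_apply, conj_trivial, div_eq_mul_inv]
    congr 2
    have hpi : (Real.pi : ℂ) ≠ 0 := by exact_mod_cast Real.pi_ne_zero
    push_cast
    field_simp
  have h2 : (𝓕⁻ (𝓕 (f : ℝ → Spinor))) x = f x := by
    rw [← SchwartzMap.fourier_coe, ← SchwartzMap.fourierInv_coe, FourierTransform.fourierInv_fourier_eq]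
  rw [invFourierT, (integral_congr_ae (.of_forall h1)).trans (Measure.integral_comp_div
    (fun η : ℝ => Complex.exp (↑(2 * Real.pi * inner ℝ η x) * Complex.I) • 𝓕 (f : ℝ → Spinor) η)
    (2 * Real.pi)), ← Real.fourierInv_eq', h2, abs_of_pos (by positivity),
    ← Complex.coe_smul, smul_smul]
  have hpi : (Real.pi : ℂ) ≠ 0 := by exact_mod_cast Real.pi_ne_zero
  push_cast
  rw [one_div_mul_cancel (by simp [hpi]), one_smul]

theorem fourierT_invFourierT (h : 𝓢(ℝ, Spinor)) : fourierT (invFourierT h) = h := by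
  funext ξ
  have hpi : (2 * Real.pi) ≠ 0 := by positivity
  have hpi' : (Real.pi : ℂ) ≠ 0 := by exact_mod_cast Real.pi_ne_zero
  have h1 : ∀ x : ℝ, Complex.exp (-(Complex.I * ξ * x)) • invFourierT h x
      = (fun y : ℝ => Complex.exp (↑(-2 * Real.pi * y * ξ) * Complex.I) •
        ((1 / (2 * (Real.pi : ℂ))) • 𝓕⁻ (h : ℝ → Spinor) y)) (x / (2 * Real.pi)) := by
    intro x
    simp only [invFourierT_eq_fourierInv, div_eq_mul_inv]
    congr 2
    push_cast
    field_simp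
  have h2 : 𝓕 (𝓕⁻ (h : ℝ → Spinor)) ξ = h ξ := by
    rw [← SchwartzMap.fourierInv_coe, ← SchwartzMap.fourier_coe, FourierTransform.fourier_fourierInv_eq]
  rw [fourierT, (integral_congr_ae (.of_forall h1)).trans (Measure.integral_comp_div
    (fun y : ℝ => Complex.exp (↑(-2 * Real.pi * y * ξ) * Complex.I) •
        ((1 / (2 * (Real.pi : ℂ))) • 𝓕⁻ (h : ℝ → Spinor) y)) (2 * Real.pi))]
  simp_rw [smul_comm _ (1 / (2 * (Real.pi : ℂ)))]
  rw [integral_smul, ← Real.fourier_real_eq_integral_exp_smul, h2, abs_of_pos (by positivity),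
    ← Complex.coe_smul, smul_smul]
  push_cast
  rw [mul_one_div_cancel (by simp [hpi']), one_smul]

end FourierInversion

/-! ### Band-limited functions and their profiles -/

/-- `g` is the inverse Fourier transform of a smooth profile supported in `[-δ, δ]`. -/
structure IsBandProfile (δ : ℝ) (g h : ℝ → Spinor) : Prop where
  smooth : ContDiff ℝ (⊤ : ℕ∞) h
  support : ∀ ξ, δ < |ξ| → h ξ = 0
  eq_inv : g = invFourierT h

theorem exists_schwartz_of_compactSupport {δ : ℝ} {h : ℝ → Spinor} (hs : ContDiff ℝ (⊤ : ℕ∞) h)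
    (h0 : ∀ ξ, δ < |ξ| → h ξ = 0) : ∃ H : 𝓢(ℝ, Spinor), ⇑H = h := by
  have hc : HasCompactSupport h := by
    refine HasCompactSupport.intro (isCompact_Icc (a := -δ) (b := δ)) fun x hx => h0 x ?_
    by_contra hcon
    exact hx (abs_le.1 (not_lt.1 hcon))
  exact ⟨hc.toSchwartzMap hs, rfl⟩

namespace IsBandProfile

variable {δ : ℝ} {g h : ℝ → Spinor}

/-- A smooth compactly supported profile is Schwartz, so inversion applies. Flows can then be
composed by multiplying profiles. -/
theorem fourierT_eq (hg : IsBandProfile δ g h) : fourierT g = h := by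
  obtain ⟨H, rfl⟩ := exists_schwartz_of_compactSupport hg.smooth hg.support
  rw [hg.eq_inv, fourierT_invFourierT]

theorem exists_schwartz (hg : IsBandProfile δ g h) : ∃ G : 𝓢(ℝ, Spinor), ⇑G = g := by
  obtain ⟨H, rfl⟩ := exists_schwartz_of_compactSupport hg.smooth hg.support
  rw [hg.eq_inv]
  exact exists_schwartz_invFourierT H

end IsBandProfile

theorem BandLimited.isBandProfile {δ : ℝ} {f : 𝓢(ℝ, Spinor)} (hf : BandLimited δ f) :
    IsBandProfile δ f (fourierT f) := by
  refine ⟨?_, hf, (invFourierT_fourierT f).symm⟩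
  obtain ⟨F, hF⟩ := exists_schwartz_fourierT f
  rw [← hF]
  exact F.smooth ⊤

theorem integral_eq_intervalIntegral_of_support {E : Type*} [NormedAddCommGroup E]
    [NormedSpace ℝ E] {δ : ℝ} (hδ : 0 < δ) {u : ℝ → E} (hu : ∀ ξ, δ < |ξ| → u ξ = 0) :
    ∫ ξ, u ξ = ∫ ξ in (-δ)..δ, u ξ := by
  rw [intervalIntegral.integral_of_le (by linarith), ← integral_Icc_eq_integral_Ioc,
    setIntegral_eq_integral_of_forall_compl_eq_zero]
  intro x hx
  refine hu x ?_
  by_contra hcon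
  exact hx (abs_le.1 (not_lt.1 hcon))

theorem invFourierT_eq_intervalIntegral {δ : ℝ} (hδ : 0 < δ) {h : ℝ → Spinor}
    (h0 : ∀ ξ, δ < |ξ| → h ξ = 0) (x : ℝ) :
    invFourierT h x = (1 / (2 * (Real.pi : ℂ))) •
      ∫ ξ in (-δ)..δ, Complex.exp (Complex.I * ξ * x) • h ξ := by
  rw [invFourierT, integral_eq_intervalIntegral_of_support hδ]
  intro ξ hξ
  rw [h0 ξ hξ, smul_zero]

/-- Differentiation under the integral sign for jointly continuous data. -/
theorem hasDerivAt_intervalIntegral_of_continuous {E : Type*} [NormedAddCommGroup E]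
    [NormedSpace ℝ E] [CompleteSpace E] {F F' : ℝ → ℝ → E}
    (hF : Continuous (Function.uncurry F))
    (hF' : Continuous (Function.uncurry F')) (hd : ∀ s ξ, HasDerivAt (fun s => F s ξ) (F' s ξ) s)
    (a b s : ℝ) :
    HasDerivAt (fun s => ∫ ξ in a..b, F s ξ) (∫ ξ in a..b, F' s ξ) s := by
  obtain ⟨C, hC⟩ := ((isCompact_closedBall s 1).prod (isCompact_uIcc (a := a) (b := b))).exists_bound_of_continuousOn
    hF'.continuousOn
  have hFs : ∀ s, Continuous (F s) := fun s => hF.comp (Continuous.prodMk_right s)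
  have hF's : ∀ s, Continuous (F' s) := fun s => hF'.comp (Continuous.prodMk_right s)
  refine (intervalIntegral.hasDerivAt_integral_of_dominated_loc_of_deriv_le (bound := fun _ => C)
    (Metric.ball_mem_nhds s one_pos) (.of_forall fun s => (hFs s).aestronglyMeasurable)
    ((hFs s).intervalIntegrable _ _) (hF's s).aestronglyMeasurable (.of_forall ?_)
    intervalIntegrable_const (.of_forall fun t _ x _ => hd x t)).2
  intro t ht x hx
  exact hC (x, t) ⟨Metric.ball_subset_closedBall hx, uIoc_subset_uIcc ht⟩

/-! ### Closed form of the propagator and diagonalization of the monodromy symbol -/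

section Propagator

theorem omegaFreq_pos {m : ℝ} (hm : m ≠ 0) (ξ : ℝ) : 0 < omegaFreq m ξ := by
  unfold omegaFreq; positivity

theorem omegaFreq_sq (m ξ : ℝ) : omegaFreq m ξ ^ 2 = m ^ 2 + ξ ^ 2 :=
  Real.sq_sqrt (by positivity)

theorem omegaFreq_neg_mass (m ξ : ℝ) : omegaFreq (-m) ξ = omegaFreq m ξ := by
  simp [omegaFreq]

/-- The closed form `cos (tω) - i (sin (tω) / ω) H` of `e^{-itH}`, `H = -ξσ₃ + μσ₁`. -/
noncomputable def diracExp (μ t ξ : ℝ) : Matrix (Fin 2) (Fin 2) ℂ :=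
  (Real.cos (t * omegaFreq μ ξ) : ℂ) • 1
    - (Complex.I * (Real.sin (t * omegaFreq μ ξ) / omegaFreq μ ξ : ℝ)) • diracSymbol μ ξ

theorem exp_diracSymbol {μ : ℝ} (hμ : μ ≠ 0) (t ξ : ℝ) :
    NormedSpace.exp ((-(Complex.I * t)) • diracSymbol μ ξ) = diracExp μ t ξ := by
  set w := omegaFreq μ ξ with hw
  have hw0 : (w : ℂ) ≠ 0 := by exact_mod_cast (omegaFreq_pos hμ ξ).ne'
  have hμ' : (μ : ℂ) ≠ 0 := by exact_mod_cast hμ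
  have hw2 : (w : ℂ) ^ 2 = μ ^ 2 + ξ ^ 2 := by exact_mod_cast omegaFreq_sq μ ξ
  -- The columns are eigenvectors of `H` for the eigenvalues `ω` and `-ω`. The determinant is
  -- `-2μω`, so a nonzero mass makes them a basis at every frequency.
  set U : Matrix (Fin 2) (Fin 2) ℂ := !![(μ : ℂ), μ; w + ξ, ξ - w] with hU
  have hdet : IsUnit U.det := by
    rw [isUnit_iff_ne_zero, hU, Matrix.det_fin_two_of]
    have : (μ : ℂ) * (ξ - w) - μ * (w + ξ) = -2 * μ * w := by ring
    rw [this]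
    simp [hμ', hw0]
  have hUu : IsUnit U := (Matrix.isUnit_iff_isUnit_det U).2 hdet
  set D : Matrix (Fin 2) (Fin 2) ℂ :=
    Matrix.diagonal ![-(Complex.I * t) * w, (Complex.I * t) * w] with hD
  have h1 : ((-(Complex.I * t)) • diracSymbol μ ξ) * U = U * D := by
    ext i j
    fin_cases i <;> fin_cases j <;>
      simp [hU, hD, diracSymbol, pauli1, pauli3, Matrix.mul_apply, Fin.sum_univ_two] <;>
      first
      | ring1
      | linear_combination (Complex.I * t) * hw2
  have h2 : (-(Complex.I * t)) • diracSymbol μ ξ = U * D * U⁻¹ := by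
    rw [← h1, Matrix.mul_nonsing_inv_cancel_right _ _ hdet]
  have e2 : NormedSpace.exp (Complex.I * t * w) =
      Complex.cos (t * w) + Complex.sin (t * w) * Complex.I := by
    rw [← Complex.exp_mul_I, ← Complex.exp_eq_exp_ℂ]
    ring_nf
  have e1 : NormedSpace.exp (-(Complex.I * t * w)) =
      Complex.cos (t * w) - Complex.sin (t * w) * Complex.I := by
    rw [← Complex.exp_eq_exp_ℂ, show -(Complex.I * t * w) = (-(t * w)) * Complex.I by ring,
      Complex.exp_mul_I, Complex.cos_neg, Complex.sin_neg]
    ring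
  rw [h2, Matrix.exp_conj _ _ hUu, hD, Matrix.exp_diagonal]
  suffices h : U * Matrix.diagonal (NormedSpace.exp
      ![-(Complex.I * t) * w, (Complex.I * t) * w]) = diracExp μ t ξ * U by
    rw [h, Matrix.mul_nonsing_inv_cancel_right _ _ hdet]
  rw [Pi.exp_def]
  ext i j
  fin_cases i <;> fin_cases j <;>
    simp [hU, diracExp, diracSymbol, pauli1, pauli3, Matrix.mul_apply, Fin.sum_univ_two, e1, e2,
      ← hw] <;> field_simp <;>
    first
    | ring1
    | linear_combination (Complex.I * Complex.sin (w * t)) * hw2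
    | linear_combination (-(Complex.I * Complex.sin (w * t))) * hw2

/-- The operator that swaps the two branches: `M̂ = cos 2θ + i sin 2θ N`. -/
noncomputable def branchGen (m ξ : ℝ) : Matrix (Fin 2) (Fin 2) ℂ :=
  !![((omegaFreq m ξ * Real.cos (omegaFreq m ξ) /
        Real.sqrt (m ^ 2 + ξ ^ 2 * Real.cos (omegaFreq m ξ) ^ 2) : ℝ) : ℂ),
      -Complex.I * ((m * Real.sin (omegaFreq m ξ) /
        Real.sqrt (m ^ 2 + ξ ^ 2 * Real.cos (omegaFreq m ξ) ^ 2) : ℝ) : ℂ);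
      Complex.I * ((m * Real.sin (omegaFreq m ξ) /
        Real.sqrt (m ^ 2 + ξ ^ 2 * Real.cos (omegaFreq m ξ) ^ 2) : ℝ) : ℂ),
      -((omegaFreq m ξ * Real.cos (omegaFreq m ξ) /
        Real.sqrt (m ^ 2 + ξ ^ 2 * Real.cos (omegaFreq m ξ) ^ 2) : ℝ) : ℂ)]

/-- The spectral projection onto the branch `e^{2iεθ}` of the monodromy. -/
noncomputable def branchProj (m ε ξ : ℝ) : Matrix (Fin 2) (Fin 2) ℂ :=
  (1 / 2 : ℂ) • (1 + (ε : ℂ) • branchGen m ξ)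

theorem discr_pos {m : ℝ} (hm : m ≠ 0) (ξ : ℝ) :
    0 < m ^ 2 + ξ ^ 2 * Real.cos (omegaFreq m ξ) ^ 2 := by positivity

/-- The matrix is a reflection: since `ω² = m² + ξ²`, one has `ω² cos² ω + m² sin² ω = m² + ξ² cos²
ω`, the square of the common denominator. This makes `branchProj` idempotent. -/
theorem branchGen_mul_self {m : ℝ} (hm : m ≠ 0) (ξ : ℝ) :
    branchGen m ξ * branchGen m ξ = 1 := by
  have hp := discr_pos hm ξ
  set D := Real.sqrt (m ^ 2 + ξ ^ 2 * Real.cos (omegaFreq m ξ) ^ 2) with hD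
  have hD0 : 0 < D := Real.sqrt_pos.2 hp
  have hD2 : D ^ 2 = m ^ 2 + ξ ^ 2 * Real.cos (omegaFreq m ξ) ^ 2 := Real.sq_sqrt hp.le
  have key : (omegaFreq m ξ * Real.cos (omegaFreq m ξ) / D) ^ 2
      + (m * Real.sin (omegaFreq m ξ) / D) ^ 2 = 1 := by
    have h1 := omegaFreq_sq m ξ
    have h2 := Real.sin_sq_add_cos_sq (omegaFreq m ξ)
    field_simp
    rw [hD2]
    linear_combination Real.cos (omegaFreq m ξ) ^ 2 * h1 + m ^ 2 * h2
  unfold branchGen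
  rw [← hD]
  set a := omegaFreq m ξ * Real.cos (omegaFreq m ξ) / D
  set b := m * Real.sin (omegaFreq m ξ) / D
  have key' : (a : ℂ) ^ 2 + (b : ℂ) ^ 2 = 1 := by exact_mod_cast key
  ext i j
  fin_cases i <;> fin_cases j <;> simp [Matrix.mul_apply, Fin.sum_univ_two] <;>
    first
    | ring1
    | linear_combination key' - (b : ℂ) ^ 2 * Complex.I_sq

theorem branchProj_mul_self {m ε : ℝ} (hm : m ≠ 0) (hε : ε ^ 2 = 1) (ξ : ℝ) :
    branchProj m ε ξ * branchProj m ε ξ = branchProj m ε ξ := by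
  have hε' : (ε : ℂ) * ε = 1 := by rw [← sq]; exact_mod_cast hε
  simp only [branchProj, smul_mul_smul_comm, add_mul, mul_add, one_mul, mul_one,
    branchGen_mul_self hm, hε', one_smul]
  module

theorem branchProj_mul_neg {m ε : ℝ} (hm : m ≠ 0) (hε : ε ^ 2 = 1) (ξ : ℝ) :
    branchProj m ε ξ * branchProj m (-ε) ξ = 0 := by
  have hε' : (ε : ℂ) * ε = 1 := by rw [← sq]; exact_mod_cast hε
  simp only [branchProj, smul_mul_smul_comm, add_mul, mul_add, one_mul, mul_one,
    branchGen_mul_self hm, Complex.ofReal_neg, mul_neg, hε']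
  module

theorem branchProj_add_neg (m ε ξ : ℝ) :
    branchProj m ε ξ + branchProj m (-ε) ξ = 1 := by
  simp only [branchProj, Complex.ofReal_neg]
  module

/-- `θ` is an angle of the right triangle with legs `ξ sin ω` and `√(m² + ξ² cos² ω)`, whose
hypotenuse is `ω`. -/
theorem sin_theta {m : ℝ} (hm : m ≠ 0) (ξ : ℝ) :
    Real.sin (theta m ξ) = ξ * Real.sin (omegaFreq m ξ) / omegaFreq m ξ ∧
    Real.cos (theta m ξ) =
      Real.sqrt (m ^ 2 + ξ ^ 2 * Real.cos (omegaFreq m ξ) ^ 2) / omegaFreq m ξ := by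
  have hp := discr_pos hm ξ
  set D := Real.sqrt (m ^ 2 + ξ ^ 2 * Real.cos (omegaFreq m ξ) ^ 2) with hD
  have hD0 : 0 < D := Real.sqrt_pos.2 hp
  have hD2 : D ^ 2 = m ^ 2 + ξ ^ 2 * Real.cos (omegaFreq m ξ) ^ 2 := Real.sq_sqrt hp.le
  have hw := omegaFreq_pos hm ξ
  have hs : Real.sqrt (1 + (ξ * Real.sin (omegaFreq m ξ) / D) ^ 2) = omegaFreq m ξ / D := by
    rw [Real.sqrt_eq_iff_mul_self_eq (by positivity) (by positivity)]
    have h1 := omegaFreq_sq m ξ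
    have h2 := Real.sin_sq_add_cos_sq (omegaFreq m ξ)
    field_simp
    rw [hD2]
    linear_combination ξ ^ 2 * h2 - h1
  rw [theta, Real.sin_arctan, Real.cos_arctan, ← hD, hs]
  constructor <;> field_simp

/-- The product has trace `2 - 4(ξ sin ω / ω)² = 2 cos 2θ`. Its trace-free part is `i sin 2θ` times
`branchGen`: the root in `sin 2θ = 2 sin θ cos θ` cancels the denominator of `branchGen`. -/
theorem monodromySymbol_eq {m : ℝ} (hm : m ≠ 0) (ξ : ℝ) :
    diracExp (-m) 1 ξ * diracExp m 1 ξ =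
      Complex.exp (Complex.I * (2 * theta m ξ)) • branchProj m 1 ξ
        + Complex.exp (-(Complex.I * (2 * theta m ξ))) • branchProj m (-1) ξ := by
  obtain ⟨hsin, hcos⟩ := sin_theta hm ξ
  have hp := discr_pos hm ξ
  have e1 : Complex.exp (Complex.I * (2 * theta m ξ)) =
      Complex.cos (2 * theta m ξ) + Complex.sin (2 * theta m ξ) * Complex.I := by
    rw [← Complex.exp_mul_I]; ring_nf
  have e2 : Complex.exp (-(Complex.I * (2 * theta m ξ))) =
      Complex.cos (2 * theta m ξ) - Complex.sin (2 * theta m ξ) * Complex.I := by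
    rw [show -(Complex.I * (2 * theta m ξ)) = (-(2 * theta m ξ)) * Complex.I by ring,
      Complex.exp_mul_I, Complex.cos_neg, Complex.sin_neg]
    ring
  rw [e1, e2]
  unfold branchProj branchGen diracExp
  rw [omegaFreq_neg_mass]
  set D := Real.sqrt (m ^ 2 + ξ ^ 2 * Real.cos (omegaFreq m ξ) ^ 2) with hD
  set w := omegaFreq m ξ with hw
  have hD0 : (D : ℂ) ≠ 0 := by exact_mod_cast (Real.sqrt_pos.2 hp).ne'
  have hw0 : (w : ℂ) ≠ 0 := by exact_mod_cast (omegaFreq_pos hm ξ).ne'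
  have hw2 : (w : ℂ) ^ 2 = m ^ 2 + ξ ^ 2 := by exact_mod_cast omegaFreq_sq m ξ
  have hc : Complex.cos (2 * theta m ξ) = 1 - 2 * (ξ * Complex.sin w / w) ^ 2 := by
    rw [Complex.cos_two_mul, Complex.cos_sq', ← Complex.ofReal_sin, hsin]
    push_cast
    ring
  have hs : Complex.sin (2 * theta m ξ) = 2 * (ξ * Complex.sin w / w) * (D / w) := by
    rw [Complex.sin_two_mul, ← Complex.ofReal_sin, hsin, ← Complex.ofReal_cos, hcos]
    push_cast
    ring
  have h2 := Complex.sin_sq_add_cos_sq w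
  rw [hc, hs]
  ext i j
  fin_cases i <;> fin_cases j <;>
    simp [diracSymbol, pauli1, pauli3, Matrix.mul_apply, Fin.sum_univ_two] <;> field_simp <;>
    ring_nf <;> simp only [Complex.I_sq] <;> ring_nf
  all_goals
    linear_combination (2 * D * w ^ 2 : ℂ) * h2 - (2 * D * Complex.sin w ^ 2 : ℂ) * hw2

theorem monodromySymbol_pow {m : ℝ} (hm : m ≠ 0) (ξ : ℝ) (n : ℕ) :
    (diracExp (-m) 1 ξ * diracExp m 1 ξ) ^ n =
      Complex.exp (Complex.I * (n * (2 * theta m ξ))) • branchProj m 1 ξ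
        + Complex.exp (Complex.I * (n * (-2 * theta m ξ))) • branchProj m (-1) ξ := by
  induction n with
  | zero => simp [branchProj_add_neg]
  | succ n ih =>
    have h1 := branchProj_mul_self hm (ε := 1) (by norm_num) ξ
    have h2 := branchProj_mul_self hm (ε := -1) (by norm_num) ξ
    have h3 := branchProj_mul_neg hm (ε := 1) (by norm_num) ξ
    have h4 := branchProj_mul_neg hm (ε := -1) (by norm_num) ξ
    rw [neg_neg] at h4
    rw [pow_succ, ih, monodromySymbol_eq hm]
    simp only [add_mul, mul_add, smul_mul_smul_comm, h1, h2, h3, h4, smul_zero, add_zero, zero_add,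
      ← Complex.exp_add]
    congr 3 <;> push_cast <;> ring

theorem branchGen_zero {m : ℝ} (hm : 0 < m) : branchGen m 0 =
    !![(Real.cos m : ℂ), -Complex.I * (Real.sin m : ℂ);
      Complex.I * (Real.sin m : ℂ), -(Real.cos m : ℂ)] := by
  have h1 : omegaFreq m 0 = m := by simp [omegaFreq, Real.sqrt_sq hm.le]
  have h2 : Real.sqrt (m ^ 2 + 0 ^ 2 * Real.cos m ^ 2) = m := by simp [Real.sqrt_sq hm.le]
  rw [branchGen, h1, h2]
  simp only [mul_div_cancel_left₀ _ hm.ne']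

theorem polarization_eq_branchProj {m : ℝ} (hm : 0 < m) (hs : Real.sin m ≠ 0) (ε : ℝ) :
    polarization m ε = branchProj m ε 0 := by
  rw [polarization, if_neg hs, branchProj, branchGen_zero hm]
  congr 1
  ext i j
  fin_cases i <;> fin_cases j <;> simp <;> ring

end Propagator

/-! ### Smoothness of the symbols -/

section MatrixSymbols

/-- Two by two matrices as operators on `ℂ²`. -/
noncomputable abbrev matrixOp : Matrix (Fin 2) (Fin 2) ℂ ≃⋆ₐ[ℂ] (Spinor →L[ℂ] Spinor) :=
  Matrix.toEuclideanCLM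

theorem matrixOp_apply (A : Matrix (Fin 2) (Fin 2) ℂ) (v : Spinor) :
    matrixOp A v = Matrix.toEuclideanLin A v := rfl

theorem contDiff_matrixOp {X : Type*} [NormedAddCommGroup X] [NormedSpace ℝ X] {n : WithTop ℕ∞}
    {A : X → Matrix (Fin 2) (Fin 2) ℂ} (hA : ∀ i j, ContDiff ℝ n (fun x => A x i j)) :
    ContDiff ℝ n (fun x => matrixOp (A x)) := by
  have h : (fun x => matrixOp (A x)) = fun x =>
      ∑ i, ∑ j, A x i j • matrixOp (Matrix.single i j (1 : ℂ)) := by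
    funext x
    conv_lhs => rw [Matrix.matrix_eq_sum_single (A x)]
    simp only [map_sum]
    refine Finset.sum_congr rfl fun i _ => Finset.sum_congr rfl fun j _ => ?_
    rw [← map_smul, Matrix.smul_single, smul_eq_mul, mul_one]
  rw [h]
  exact ContDiff.sum fun i _ => ContDiff.sum fun j _ => (hA i j).smul contDiff_const

/-- The mass keeps the radicand away from `0`; for `m = 0` the function would be `|ξ|`. -/
theorem contDiff_omegaFreq {m : ℝ} (hm : m ≠ 0) {n : WithTop ℕ∞} :
    ContDiff ℝ n (omegaFreq m) := by
  unfold omegaFreq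
  exact (contDiff_const.add (contDiff_id.pow 2)).sqrt fun ξ => by positivity

theorem contDiff_discr {m : ℝ} (hm : m ≠ 0) {n : WithTop ℕ∞} :
    ContDiff ℝ n (fun ξ => Real.sqrt (m ^ 2 + ξ ^ 2 * Real.cos (omegaFreq m ξ) ^ 2)) :=
  (contDiff_const.add ((contDiff_id.pow 2).mul
    ((Real.contDiff_cos.comp (contDiff_omegaFreq hm)).pow 2))).sqrt fun ξ => (discr_pos hm ξ).ne'

theorem contDiff_theta {m : ℝ} (hm : m ≠ 0) {n : WithTop ℕ∞} : ContDiff ℝ n (theta m) :=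
  Real.contDiff_arctan.comp ((contDiff_id.mul (Real.contDiff_sin.comp (contDiff_omegaFreq hm))).div
    (contDiff_discr hm) fun ξ => (Real.sqrt_pos.2 (discr_pos hm ξ)).ne')

/-- Oddness forces `θ''(0) = 0`, which turns the stationary point at `0` into a cubic one. -/
theorem theta_neg (m ξ : ℝ) : theta m (-ξ) = -theta m ξ := by
  have h : omegaFreq m (-ξ) = omegaFreq m ξ := by simp [omegaFreq]
  rw [theta, theta, h, neg_mul, neg_sq, neg_div, Real.arctan_neg]

theorem contDiff_branchProj {m : ℝ} (hm : m ≠ 0) (ε : ℝ) {n : WithTop ℕ∞} :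
    ContDiff ℝ n (fun ξ => matrixOp (branchProj m ε ξ)) := by
  have hD : ∀ ξ, Real.sqrt (m ^ 2 + ξ ^ 2 * Real.cos (omegaFreq m ξ) ^ 2) ≠ 0 :=
    fun ξ => (Real.sqrt_pos.2 (discr_pos hm ξ)).ne'
  have ha : ContDiff ℝ n (fun ξ => ((omegaFreq m ξ * Real.cos (omegaFreq m ξ) /
        Real.sqrt (m ^ 2 + ξ ^ 2 * Real.cos (omegaFreq m ξ) ^ 2) : ℝ) : ℂ)) :=
    Complex.ofRealCLM.contDiff.comp (((contDiff_omegaFreq hm).mul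
      (Real.contDiff_cos.comp (contDiff_omegaFreq hm))).div (contDiff_discr hm) hD)
  have hb : ContDiff ℝ n (fun ξ => ((m * Real.sin (omegaFreq m ξ) /
        Real.sqrt (m ^ 2 + ξ ^ 2 * Real.cos (omegaFreq m ξ) ^ 2) : ℝ) : ℂ)) :=
    Complex.ofRealCLM.contDiff.comp ((contDiff_const.mul
      (Real.contDiff_sin.comp (contDiff_omegaFreq hm))).div (contDiff_discr hm) hD)
  have hN : ContDiff ℝ n (fun ξ => matrixOp (branchGen m ξ)) := by
    refine contDiff_matrixOp fun i j => ?_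
    fin_cases i <;> fin_cases j
    · exact ha
    · exact contDiff_const.mul hb
    · exact contDiff_const.mul hb
    · exact ha.neg
  simp only [branchProj, map_smul, map_add]
  exact (contDiff_const.add (hN.const_smul _)).const_smul _

theorem contDiff_diracExp {μ : ℝ} (hμ : μ ≠ 0) {n : WithTop ℕ∞} :
    ContDiff ℝ n (fun p : ℝ × ℝ => matrixOp (diracExp μ p.1 p.2)) := by
  have hw : ContDiff ℝ n (fun p : ℝ × ℝ => omegaFreq μ p.2) :=
    (contDiff_omegaFreq hμ).comp contDiff_snd
  have hc : ContDiff ℝ n (fun p : ℝ × ℝ => (Real.cos (p.1 * omegaFreq μ p.2) : ℂ)) :=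
    Complex.ofRealCLM.contDiff.comp (Real.contDiff_cos.comp (contDiff_fst.mul hw))
  have hs : ContDiff ℝ n
      (fun p : ℝ × ℝ => ((Real.sin (p.1 * omegaFreq μ p.2) / omegaFreq μ p.2 : ℝ) : ℂ)) :=
    Complex.ofRealCLM.contDiff.comp ((Real.contDiff_sin.comp (contDiff_fst.mul hw)).div hw
      fun p => (omegaFreq_pos hμ p.2).ne')
  have hx : ContDiff ℝ n (fun p : ℝ × ℝ => (p.2 : ℂ)) :=
    Complex.ofRealCLM.contDiff.comp contDiff_snd
  simp only [diracExp, diracSymbol, map_smul, map_sub, map_add, map_one]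
  exact (hc.smul contDiff_const).sub ((contDiff_const.mul hs).smul
    ((hx.neg.smul contDiff_const).add contDiff_const))

end MatrixSymbols

/-! ### The Fourier formulas solve the equation -/

section DiracFlow

/-- Smoothness is over `ℝ` while the operators are `ℂ`-linear, hence the detour through restriction
of scalars. -/
theorem ContDiff.complex_clm_apply {X E F : Type*} [NormedAddCommGroup X] [NormedSpace ℝ X]
    [NormedAddCommGroup E] [NormedSpace ℂ E] [NormedAddCommGroup F] [NormedSpace ℂ F]
    {n : WithTop ℕ∞} {A : X → E →L[ℂ] F} {v : X → E} (hA : ContDiff ℝ n A) (hv : ContDiff ℝ n v) :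
    ContDiff ℝ n fun x => A x (v x) :=
  ((ContinuousLinearMap.restrictScalarsL ℂ E F ℝ ℝ).contDiff.comp hA).clm_apply hv

variable {δ : ℝ} {g h : ℝ → Spinor}

theorem diracFlow_eq_invFourierT (hg : IsBandProfile δ g h) {μ : ℝ} (hμ : μ ≠ 0) (t : ℝ) :
    diracFlow μ t g = invFourierT (fun ξ => matrixOp (diracExp μ t ξ) (h ξ)) := by
  funext x
  simp only [diracFlow, invFourierT, hg.fourierT_eq, exp_diracSymbol hμ, matrixOp_apply]

theorem IsBandProfile.diracFlow (hg : IsBandProfile δ g h) {μ : ℝ} (hμ : μ ≠ 0) (t : ℝ) :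
    IsBandProfile δ (diracFlow μ t g) (fun ξ => matrixOp (diracExp μ t ξ) (h ξ)) where
  smooth := ((contDiff_diracExp hμ).comp (contDiff_const.prodMk contDiff_id)).complex_clm_apply hg.smooth
  support ξ hξ := by rw [hg.support ξ hξ, map_zero]
  eq_inv := diracFlow_eq_invFourierT hg hμ t

theorem IsBandProfile.diracFlow_zero (hg : IsBandProfile δ g h) {μ : ℝ} (hμ : μ ≠ 0) :
    _root_.diracFlow μ 0 g = g := by
  rw [diracFlow_eq_invFourierT hg hμ]
  conv_rhs => rw [hg.eq_inv]
  congr 1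
  funext ξ
  simp [diracExp]

theorem IsBandProfile.monodromy_iterate (hg : IsBandProfile δ g h) {m : ℝ} (hm : m ≠ 0) (n : ℕ) :
    IsBandProfile δ ((monodromy m)^[n] g)
      (fun ξ => matrixOp ((diracExp (-m) 1 ξ * diracExp m 1 ξ) ^ n) (h ξ)) := by
  induction n with
  | zero => simpa using hg
  | succ n ih =>
    rw [Function.iterate_succ_apply']
    have := (ih.diracFlow hm 1).diracFlow (neg_ne_zero.2 hm) 1
    simp only [pow_succ', map_mul, mul_apply_eq_comp] at this ⊢
    exact this

theorem diracFlow_eq_intervalIntegral (hδ : 0 < δ) (hg : IsBandProfile δ g h) {μ : ℝ} (hμ : μ ≠ 0)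
    (t x : ℝ) :
    diracFlow μ t g x = (1 / (2 * (Real.pi : ℂ))) • ∫ ξ in (-δ)..δ,
      Complex.exp (Complex.I * ξ * x) • matrixOp (diracExp μ t ξ) (h ξ) := by
  rw [diracFlow_eq_invFourierT hg hμ, invFourierT_eq_intervalIntegral hδ]
  intro ξ hξ
  rw [hg.support ξ hξ, map_zero]

theorem continuous_matrixOp_diracExp {μ : ℝ} (hμ : μ ≠ 0) {X : Type*} [TopologicalSpace X]
    {s ξ : X → ℝ} (hs : Continuous s) (hξ : Continuous ξ) {v : X → Spinor} (hv : Continuous v) :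
    Continuous fun p => matrixOp (diracExp μ (s p) (ξ p)) (v p) :=
  ((contDiff_diracExp hμ (n := 0)).continuous.comp (hs.prodMk hξ)).clm_apply hv

theorem continuous_diracFlow (hδ : 0 < δ) (hg : IsBandProfile δ g h) {μ : ℝ} (hμ : μ ≠ 0) :
    Continuous (fun p : ℝ × ℝ => diracFlow μ p.1 g p.2) := by
  simp only [diracFlow_eq_intervalIntegral hδ hg hμ]
  have hh := hg.smooth.continuous
  have hexp : Continuous fun q : (ℝ × ℝ) × ℝ => Complex.exp (Complex.I * q.2 * q.1.2) := by
    fun_prop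
  have hF : Continuous (Function.uncurry fun (p : ℝ × ℝ) (ξ : ℝ) =>
      Complex.exp (Complex.I * ξ * p.2) • matrixOp (diracExp μ p.1 ξ) (h ξ)) :=
    hexp.smul (continuous_matrixOp_diracExp hμ (by fun_prop) (by fun_prop) (by fun_prop))
  exact (intervalIntegral.continuous_parametric_intervalIntegral_of_continuous' (μ := volume)
    hF (-δ) δ).const_smul (1 / (2 * (Real.pi : ℂ)))

theorem diracSymbol_mul_self (μ ξ : ℝ) :
    diracSymbol μ ξ * diracSymbol μ ξ = ((omegaFreq μ ξ : ℂ) ^ 2) • 1 := by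
  have hw2 : (omegaFreq μ ξ : ℂ) ^ 2 = μ ^ 2 + ξ ^ 2 := by exact_mod_cast omegaFreq_sq μ ξ
  rw [hw2]
  ext i j
  fin_cases i <;> fin_cases j <;>
    simp [diracSymbol, pauli1, pauli3, Matrix.mul_apply, Fin.sum_univ_two] <;> ring

/-- Because `H² = ω²`, the derivative `-ω sin(sω) - i cos(sω) H` of the closed form equals `-iH`
times the closed form. -/
theorem hasDerivAt_diracExp {μ : ℝ} (hμ : μ ≠ 0) (s ξ : ℝ) (v : Spinor) :
    HasDerivAt (fun s => matrixOp (diracExp μ s ξ) v)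
      (-Complex.I • matrixOp (diracSymbol μ ξ) (matrixOp (diracExp μ s ξ) v)) s := by
  have hw : (omegaFreq μ ξ : ℂ) ≠ 0 := by exact_mod_cast (omegaFreq_pos hμ ξ).ne'
  have hlin : HasDerivAt (fun s : ℝ => s * omegaFreq μ ξ) (omegaFreq μ ξ) s := by
    simpa using (hasDerivAt_id s).mul_const (omegaFreq μ ξ)
  have hc := (hlin.cos.ofReal_comp).smul_const v
  have hs := (((hlin.sin.div_const (omegaFreq μ ξ)).ofReal_comp).const_mul Complex.I).smul_const
    (matrixOp (diracSymbol μ ξ) v)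
  have hrep : (fun s => matrixOp (diracExp μ s ξ) v) = fun s =>
      ((Real.cos (s * omegaFreq μ ξ) : ℝ) : ℂ) • v
        - (Complex.I * ((Real.sin (s * omegaFreq μ ξ) / omegaFreq μ ξ : ℝ) : ℂ)) •
          matrixOp (diracSymbol μ ξ) v := by
    funext s
    simp [diracExp]
  rw [hrep]
  refine (hc.sub hs).congr_deriv ?_
  rw [congrFun hrep s, map_sub, map_smul, map_smul, ← mul_apply_eq_comp, ← map_mul,
    diracSymbol_mul_self, map_smul, map_one, smul_apply,
    one_apply_eq_self, smul_sub, smul_smul, smul_smul, smul_smul]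
  rw [sub_eq_add_neg, ← neg_smul, sub_eq_neg_add, ← neg_smul]
  congr 2
  · push_cast
    field_simp
    linear_combination (-Complex.sin (s * omegaFreq μ ξ)) * Complex.I_sq
  · push_cast
    field_simp

theorem hasDerivAt_exp_smul (ξ x : ℝ) (v : Spinor) :
    HasDerivAt (fun x : ℝ => Complex.exp (Complex.I * ξ * x) • v)
      (Complex.exp (Complex.I * ξ * x) • (Complex.I * ξ) • v) x := by
  have h1 : HasDerivAt (fun x : ℝ => Complex.I * ξ * x) (Complex.I * ξ) x := by
    simpa using (Complex.ofRealCLM.hasDerivAt (x := x)).const_mul (Complex.I * ξ)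
  refine (h1.cexp.smul_const v).congr_deriv ?_
  rw [smul_smul]

theorem deriv_diracFlow (hδ : 0 < δ) (hg : IsBandProfile δ g h) {μ : ℝ} (hμ : μ ≠ 0)
    (t x : ℝ) :
    deriv (diracFlow μ t g) x = (1 / (2 * (Real.pi : ℂ))) • ∫ ξ in (-δ)..δ,
      Complex.exp (Complex.I * ξ * x) • (Complex.I * ξ) • matrixOp (diracExp μ t ξ) (h ξ) := by
  have hh := hg.smooth.continuous
  have hE : Continuous fun p : ℝ × ℝ => matrixOp (diracExp μ t p.2) (h p.2) :=
    continuous_matrixOp_diracExp hμ (by fun_prop) (by fun_prop) (by fun_prop)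
  have hexp : Continuous fun p : ℝ × ℝ => Complex.exp (Complex.I * p.2 * p.1) := by fun_prop
  have hI : Continuous fun p : ℝ × ℝ => Complex.I * (p.2 : ℂ) := by fun_prop
  rw [funext (diracFlow_eq_intervalIntegral hδ hg hμ t)]
  refine (HasDerivAt.fun_const_smul _ (hasDerivAt_intervalIntegral_of_continuous ?_ ?_
    (fun x ξ => hasDerivAt_exp_smul ξ x _) _ _ x)).deriv
  · exact hexp.smul hE
  · exact hexp.smul (hI.smul hE)

/-- Under the integral `∂ₓ` is multiplication by `iξ`, and `iσ₃ · iξ = -ξσ₃`; so `-iH(ξ)` is the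
symbol of the right-hand side. -/
theorem hasDerivAt_diracFlow (hδ : 0 < δ) (hg : IsBandProfile δ g h) {μ : ℝ} (hμ : μ ≠ 0)
    (t x : ℝ) :
    HasDerivAt (fun s => diracFlow μ s g x)
      ((-Complex.I) • (Complex.I • Matrix.toEuclideanLin pauli3 (deriv (diracFlow μ t g) x)
        + (μ : ℂ) • Matrix.toEuclideanLin pauli1 (diracFlow μ t g x))) t := by
  have hh := hg.smooth.continuous
  have hE : Continuous fun p : ℝ × ℝ => matrixOp (diracExp μ p.1 p.2) (h p.2) :=
    continuous_matrixOp_diracExp hμ (by fun_prop) (by fun_prop) (by fun_prop)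
  have hH : Continuous fun p : ℝ × ℝ => matrixOp (diracSymbol μ p.2) := by
    simp only [diracSymbol, map_add, map_smul]
    fun_prop
  have hE1 : Continuous fun ξ : ℝ => matrixOp (diracExp μ t ξ) (h ξ) :=
    continuous_matrixOp_diracExp hμ (by fun_prop) (by fun_prop) (by fun_prop)
  have hexp : Continuous fun p : ℝ × ℝ => Complex.exp (Complex.I * p.2 * x) := by fun_prop
  rw [funext fun s => diracFlow_eq_intervalIntegral hδ hg hμ s x]
  refine (HasDerivAt.fun_const_smul _ (hasDerivAt_intervalIntegral_of_continuous
    (F := fun s ξ => Complex.exp (Complex.I * ξ * x) • matrixOp (diracExp μ s ξ) (h ξ)) ?_ ?_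
    (fun s ξ => (hasDerivAt_diracExp hμ s ξ (h ξ)).fun_const_smul _) _ _ t)).congr_deriv ?_
  · exact hexp.smul hE
  · exact hexp.smul ((hH.clm_apply hE).const_smul (-Complex.I))
  · rw [deriv_diracFlow hδ hg hμ, diracFlow_eq_intervalIntegral hδ hg hμ, ← matrixOp_apply,
      ← matrixOp_apply, map_smul, map_smul, smul_comm Complex.I, smul_comm (μ : ℂ), ← smul_add,
      smul_comm (-Complex.I)]
    congr 1
    rw [← ContinuousLinearMap.intervalIntegral_comp_comm,
      ← ContinuousLinearMap.intervalIntegral_comp_comm, ← intervalIntegral.integral_smul,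
      ← intervalIntegral.integral_smul, ← intervalIntegral.integral_add,
      ← intervalIntegral.integral_smul]
    · refine intervalIntegral.integral_congr fun ξ _ => ?_
      simp only [diracSymbol, map_add, map_smul, add_apply,
        smul_apply, smul_add, smul_smul]
      congr 2
      linear_combination (Complex.exp (Complex.I * ξ * x) * (-Complex.I) * ξ) * (-Complex.I_sq)
      ring
    all_goals
      apply Continuous.intervalIntegrable
      fun_prop

theorem natFloor_half_eq {t : ℝ} {j : ℕ} (h1 : 2 * (j : ℝ) ≤ t) (h2 : t < 2 * j + 2) :
    ⌊t / 2⌋₊ = j := by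
  rw [Nat.floor_eq_iff (by linarith [Nat.cast_nonneg (α := ℝ) j])]
  constructor <;> linarith

theorem IsBandProfile.switchedFlow_two_mul {m : ℝ} (hm : m ≠ 0) (hg : IsBandProfile δ g h)
    (n : ℕ) : switchedFlow m (2 * n) g = (monodromy m)^[n] g := by
  have h1 : ⌊(2 * n : ℝ) / 2⌋₊ = n := natFloor_half_eq le_rfl (by linarith)
  rw [switchedFlow, h1, sub_self, if_pos one_pos]
  exact (hg.monodromy_iterate hm n).diracFlow_zero hm

/-- On `[k, k + 1]` the solution operator is the constant mass flow started at time `k`. -/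
theorem IsBandProfile.switchedFlow_eq_diracFlow {m : ℝ} (hm : m ≠ 0) (hg : IsBandProfile δ g h)
    (k : ℕ) : ∃ g' h', IsBandProfile δ g' h' ∧ ∀ t ∈ Icc (k : ℝ) (k + 1),
      switchedFlow m t g = _root_.diracFlow (switchingMass m k) (t - k) g' := by
  have hm' := neg_ne_zero.2 hm
  have hfl : ⌊(k : ℝ)⌋ = (k : ℤ) := by simp
  obtain ⟨j, rfl | rfl⟩ := Nat.even_or_odd' k
  · have hP := hg.monodromy_iterate hm j
    have hmass : switchingMass m ((2 * j : ℕ) : ℝ) = m := by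
      rw [switchingMass, hfl, if_pos (by simp)]
    refine ⟨_, _, hP, fun t ht => ?_⟩
    push_cast at ht
    rw [hmass, switchedFlow, natFloor_half_eq ht.1 (by linarith [ht.2])]
    push_cast
    rcases ht.2.lt_or_eq with hlt | rfl
    · rw [if_pos (by linarith)]
    -- At the right endpoint the definition has already switched to mass `-m`, but for zero time.
    · rw [if_neg (by linarith), add_sub_cancel_left, sub_self,
        (hP.diracFlow hm 1).diracFlow_zero hm']
  · have hP := hg.monodromy_iterate hm j
    have hmass : switchingMass m ((2 * j + 1 : ℕ) : ℝ) = -m := by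
      rw [switchingMass, hfl, if_neg (by simp)]
    refine ⟨_, _, hP.diracFlow hm 1, fun t ht => ?_⟩
    push_cast at ht
    rw [hmass]
    rcases ht.2.lt_or_eq with hlt | rfl
    · rw [switchedFlow, natFloor_half_eq (by linarith [ht.1] : 2 * (j : ℝ) ≤ t)
        (by linarith), if_neg (by linarith [ht.1])]
      push_cast
      rw [sub_sub]
    -- At `t = 2j + 2` the count of full periods has jumped to `j + 1`; the last half period
    -- completes one more factor of the monodromy.
    · have := hg.switchedFlow_two_mul hm (j + 1)
      rw [Function.iterate_succ_apply'] at this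
      push_cast at this ⊢
      rw [show (2 * (j : ℝ) + 1 + 1) = 2 * (j + 1) by ring, this, monodromy]
      congr 1
      ring

theorem switchingMass_ne_zero {m : ℝ} (hm : m ≠ 0) (t : ℝ) : switchingMass m t ≠ 0 := by
  unfold switchingMass
  split_ifs
  exacts [hm, neg_ne_zero.2 hm]

theorem mem_Icc_floor {t : ℝ} (ht : 0 ≤ t) : t ∈ Icc (⌊t⌋₊ : ℝ) (⌊t⌋₊ + 1) :=
  ⟨Nat.floor_le ht, (Nat.lt_floor_add_one t).le⟩

theorem IsBandProfile.exists_schwartz_switchedFlow {m : ℝ} (hm : m ≠ 0)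
    (hg : IsBandProfile δ g h) {t : ℝ} (ht : 0 ≤ t) :
    ∃ G : 𝓢(ℝ, Spinor), ⇑G = switchedFlow m t g := by
  obtain ⟨g', h', hg', hk⟩ := hg.switchedFlow_eq_diracFlow hm ⌊t⌋₊
  rw [hk t (mem_Icc_floor ht)]
  exact (hg'.diracFlow (switchingMass_ne_zero hm _) _).exists_schwartz

theorem IsBandProfile.isDiracSolution {m : ℝ} (hm : m ≠ 0) (hδ : 0 < δ)
    (hg : IsBandProfile δ g h) : IsDiracSolution m g (fun t => switchedFlow m t g) where
  initial := by
    have := hg.switchedFlow_two_mul hm 0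
    simpa using this
  memLp t ht := by
    obtain ⟨G, hG⟩ := hg.exists_schwartz_switchedFlow hm ht
    rw [← hG]
    exact G.memLp 2
  contDiff t ht := by
    obtain ⟨G, hG⟩ := hg.exists_schwartz_switchedFlow hm ht
    rw [← hG]
    exact G.smooth 1
  continuousOn := by
    -- The closed unit strips form a locally finite cover, and on each of them the flow has constant
    -- mass, so continuity glues across the switching times.
    have hcov : Ici (0 : ℝ) ×ˢ (univ : Set ℝ) ⊆ ⋃ k : ℕ, Icc (k : ℝ) (k + 1) ×ˢ univ := by
      rintro ⟨t, x⟩ ⟨ht, -⟩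
      exact mem_iUnion.2 ⟨⌊t⌋₊, mem_Icc_floor ht, mem_univ _⟩
    refine ContinuousOn.mono (LocallyFinite.continuousOn_iUnion ?_ ?_ ?_) hcov
    · rintro ⟨t, x⟩
      refine ⟨Iio (t + 1) ×ˢ univ, (isOpen_Iio.prod isOpen_univ).mem_nhds
        ⟨by simp, mem_univ _⟩, (finite_lt_nat (⌈t + 1⌉₊)).subset ?_⟩
      rintro k ⟨⟨s, y⟩, ⟨hs, -⟩, ⟨hs', -⟩⟩
      exact Nat.lt_ceil.2 (lt_of_le_of_lt hs.1 hs')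
    · exact fun k => isClosed_Icc.prod isClosed_univ
    · intro k
      obtain ⟨g', h', hg', hk⟩ := hg.switchedFlow_eq_diracFlow hm k
      have hc := (continuous_diracFlow hδ hg' (switchingMass_ne_zero hm k)).comp
        ((continuous_fst.sub continuous_const).prodMk continuous_snd :
          Continuous fun p : ℝ × ℝ => (p.1 - (k : ℝ), p.2))
      refine hc.continuousOn.congr ?_
      rintro ⟨t, x⟩ ⟨ht, -⟩
      exact congrFun (hk t ht) x
  equation t ht x := by
    obtain ⟨g', h', hg', hk⟩ := hg.switchedFlow_eq_diracFlow hm ⌊t⌋₊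
    have hmass : switchingMass m t = switchingMass m ((⌊t⌋₊ : ℕ) : ℝ) := by
      simp only [switchingMass, Int.floor_natCast, Int.natCast_floor_eq_floor ht]
    rw [hmass, hk t (mem_Icc_floor ht)]
    have h1 : HasDerivAt (fun s : ℝ => s - (⌊t⌋₊ : ℝ)) 1 t := (hasDerivAt_id t).sub_const _
    have h2 := (hasDerivAt_diracFlow hδ hg' (switchingMass_ne_zero hm (⌊t⌋₊ : ℝ))
      (t - ⌊t⌋₊) x).scomp t h1
    rw [one_smul] at h2
    refine h2.hasDerivWithinAt.congr_of_eventuallyEq ?_ (congrFun (hk t (mem_Icc_floor ht)) x)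
    -- Only times to the right of `t` in the same unit interval matter for the one-sided derivative,
    -- so the jump of the mass is never seen.
    filter_upwards [Ico_mem_nhdsGE (Nat.lt_floor_add_one t)] with s hs
    exact congrFun (hk s ⟨(Nat.floor_le ht).trans hs.1, hs.2.le⟩) x

theorem IsBandProfile.monodromy_iterate_apply {m : ℝ} (hm : m ≠ 0) (hδ : 0 < δ)
    (hg : IsBandProfile δ g h) (n : ℕ) (x : ℝ) :
    (monodromy m)^[n] g x = (1 / (2 * (Real.pi : ℂ))) • ∫ ξ in (-δ)..δ,
      Complex.exp (Complex.I * ξ * x) •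
        matrixOp ((diracExp (-m) 1 ξ * diracExp m 1 ξ) ^ n) (h ξ) := by
  have hP := hg.monodromy_iterate hm n
  rw [hP.eq_inv, invFourierT_eq_intervalIntegral hδ hP.support]

end DiracFlow

/-! ### Van der Corput estimates -/

section VanDerCorput

theorem hasDerivAt_cexp_I_mul {φ : ℝ → ℝ} {φ' x : ℝ} (h : HasDerivAt φ φ' x) :
    HasDerivAt (fun x => Complex.exp (Complex.I * φ x))
      (Complex.I * φ' * Complex.exp (Complex.I * φ x)) x := by
  refine ((h.ofReal_comp.const_mul Complex.I).cexp).congr_deriv ?_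
  ring

theorem HasDerivAt.comp_neg_arg {E : Type*} [NormedAddCommGroup E] [NormedSpace ℝ E] {f : ℝ → E}
    {f' : E} {x : ℝ} (h : HasDerivAt f f' (-x)) : HasDerivAt (fun x => f (-x)) (-f') x := by
  have := h.scomp x (hasDerivAt_neg x)
  rwa [neg_one_smul] at this

theorem continuous_cexp_I_mul {φ : ℝ → ℝ} (h : Continuous φ) :
    Continuous fun x => Complex.exp (Complex.I * φ x) := by fun_prop

theorem norm_intervalIntegral_cexp_le_length {φ : ℝ → ℝ} {a b : ℝ} (hab : a ≤ b) :
    ‖∫ x in a..b, Complex.exp (Complex.I * φ x)‖ ≤ b - a := by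
  have := intervalIntegral.norm_integral_le_of_norm_le_const (a := a) (b := b) (C := 1)
    (f := fun x => Complex.exp (Complex.I * φ x))
    (fun x _ => (Complex.norm_exp_I_mul_ofReal _).le)
  rwa [one_mul, abs_of_nonneg (by linarith)] at this

/-- The first derivative test for oscillatory integrals with monotone phase derivative. -/
theorem norm_intervalIntegral_cexp_le_of_deriv {φ φ' φ'' : ℝ → ℝ} {a b l : ℝ} (hab : a ≤ b)
    (hl : 0 < l) (hφ : ∀ x, HasDerivAt φ (φ' x) x) (hφ' : ∀ x, HasDerivAt φ' (φ'' x) x)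
    (hc : Continuous φ'') (h1 : ∀ x ∈ Icc a b, l ≤ φ' x) (h2 : ∀ x ∈ Icc a b, 0 ≤ φ'' x) :
    ‖∫ x in a..b, Complex.exp (Complex.I * φ x)‖ ≤ 2 / l := by
  have hφc : Continuous φ := continuous_iff_continuousAt.2 fun x => (hφ x).continuousAt
  have hφ'c : Continuous φ' := continuous_iff_continuousAt.2 fun x => (hφ' x).continuousAt
  have hpos : ∀ x ∈ Icc a b, 0 < φ' x := fun x hx => hl.trans_le (h1 x hx)
  have hu : uIcc a b = Icc a b := uIcc_of_le hab
  have hinv : ∀ x ∈ uIcc a b, HasDerivAt (fun x => (φ' x)⁻¹) (-φ'' x / φ' x ^ 2) x :=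
    fun x hx => (hφ' x).fun_inv (hpos x (hu ▸ hx)).ne'
  have hci : ContinuousOn (fun x => -φ'' x / φ' x ^ 2) (uIcc a b) :=
    hc.neg.continuousOn.div (hφ'c.pow 2).continuousOn
      fun x hx => (pow_pos (hpos x (hu ▸ hx)) 2).ne'
  have hparts := intervalIntegral.integral_mul_deriv_eq_deriv_mul
    (u := fun x => (((φ' x)⁻¹ : ℝ) : ℂ)) (u' := fun x => ((-φ'' x / φ' x ^ 2 : ℝ) : ℂ))
    (fun x hx => (hinv x hx).ofReal_comp)
    (fun x _ => hasDerivAt_cexp_I_mul (hφ x))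
    (Complex.continuous_ofReal.comp_continuousOn hci).intervalIntegrable
    (Continuous.intervalIntegrable (by fun_prop) _ _)
  have hlhs : ∫ x in a..b, (((φ' x)⁻¹ : ℝ) : ℂ) * (Complex.I * φ' x * Complex.exp (Complex.I * φ x))
      = Complex.I * ∫ x in a..b, Complex.exp (Complex.I * φ x) := by
    rw [← intervalIntegral.integral_const_mul]
    refine intervalIntegral.integral_congr fun x hx => ?_
    have : (φ' x : ℂ) ≠ 0 := by exact_mod_cast (hpos x (hu ▸ hx)).ne'
    push_cast
    field_simp
  rw [hlhs] at hparts
  -- `1/φ'` is decreasing, so its variation telescopes to `1/φ'(a) - 1/φ'(b)`. With the boundary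
  -- terms the total is `2/φ'(a)`.
  have hI : ‖∫ x in a..b, ((-φ'' x / φ' x ^ 2 : ℝ) : ℂ) * Complex.exp (Complex.I * φ x)‖
      ≤ ∫ x in a..b, -(-φ'' x / φ' x ^ 2) := by
    refine intervalIntegral.norm_integral_le_of_norm_le hab (.of_forall fun x hx => ?_)
      hci.intervalIntegrable.neg
    rw [norm_mul, Complex.norm_exp_I_mul_ofReal, mul_one, Complex.norm_real, Real.norm_eq_abs,
      abs_of_nonpos]
    have := h2 x (Ioc_subset_Icc_self hx)
    rw [neg_div]
    exact neg_nonpos.2 (by positivity)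
  rw [intervalIntegral.integral_neg, intervalIntegral.integral_eq_sub_of_hasDerivAt hinv
    hci.intervalIntegrable] at hI
  have hn := congrArg norm hparts
  rw [norm_mul, Complex.norm_I, one_mul] at hn
  rw [hn]
  have hb := hpos b (right_mem_Icc.2 hab)
  have ha := hpos a (left_mem_Icc.2 hab)
  have e1 : ‖(((φ' b)⁻¹ : ℝ) : ℂ) * Complex.exp (Complex.I * φ b)‖ = (φ' b)⁻¹ := by
    rw [norm_mul, Complex.norm_exp_I_mul_ofReal, mul_one, Complex.norm_real, Real.norm_eq_abs,
      abs_of_pos (inv_pos.2 hb)]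
  have e2 : ‖(((φ' a)⁻¹ : ℝ) : ℂ) * Complex.exp (Complex.I * φ a)‖ = (φ' a)⁻¹ := by
    rw [norm_mul, Complex.norm_exp_I_mul_ofReal, mul_one, Complex.norm_real, Real.norm_eq_abs,
      abs_of_pos (inv_pos.2 ha)]
  refine (norm_sub_le _ _).trans ((add_le_add (norm_sub_le _ _) hI).trans ?_)
  rw [e1, e2]
  have : (φ' a)⁻¹ ≤ l⁻¹ := inv_anti₀ hl (h1 a (left_mem_Icc.2 hab))
  rw [div_eq_mul_inv]
  linarith

/-- The second derivative test, for a phase that increases on the interval. -/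
theorem norm_intervalIntegral_cexp_le_of_deriv_nonneg {φ φ' φ'' : ℝ → ℝ} {a b l : ℝ} (hab : a ≤ b)
    (hl : 0 < l) (hφ : ∀ x, HasDerivAt φ (φ' x) x) (hφ' : ∀ x, HasDerivAt φ' (φ'' x) x)
    (hc : Continuous φ'') (h1 : 0 ≤ φ' a) (h2 : ∀ x ∈ Icc a b, l ≤ φ'' x) :
    ‖∫ x in a..b, Complex.exp (Complex.I * φ x)‖ ≤ 3 / Real.sqrt l := by
  have hs : 0 < Real.sqrt l := Real.sqrt_pos.2 hl
  have hsl : Real.sqrt l * Real.sqrt l = l := Real.mul_self_sqrt hl.le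
  have hφc : Continuous φ := continuous_iff_continuousAt.2 fun x => (hφ x).continuousAt
  have hφ'c : Continuous φ' := continuous_iff_continuousAt.2 fun x => (hφ' x).continuousAt
  -- The first piece, of length `1/√l`, is bounded trivially. Beyond it `φ' ≥ √l`, and the first
  -- derivative test adds `2/√l`.
  rcases le_total b (a + 1 / Real.sqrt l) with hb | hb
  · refine (norm_intervalIntegral_cexp_le_length hab).trans ?_
    have : 1 / Real.sqrt l ≤ 3 / Real.sqrt l := by gcongr; norm_num
    linarith
  · have hac : a ≤ a + 1 / Real.sqrt l := by
      have := (one_div_pos.2 hs).le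
      linarith
    have hint : ∀ c d, IntervalIntegrable (fun x => Complex.exp (Complex.I * φ x)) volume c d :=
      fun c d => (continuous_cexp_I_mul hφc).intervalIntegrable c d
    rw [← intervalIntegral.integral_add_adjacent_intervals (hint a (a + 1 / Real.sqrt l)) (hint _ b)]
    have hlow : ∀ x ∈ Icc a b, l * (x - a) ≤ φ' x := by
      have hmono : MonotoneOn (fun x => φ' x - l * x) (Icc a b) := by
        have hd : ∀ x, HasDerivAt (fun x => φ' x - l * x) (φ'' x - l) x := fun x => by
          simpa using (hφ' x).fun_sub ((hasDerivAt_id x).const_mul l)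
        refine monotoneOn_of_deriv_nonneg (convex_Icc a b) (by fun_prop)
          (fun x _ => (hd x).differentiableAt.differentiableWithinAt) fun x hx => ?_
        rw [(hd x).deriv]
        linarith [h2 x (interior_subset hx)]
      intro x hx
      have := hmono (left_mem_Icc.2 hab) hx hx.1
      simp only at this
      linarith
    have hfirst := norm_intervalIntegral_cexp_le_length (φ := φ) hac
    have hsecond := norm_intervalIntegral_cexp_le_of_deriv hb hs hφ hφ' hc (fun x hx => by
      refine le_trans ?_ (hlow x ⟨hac.trans hx.1, hx.2⟩)
      calc Real.sqrt l = l * (1 / Real.sqrt l) := by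
            rw [mul_one_div, eq_div_iff hs.ne', hsl]
        _ ≤ l * (x - a) := by
            refine mul_le_mul_of_nonneg_left ?_ hl.le
            linarith [hx.1])
      (fun x hx => hl.le.trans (h2 x ⟨hac.trans hx.1, hx.2⟩))
    refine (norm_add_le _ _).trans ((add_le_add hfirst hsecond).trans (le_of_eq ?_))
    ring

theorem norm_intervalIntegral_cexp_le_of_deriv_nonpos {φ φ' φ'' : ℝ → ℝ} {a b l : ℝ} (hab : a ≤ b)
    (hl : 0 < l) (hφ : ∀ x, HasDerivAt φ (φ' x) x) (hφ' : ∀ x, HasDerivAt φ' (φ'' x) x)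
    (hc : Continuous φ'') (h1 : φ' b ≤ 0) (h2 : ∀ x ∈ Icc a b, l ≤ φ'' x) :
    ‖∫ x in a..b, Complex.exp (Complex.I * φ x)‖ ≤ 3 / Real.sqrt l := by
  have h := norm_intervalIntegral_cexp_le_of_deriv_nonneg (φ := fun x => φ (-x))
    (φ' := fun x => -φ' (-x)) (φ'' := fun x => φ'' (-x)) (neg_le_neg hab) hl
    (fun x => (hφ (-x)).comp_neg_arg)
    (fun x => by simpa using (hφ' (-x)).comp_neg_arg.fun_neg)
    (by fun_prop) (by simpa using h1) (fun x hx => h2 _ ⟨by linarith [hx.2], by linarith [hx.1]⟩)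
  rwa [intervalIntegral.integral_comp_neg (fun x => Complex.exp (Complex.I * φ x)), neg_neg,
    neg_neg] at h

/-- The second derivative test of van der Corput. -/
theorem norm_intervalIntegral_cexp_le_of_deriv2 {φ φ' φ'' : ℝ → ℝ} {a b l : ℝ} (hab : a ≤ b)
    (hl : 0 < l) (hφ : ∀ x, HasDerivAt φ (φ' x) x) (hφ' : ∀ x, HasDerivAt φ' (φ'' x) x)
    (hc : Continuous φ'') (h2 : ∀ x ∈ Icc a b, l ≤ φ'' x) :
    ‖∫ x in a..b, Complex.exp (Complex.I * φ x)‖ ≤ 6 / Real.sqrt l := by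
  have hs : 0 < Real.sqrt l := Real.sqrt_pos.2 hl
  have hφc : Continuous φ := continuous_iff_continuousAt.2 fun x => (hφ x).continuousAt
  have hφ'c : Continuous φ' := continuous_iff_continuousAt.2 fun x => (hφ' x).continuousAt
  have h36 : 3 / Real.sqrt l ≤ 6 / Real.sqrt l := by gcongr; norm_num
  rcases le_total 0 (φ' a) with ha | ha
  · exact (norm_intervalIntegral_cexp_le_of_deriv_nonneg hab hl hφ hφ' hc ha h2).trans h36
  rcases le_total (φ' b) 0 with hb | hb
  · exact (norm_intervalIntegral_cexp_le_of_deriv_nonpos hab hl hφ hφ' hc hb h2).trans h36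
  obtain ⟨c, hcab, hc0⟩ := intermediate_value_Icc hab hφ'c.continuousOn ⟨ha, hb⟩
  have hint : ∀ c d, IntervalIntegrable (fun x => Complex.exp (Complex.I * φ x)) volume c d :=
    fun c d => (continuous_cexp_I_mul hφc).intervalIntegrable c d
  rw [← intervalIntegral.integral_add_adjacent_intervals (hint a c) (hint c b)]
  have e1 := norm_intervalIntegral_cexp_le_of_deriv_nonpos hcab.1 hl hφ hφ' hc hc0.le
    fun x hx => h2 x ⟨hx.1, hx.2.trans hcab.2⟩
  have e2 := norm_intervalIntegral_cexp_le_of_deriv_nonneg hcab.2 hl hφ hφ' hc hc0.ge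
    fun x hx => h2 x ⟨hcab.1.trans hx.1, hx.2⟩
  refine (norm_add_le _ _).trans ((add_le_add e1 e2).trans (le_of_eq ?_))
  ring

theorem norm_intervalIntegral_cexp_neg (φ : ℝ → ℝ) (a b : ℝ) :
    ‖∫ x in a..b, Complex.exp (Complex.I * (-φ x : ℝ))‖
      = ‖∫ x in a..b, Complex.exp (Complex.I * φ x)‖ := by
  rw [← RCLike.norm_conj (∫ x in a..b, Complex.exp (Complex.I * φ x)),
    ← intervalIntegral.intervalIntegral_conj]
  congr 1
  refine intervalIntegral.integral_congr fun x _ => ?_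
  simp only [← Complex.exp_conj, map_mul, Complex.conj_I, Complex.conj_ofReal]
  push_cast
  ring_nf

/-- Cube root decay for a phase `yξ + τφ(ξ)` whose second derivative vanishes only at `0`,
to first order. -/
theorem norm_intervalIntegral_cexp_le_cube_root {φ φ' φ'' : ℝ → ℝ} {δ c : ℝ} (hc : 0 < c)
    (hφ : ∀ x, HasDerivAt φ (φ' x) x) (hφ' : ∀ x, HasDerivAt φ' (φ'' x) x)
    (hcont : Continuous φ'') (h2 : ∀ x ∈ Icc 0 δ, c * x ≤ φ'' x) {τ : ℝ} (hτ : 0 < τ) (y : ℝ)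
    {b : ℝ} (hb : b ∈ Icc 0 δ) :
    ‖∫ ξ in (0 : ℝ)..b, Complex.exp (Complex.I * (y * ξ + τ * φ ξ : ℝ))‖
      ≤ (1 + 6 / Real.sqrt c) * τ ^ (-(1 / 3) : ℝ) := by
  have hφc : Continuous φ := continuous_iff_continuousAt.2 fun x => (hφ x).continuousAt
  -- The scale at which the trivial bound `r` on `[0, r]` balances the second derivative bound
  -- `6/√(τcr)` on `[r, b]`: here `τr = r⁻²`.
  set r := τ ^ (-(1 / 3) : ℝ) with hr
  have hr0 : 0 < r := Real.rpow_pos_of_pos hτ _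
  have hsc : 0 < Real.sqrt c := Real.sqrt_pos.2 hc
  have h6 : 0 ≤ 6 / Real.sqrt c * r := by positivity
  rcases le_total b r with hbr | hbr
  · refine (norm_intervalIntegral_cexp_le_length hb.1).trans ?_
    linarith
  · have hpc : Continuous fun ξ => y * ξ + τ * φ ξ := by fun_prop
    have hint : ∀ c d, IntervalIntegrable
        (fun x => Complex.exp (Complex.I * (y * x + τ * φ x : ℝ))) volume c d :=
      fun c d => (continuous_cexp_I_mul hpc).intervalIntegrable c d
    rw [← intervalIntegral.integral_add_adjacent_intervals (hint 0 r) (hint r b)]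
    have e1 := norm_intervalIntegral_cexp_le_length (φ := fun ξ => y * ξ + τ * φ ξ) hr0.le
    have hl : 0 < τ * (c * r) := by positivity
    have e2 := norm_intervalIntegral_cexp_le_of_deriv2 (φ := fun ξ => y * ξ + τ * φ ξ)
      (φ' := fun ξ => y + τ * φ' ξ) (φ'' := fun ξ => τ * φ'' ξ) hbr hl
      (fun x => by simpa using ((hasDerivAt_id x).const_mul y).fun_add ((hφ x).const_mul τ))
      (fun x => by simpa using ((hφ' x).const_mul τ).const_add y) (by fun_prop)
      (fun x hx => by
        refine mul_le_mul_of_nonneg_left (le_trans ?_ (h2 x ⟨hr0.le.trans hx.1, hx.2.trans hb.2⟩))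
          hτ.le
        exact mul_le_mul_of_nonneg_left hx.1 hc.le)
    have hτr : τ * r = (r⁻¹) ^ 2 := by
      rw [hr, ← Real.rpow_neg hτ.le, ← Real.rpow_natCast, ← Real.rpow_mul hτ.le]
      nth_rewrite 1 [← Real.rpow_one τ]
      rw [← Real.rpow_add hτ]
      norm_num
    have hsq : Real.sqrt (τ * (c * r)) = Real.sqrt c * r⁻¹ := by
      rw [show τ * (c * r) = c * (τ * r) by ring, hτr, Real.sqrt_mul hc.le,
        Real.sqrt_sq (by positivity)]
    rw [hsq] at e2
    refine (norm_add_le _ _).trans ((add_le_add e1 e2).trans (le_of_eq ?_))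
    field_simp
    ring

theorem norm_intervalIntegral_cexp_le_cube_root_abs {φ φ' φ'' : ℝ → ℝ} {δ c : ℝ} (hc : 0 < c)
    (hφ : ∀ x, HasDerivAt φ (φ' x) x) (hφ' : ∀ x, HasDerivAt φ' (φ'' x) x)
    (hcont : Continuous φ'') (h2 : ∀ x ∈ Icc 0 δ, c * x ≤ φ'' x) {τ : ℝ} (hτ : τ ≠ 0) (y : ℝ)
    {b : ℝ} (hb : b ∈ Icc 0 δ) :
    ‖∫ ξ in (0 : ℝ)..b, Complex.exp (Complex.I * (y * ξ + τ * φ ξ : ℝ))‖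
      ≤ (1 + 6 / Real.sqrt c) * |τ| ^ (-(1 / 3) : ℝ) := by
  rcases hτ.lt_or_gt with h | h
  · have := norm_intervalIntegral_cexp_le_cube_root hc hφ hφ' hcont h2 (neg_pos.2 h) (-y) hb
    rw [← norm_intervalIntegral_cexp_neg] at this
    rw [abs_of_neg h]
    refine le_trans (le_of_eq ?_) this
    congr 1
    refine intervalIntegral.integral_congr fun x _ => ?_
    congr 3
    ring
  · rw [abs_of_pos h]
    exact norm_intervalIntegral_cexp_le_cube_root hc hφ hφ' hcont h2 h y hb

/-- Oscillatory integrals with an amplitude, from uniform bounds on all initial segments. -/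
theorem norm_intervalIntegral_smul_le_of_primitive {E : Type*} [NormedAddCommGroup E]
    [NormedSpace ℂ E] [CompleteSpace E] {e : ℝ → ℂ} {A A' : ℝ → E} {δ C D : ℝ}
    (hδ : 0 ≤ δ) (he : Continuous e) (hA : ∀ x, HasDerivAt A (A' x) x) (hA' : Continuous A')
    (hC : ∀ b ∈ Icc 0 δ, ‖∫ x in (0 : ℝ)..b, e x‖ ≤ C)
    (hD0 : ‖A δ‖ ≤ D) (hD : ∀ x ∈ Icc 0 δ, ‖A' x‖ ≤ D) :
    ‖∫ x in (0 : ℝ)..δ, e x • A x‖ ≤ C * (D * (1 + δ)) := by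
  have hΦ : ∀ x, HasDerivAt (fun b => ∫ x in (0 : ℝ)..b, e x) (e x) x := fun x =>
    intervalIntegral.integral_hasDerivAt_right (he.intervalIntegrable _ _)
      (he.stronglyMeasurableAtFilter _ _) he.continuousAt
  have hC0 : 0 ≤ C := (norm_nonneg _).trans (hC 0 (left_mem_Icc.2 hδ))
  have hparts := intervalIntegral.integral_smul_deriv_eq_deriv_smul (a := 0) (b := δ)
    (fun x _ => hΦ x) (fun x _ => hA x) (he.intervalIntegrable _ _) (hA'.intervalIntegrable _ _)
  have heq : ∫ x in (0 : ℝ)..δ, e x • A x = (∫ x in (0 : ℝ)..δ, e x) • A δ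
      - ∫ x in (0 : ℝ)..δ, (∫ x in (0 : ℝ)..x, e x) • A' x := by
    rw [hparts]
    simp
  rw [heq]
  have e1 : ‖(∫ x in (0 : ℝ)..δ, e x) • A δ‖ ≤ C * D := by
    rw [norm_smul]
    exact mul_le_mul (hC δ (right_mem_Icc.2 hδ)) hD0 (norm_nonneg _) hC0
  have e2 : ‖∫ x in (0 : ℝ)..δ, (∫ x in (0 : ℝ)..x, e x) • A' x‖ ≤ C * D * |δ - 0| := by
    refine intervalIntegral.norm_integral_le_of_norm_le_const fun x hx => ?_
    rw [uIoc_of_le hδ] at hx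
    rw [norm_smul]
    exact mul_le_mul (hC x (Ioc_subset_Icc_self hx)) (hD x (Ioc_subset_Icc_self hx))
      (norm_nonneg _) hC0
  rw [sub_zero, abs_of_nonneg hδ] at e2
  refine (norm_sub_le _ _).trans ((add_le_add e1 e2).trans (le_of_eq ?_))
  ring

/-- Uniform cube root decay with a smooth amplitude, for an odd phase with nondegenerate third
derivative. -/
theorem exists_norm_intervalIntegral_le_cube_root {E : Type*} [NormedAddCommGroup E]
    [NormedSpace ℂ E] [CompleteSpace E] {φ φ' φ'' : ℝ → ℝ} {δ c : ℝ} (hδ : 0 ≤ δ) (hc : 0 < c)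
    (hodd : ∀ x, φ (-x) = -φ x)
    (hφ : ∀ x, HasDerivAt φ (φ' x) x) (hφ' : ∀ x, HasDerivAt φ' (φ'' x) x)
    (hcont : Continuous φ'') (h2 : ∀ x ∈ Icc 0 δ, c * x ≤ φ'' x)
    {A : ℝ → E} (hA : ContDiff ℝ 1 A) :
    ∃ K, ∀ τ : ℝ, τ ≠ 0 → ∀ y : ℝ,
      ‖∫ ξ in (-δ)..δ, Complex.exp (Complex.I * (y * ξ + τ * φ ξ : ℝ)) • A ξ‖
        ≤ K * |τ| ^ (-(1 / 3) : ℝ) := by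
  have hφc : Continuous φ := continuous_iff_continuousAt.2 fun x => (hφ x).continuousAt
  have hAd : ∀ x, HasDerivAt A (deriv A x) x := fun x =>
    (hA.differentiable one_ne_zero x).hasDerivAt
  have hA' : Continuous (deriv A) := hA.continuous_deriv le_rfl
  have hAc := hA.continuous
  obtain ⟨D1, hD1⟩ := (isCompact_Icc (a := -δ) (b := δ)).exists_bound_of_continuousOn hAc.continuousOn
  obtain ⟨D2, hD2⟩ := (isCompact_Icc (a := -δ) (b := δ)).exists_bound_of_continuousOn hA'.continuousOn
  set D := max D1 D2
  set C := 1 + 6 / Real.sqrt c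
  refine ⟨2 * C * (D * (1 + δ)), fun τ hτ y => ?_⟩
  set r := |τ| ^ (-(1 / 3) : ℝ)
  have hpc : ∀ y τ : ℝ, Continuous fun ξ : ℝ => Complex.exp (Complex.I * (y * ξ + τ * φ ξ : ℝ)) :=
    fun y τ => continuous_cexp_I_mul (by fun_prop)
  have hint : ∀ c d, IntervalIntegrable
      (fun ξ => Complex.exp (Complex.I * (y * ξ + τ * φ ξ : ℝ)) • A ξ) volume c d :=
    fun c d => ((hpc y τ).smul hAc).intervalIntegrable c d
  rw [← intervalIntegral.integral_add_adjacent_intervals (hint (-δ) 0) (hint 0 δ)]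
  have e1 := norm_intervalIntegral_smul_le_of_primitive (D := D) hδ (hpc y τ) hAd hA'
    (fun b hb => norm_intervalIntegral_cexp_le_cube_root_abs hc hφ hφ' hcont h2 hτ y hb)
    ((hD1 δ ⟨by linarith, le_rfl⟩).trans (le_max_left _ _))
    (fun x hx => (hD2 x ⟨by linarith [hx.1], hx.2⟩).trans (le_max_right _ _))
  have e2 := norm_intervalIntegral_smul_le_of_primitive (D := D) (A := fun x => A (-x))
    (A' := fun x => -deriv A (-x)) hδ (hpc (-y) (-τ))
    (fun x => (hAd (-x)).comp_neg_arg) (by fun_prop)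
    (fun b hb => norm_intervalIntegral_cexp_le_cube_root_abs hc hφ hφ' hcont h2
      (neg_ne_zero.2 hτ) (-y) hb)
    ((hD1 (-δ) ⟨le_rfl, by linarith⟩).trans (le_max_left _ _))
    (fun x hx => by
      rw [norm_neg]
      exact (hD2 (-x) ⟨by linarith [hx.2], by linarith [hx.1]⟩).trans (le_max_right _ _))
  rw [abs_neg] at e2
  -- Reflection moves the left half to `[0, δ]`; as `φ` is odd, this only changes the signs of `y`
  -- and `τ`.
  have hrefl : ∫ ξ in (-δ)..0, Complex.exp (Complex.I * (y * ξ + τ * φ ξ : ℝ)) • A ξ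
      = ∫ ξ in (0 : ℝ)..δ, Complex.exp (Complex.I * (-y * ξ + -τ * φ ξ : ℝ)) • A (-ξ) := by
    have := intervalIntegral.integral_comp_neg (a := 0) (b := δ)
      (fun ξ => Complex.exp (Complex.I * (y * ξ + τ * φ ξ : ℝ)) • A ξ)
    rw [neg_zero] at this
    rw [← this]
    refine intervalIntegral.integral_congr fun x _ => ?_
    simp only [hodd]
    congr 4
    ring
  rw [hrefl]
  refine (norm_add_le _ _).trans ((add_le_add e2 e1).trans (le_of_eq ?_))
  ring

end VanDerCorput

/-! ### Moments of `e^{iv³}` -/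

section AiryIntegrals

/-- The substitution `t = v³` turns the integral into a Gamma integral. -/
theorem integral_pow_mul_cexp_neg_real_cube {r : ℝ} (hr : 0 < r) (k : ℕ) :
    ∫ v in Ioi (0 : ℝ), (v : ℂ) ^ k * Complex.exp (-(r * v ^ 3)) =
      (1 / 3) * ((1 / (r : ℂ)) ^ (((k : ℂ) + 1) / 3) * Complex.Gamma (((k : ℂ) + 1) / 3)) := by
  have ha : 0 < (((k : ℂ) + 1) / 3).re := by
    have : (((k : ℂ) + 1) / 3) = (((k : ℝ) + 1) / 3 : ℝ) := by push_cast; ring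
    rw [this, Complex.ofReal_re]
    positivity
  rw [← Complex.integral_cpow_mul_exp_neg_mul_Ioi ha hr,
    ← integral_comp_rpow_Ioi
      (fun t : ℝ => (t : ℂ) ^ (((k : ℂ) + 1) / 3 - 1) * Complex.exp (-(r * t))) (p := 3)
      (by norm_num), ← integral_const_mul]
  refine setIntegral_congr_fun measurableSet_Ioi fun v hv => ?_
  have hv0 : (0 : ℝ) < v := hv
  have hvc : (v : ℂ) ≠ 0 := by exact_mod_cast hv0.ne'
  have h1 : ((v ^ (3 : ℝ) : ℝ) : ℂ) = (v : ℂ) ^ 3 := by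
    rw [show (3 : ℝ) = ((3 : ℕ) : ℝ) by norm_num, Real.rpow_natCast]
    push_cast; rfl
  have h2 : ((v : ℂ) ^ 3) ^ (((k : ℂ) + 1) / 3 - 1) = (v : ℂ) ^ k / (v : ℂ) ^ 2 := by
    rw [show ((v : ℂ) ^ 3) = ((v ^ (3 : ℝ) : ℝ) : ℂ) from h1.symm,
      show (((k : ℂ) + 1) / 3 - 1) = ((((k : ℝ) + 1) / 3 - 1 : ℝ) : ℂ) by push_cast; ring,
      ← Complex.ofReal_cpow (by positivity), ← Real.rpow_mul hv0.le,
      show (3 : ℝ) * (((k : ℝ) + 1) / 3 - 1) = (k : ℝ) - (2 : ℕ) by push_cast; ring,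
      Real.rpow_sub hv0, Real.rpow_natCast, Real.rpow_natCast]
    push_cast; rfl
  have h3 : v ^ ((3 : ℝ) - 1) = v ^ 2 := by
    rw [show (3 : ℝ) - 1 = ((2 : ℕ) : ℝ) by norm_num, Real.rpow_natCast]
  rw [h1, h2, h3, Complex.real_smul]
  push_cast
  rw [abs_of_pos (by norm_num : (0 : ℝ) < 3)]
  push_cast
  field_simp

theorem norm_pow_mul_cexp_neg_mul_cube (z : ℂ) (k : ℕ) {v : ℝ} (hv : 0 < v) :
    ‖(v : ℂ) ^ k * Complex.exp (-(z * v ^ 3))‖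
      = v ^ (k : ℝ) * Real.exp (-z.re * v ^ (3 : ℝ)) := by
  rw [norm_mul, norm_pow, Complex.norm_real, Real.norm_eq_abs, abs_of_pos hv, Complex.norm_exp,
    show (v : ℂ) ^ 3 = ((v ^ 3 : ℝ) : ℂ) by push_cast; rfl, Real.rpow_natCast,
    show (3 : ℝ) = ((3 : ℕ) : ℝ) by norm_num, Real.rpow_natCast]
  simp only [Complex.neg_re, Complex.re_mul_ofReal, neg_mul]

theorem integrableOn_pow_mul_cexp_neg_mul_cube {z : ℂ} (hz : 0 < z.re) (k : ℕ) :
    IntegrableOn (fun v : ℝ => (v : ℂ) ^ k * Complex.exp (-(z * v ^ 3))) (Ioi 0) := by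
  have hcont : Continuous fun v : ℝ => (v : ℂ) ^ k * Complex.exp (-(z * v ^ 3)) := by fun_prop
  refine Integrable.mono' (integrableOn_rpow_mul_exp_neg_mul_rpow (s := (k : ℝ)) (p := 3)
    (by have := Nat.cast_nonneg (α := ℝ) k; linarith) (by norm_num) hz)
    hcont.aestronglyMeasurable ?_
  exact (ae_restrict_iff' measurableSet_Ioi).2
    (.of_forall fun v hv => (norm_pow_mul_cexp_neg_mul_cube z k hv).le)

theorem differentiableAt_integral_pow_mul_cexp {z : ℂ} (hz : 0 < z.re) (k : ℕ) :
    DifferentiableAt ℂ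
      (fun z : ℂ => ∫ v in Ioi (0 : ℝ), (v : ℂ) ^ k * Complex.exp (-(z * v ^ 3))) z := by
  have hcont : ∀ (z : ℂ) (j : ℕ),
      Continuous fun v : ℝ => (v : ℂ) ^ j * Complex.exp (-(z * v ^ 3)) := fun z j => by fun_prop
  have hz2 : 0 < z.re / 2 := by linarith
  refine (hasDerivAt_integral_of_dominated_loc_of_deriv_le
    (F' := fun z v => -((v : ℂ) ^ (k + 3) * Complex.exp (-(z * v ^ 3))))
    (bound := fun v => v ^ ((k + 3 : ℕ) : ℝ) * Real.exp (-(z.re / 2) * v ^ (3 : ℝ)))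
    (Metric.ball_mem_nhds z hz2) (.of_forall fun z => (hcont z k).aestronglyMeasurable)
    (integrableOn_pow_mul_cexp_neg_mul_cube hz k) (hcont z (k + 3)).neg.aestronglyMeasurable
    ?_ ?_ ?_).2.differentiableAt
  · refine (ae_restrict_iff' measurableSet_Ioi).2 (.of_forall fun v hv w hw => ?_)
    have hv0 : (0 : ℝ) < v := hv
    rw [norm_neg, norm_pow_mul_cexp_neg_mul_cube w (k + 3) hv0]
    have hre : z.re / 2 ≤ w.re := by
      have h1 := (Complex.abs_re_le_norm (w - z)).trans (mem_ball_iff_norm.1 hw).le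
      rw [Complex.sub_re] at h1
      linarith [(abs_le.1 h1).1]
    gcongr
  · exact integrableOn_rpow_mul_exp_neg_mul_rpow
      (by have := Nat.cast_nonneg (α := ℝ) (k + 3); linarith) (by norm_num) hz2
  · refine .of_forall fun v w _ => ?_
    have h : HasDerivAt (fun w : ℂ => -(w * (v : ℂ) ^ 3)) (-(v : ℂ) ^ 3) w := by
      simpa using ((hasDerivAt_id w).mul_const ((v : ℂ) ^ 3)).fun_neg
    refine (h.cexp.const_mul ((v : ℂ) ^ k)).congr_deriv ?_
    ring

/-- Regularized Airy moments. -/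
theorem integral_pow_mul_cexp_neg_cube {z : ℂ} (hz : 0 < z.re) (k : ℕ) :
    ∫ v in Ioi (0 : ℝ), (v : ℂ) ^ k * Complex.exp (-(z * v ^ 3)) =
      (1 / 3) * ((1 / z) ^ (((k : ℂ) + 1) / 3) * Complex.Gamma (((k : ℂ) + 1) / 3)) := by
  have hopen : IsOpen {z : ℂ | 0 < z.re} := isOpen_lt continuous_const Complex.continuous_re
  have hF : AnalyticOnNhd ℂ
      (fun z : ℂ => ∫ v in Ioi (0 : ℝ), (v : ℂ) ^ k * Complex.exp (-(z * v ^ 3)))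
      {z : ℂ | 0 < z.re} := DifferentiableOn.analyticOnNhd (fun z hz =>
        (differentiableAt_integral_pow_mul_cexp hz k).differentiableWithinAt) hopen
  have hG : AnalyticOnNhd ℂ (fun z : ℂ => (1 / 3) *
      ((1 / z) ^ (((k : ℂ) + 1) / 3) * Complex.Gamma (((k : ℂ) + 1) / 3)))
      {z : ℂ | 0 < z.re} := by
    refine DifferentiableOn.analyticOnNhd (fun z hz => ?_) hopen
    have hz' : 0 < z.re := hz
    have hz0 : z ≠ 0 := fun h => by simp [h] at hz'
    have hslit : 1 / z ∈ Complex.slitPlane := by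
      left
      rw [one_div, Complex.inv_re]
      exact div_pos hz' (Complex.normSq_pos.2 hz0)
    have hd : DifferentiableAt ℂ (fun z : ℂ => 1 / z) z := by fun_prop (disch := exact hz0)
    exact (((hd.cpow_const hslit).mul_const _).const_mul _).differentiableWithinAt
  -- Identity theorem: both sides are holomorphic in the right half-plane and agree at real points
  -- accumulating at `1`.
  refine hF.eqOn_of_preconnected_of_frequently_eq hG (z₀ := 1)
    (convex_halfSpace_re_gt 0).isPreconnected (by simp) ?_ hz
  have ht : Filter.Tendsto (fun r : ℝ => (r : ℂ)) (nhdsWithin 1 {1}ᶜ) (nhdsWithin 1 {1}ᶜ) := by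
    refine tendsto_nhdsWithin_iff.2 ⟨?_, ?_⟩
    · exact (Complex.continuous_ofReal.tendsto' 1 1 (by simp)).mono_left nhdsWithin_le_nhds
    · filter_upwards [self_mem_nhdsWithin] with r hr
      simpa using hr
  refine ht.frequently (Filter.Eventually.frequently ?_)
  filter_upwards [nhdsWithin_le_nhds (lt_mem_nhds (zero_lt_one' ℝ))] with r hr
  exact integral_pow_mul_cexp_neg_real_cube hr k

theorem norm_cexp_neg_mul_cube_le {z : ℂ} (hz : 0 ≤ z.re) {v : ℝ} (hv : 0 ≤ v) :
    ‖Complex.exp (-(z * v ^ 3))‖ ≤ 1 := by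
  rw [Complex.norm_exp, show (v : ℂ) ^ 3 = ((v ^ 3 : ℝ) : ℂ) by push_cast; rfl]
  simp only [Complex.neg_re, Complex.re_mul_ofReal]
  exact Real.exp_le_one_iff.2 (by have := mul_nonneg hz (pow_nonneg hv 3); linarith)

theorem hasDerivAt_cexp_neg_mul_cube (z : ℂ) (v : ℝ) :
    HasDerivAt (fun v : ℝ => Complex.exp (-(z * (v : ℂ) ^ 3)))
      (-(3 * z) * ((v : ℂ) ^ 2 * Complex.exp (-(z * (v : ℂ) ^ 3)))) v := by
  have h : HasDerivAt (fun v : ℝ => (v : ℂ)) 1 v := Complex.ofRealCLM.hasDerivAt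
  refine (((h.fun_pow 3).const_mul z).fun_neg.cexp).congr_deriv ?_
  push_cast
  ring

/-- Tails of the regularized Airy moments, uniformly in the regularization. -/
theorem norm_integral_pow_mul_cexp_tail_le {z : ℂ} (hz : 0 ≤ z.re) (hz1 : 1 ≤ ‖z‖) {k : ℕ}
    (hk : k < 2) {L M : ℝ} (hL : 0 < L) (hLM : L ≤ M) :
    ‖∫ v in L..M, (v : ℂ) ^ k * Complex.exp (-(z * v ^ 3))‖ ≤ L ^ ((k : ℤ) - 2) := by
  set p : ℤ := (k : ℤ) - 2 with hp
  have hp0 : p < 0 := by omega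
  have hpos : ∀ v ∈ Icc L M, 0 < v := fun v hv => hL.trans_le hv.1
  have hu : uIcc L M = Icc L M := uIcc_of_le hLM
  have hz0 : z ≠ 0 := norm_pos_iff.1 (one_pos.trans_le hz1)
  have hd : ∀ v ∈ uIcc L M, HasDerivAt (fun v : ℝ => v ^ p) (p * v ^ (p - 1)) v :=
    fun v hv => hasDerivAt_zpow p v (Or.inl (hpos v (hu ▸ hv)).ne')
  have hci : ContinuousOn (fun v : ℝ => p * v ^ (p - 1)) (uIcc L M) :=
    continuousOn_const.mul (continuousOn_id.zpow₀ _ fun v hv => Or.inl (hpos v (hu ▸ hv)).ne')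
  -- `-3zv²e^{-zv³}` is an exact derivative, so the integrand is `v^{k-2}` times it, up to `-3z`. As
  -- `k < 2`, the factor `v^{k-2}` decreases; boundary terms and variation give `2L^{k-2}`, which is
  -- divided by `3|z| ≥ 3`.
  have hparts := intervalIntegral.integral_mul_deriv_eq_deriv_mul
    (u := fun v : ℝ => ((v ^ p : ℝ) : ℂ)) (u' := fun v : ℝ => ((p * v ^ (p - 1) : ℝ) : ℂ))
    (fun v hv => (hd v hv).ofReal_comp) (fun v _ => hasDerivAt_cexp_neg_mul_cube z v)
    (Complex.continuous_ofReal.comp_continuousOn hci).intervalIntegrable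
    (Continuous.intervalIntegrable (by fun_prop) _ _)
  have hlhs : ∫ v in L..M, ((v ^ p : ℝ) : ℂ) *
      (-(3 * z) * ((v : ℂ) ^ 2 * Complex.exp (-(z * (v : ℂ) ^ 3))))
      = -(3 * z) * ∫ v in L..M, (v : ℂ) ^ k * Complex.exp (-(z * v ^ 3)) := by
    rw [← intervalIntegral.integral_const_mul]
    refine intervalIntegral.integral_congr fun v hv => ?_
    have hv0 : (v : ℂ) ≠ 0 := by exact_mod_cast (hpos v (hu ▸ hv)).ne'
    have : ((v ^ p : ℝ) : ℂ) * (v : ℂ) ^ 2 = (v : ℂ) ^ k := by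
      rw [Complex.ofReal_zpow, hp, ← zpow_natCast, ← zpow_natCast, ← zpow_add₀ hv0]
      congr 1
      push_cast
      ring
    rw [← this]
    ring
  rw [hlhs] at hparts
  have hI : ‖∫ v in L..M, ((p * v ^ (p - 1) : ℝ) : ℂ) * Complex.exp (-(z * (v : ℂ) ^ 3))‖
      ≤ ∫ v in L..M, -(p * v ^ (p - 1)) := by
    refine intervalIntegral.norm_integral_le_of_norm_le hLM (.of_forall fun v hv => ?_)
      hci.intervalIntegrable.neg
    have hv0 := hpos v (Ioc_subset_Icc_self hv)
    have hneg : (p : ℝ) * v ^ (p - 1) ≤ 0 :=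
      mul_nonpos_of_nonpos_of_nonneg (by exact_mod_cast hp0.le) (zpow_nonneg hv0.le _)
    rw [norm_mul, Complex.norm_real, Real.norm_eq_abs, abs_of_nonpos hneg]
    exact mul_le_of_le_one_right (neg_nonneg.2 hneg) (norm_cexp_neg_mul_cube_le hz hv0.le)
  rw [intervalIntegral.integral_neg, intervalIntegral.integral_eq_sub_of_hasDerivAt hd
    hci.intervalIntegrable] at hI
  have hend : ∀ v : ℝ, 0 < v → ‖((v ^ p : ℝ) : ℂ) * Complex.exp (-(z * (v : ℂ) ^ 3))‖ ≤ v ^ p := by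
    intro v hv
    rw [norm_mul, Complex.norm_real, Real.norm_eq_abs, abs_of_pos (zpow_pos hv _)]
    exact mul_le_of_le_one_right (zpow_pos hv _).le (norm_cexp_neg_mul_cube_le hz hv.le)
  have hn := congrArg norm hparts
  rw [norm_mul, norm_neg, norm_mul, Complex.norm_ofNat] at hn
  have hbound := (norm_sub_le _ _).trans (add_le_add ((norm_sub_le _ _).trans
    (add_le_add (hend M (hL.trans_le hLM)) (hend L hL))) hI)
  rw [← hn] at hbound
  have h0 := norm_nonneg (∫ v in L..M, (v : ℂ) ^ k * Complex.exp (-(z * v ^ 3)))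
  have hLp := zpow_pos hL p
  nlinarith [mul_le_mul_of_nonneg_right hz1 h0]

theorem norm_integral_pow_mul_cexp_sub_le {z : ℂ} (hz : 0 < z.re) (hz1 : 1 ≤ ‖z‖) {k : ℕ}
    (hk : k < 2) {L : ℝ} (hL : 0 < L) :
    ‖(∫ v in (0 : ℝ)..L, (v : ℂ) ^ k * Complex.exp (-(z * v ^ 3))) -
      (1 / 3) * ((1 / z) ^ (((k : ℂ) + 1) / 3) * Complex.Gamma (((k : ℂ) + 1) / 3))‖
      ≤ L ^ ((k : ℤ) - 2) := by
  have hcont : Continuous fun v : ℝ => (v : ℂ) ^ k * Complex.exp (-(z * v ^ 3)) := by fun_prop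
  have hint := integrableOn_pow_mul_cexp_neg_mul_cube hz k
  have ht := intervalIntegral_tendsto_integral_Ioi 0 hint Filter.tendsto_id
  rw [integral_pow_mul_cexp_neg_cube hz] at ht
  rw [norm_sub_rev]
  refine le_of_tendsto (ht.sub_const _).norm ?_
  filter_upwards [Filter.eventually_ge_atTop L] with M hM
  rw [id, intervalIntegral.integral_interval_sub_left (hcont.intervalIntegrable _ _)
    (hcont.intervalIntegrable _ _)]
  exact norm_integral_pow_mul_cexp_tail_le hz.le hz1 hk hL hM

/-- Take `z = ε - i` and let `ε → 0⁺`. The tail bound is uniform because `|z| ≥ 1`, and `1/z → i`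
stays off the branch cut of the power. -/
theorem norm_integral_pow_mul_cexp_I_cube_sub_le {k : ℕ} (hk : k < 2) {L : ℝ} (hL : 0 < L) :
    ‖(∫ v in (0 : ℝ)..L, (v : ℂ) ^ k * Complex.exp (Complex.I * v ^ 3)) -
      (1 / 3) * (Complex.I ^ (((k : ℂ) + 1) / 3) * Complex.Gamma (((k : ℂ) + 1) / 3))‖
      ≤ L ^ ((k : ℤ) - 2) := by
  have hF : Continuous (Function.uncurry fun (ε : ℝ) (v : ℝ) =>
      (v : ℂ) ^ k * Complex.exp (-(((ε : ℂ) - Complex.I) * v ^ 3))) := by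
    fun_prop
  have h1 := (intervalIntegral.continuous_parametric_intervalIntegral_of_continuous'
    (μ := volume) hF 0 L).tendsto 0
  have hI : 1 / (((0 : ℝ) : ℂ) - Complex.I) = Complex.I := by
    simp
  have h2 : ContinuousAt (fun ε : ℝ => (1 / ((ε : ℂ) - Complex.I)) ^ (((k : ℂ) + 1) / 3)) 0 := by
    refine ContinuousAt.cpow ?_ continuousAt_const ?_
    · refine continuousAt_const.div (by fun_prop) ?_
      simp
    · rw [hI]
      exact Or.inr (by simp)
  have h3 := (h1.sub ((h2.tendsto.mul_const (Complex.Gamma (((k : ℂ) + 1) / 3))).const_mul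
    (1 / 3))).norm
  rw [hI] at h3
  simp only [Complex.ofReal_zero, zero_sub, neg_mul, neg_neg] at h3
  refine le_of_tendsto (h3.mono_left (nhdsWithin_le_nhds (s := Ioi 0))) ?_
  filter_upwards [self_mem_nhdsWithin] with ε hε
  refine norm_integral_pow_mul_cexp_sub_le (by simpa using hε) ?_ hk hL
  have := Complex.abs_im_le_norm ((ε : ℂ) - Complex.I)
  simpa using this

theorem I_cpow (a : ℝ) : Complex.I ^ (a : ℂ) =
    Real.cos (Real.pi * a / 2) + Real.sin (Real.pi * a / 2) * Complex.I := by
  rw [Complex.cpow_def_of_ne_zero Complex.I_ne_zero, Complex.log_I, Complex.ofReal_cos,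
    Complex.ofReal_sin, ← Complex.exp_mul_I]
  congr 1
  push_cast
  ring

theorem integral_symm_pow_mul_cexp (k : ℕ) (L : ℝ) :
    ∫ v in (-L)..L, (v : ℂ) ^ k * Complex.exp (Complex.I * v ^ 3) =
      (∫ v in (0 : ℝ)..L, (v : ℂ) ^ k * Complex.exp (Complex.I * v ^ 3)) + (-1) ^ k *
      (starRingEnd ℂ) (∫ v in (0 : ℝ)..L, (v : ℂ) ^ k * Complex.exp (Complex.I * v ^ 3)) := by
  have hint : ∀ a b, IntervalIntegrable
      (fun v : ℝ => (v : ℂ) ^ k * Complex.exp (Complex.I * v ^ 3)) volume a b :=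
    fun a b => Continuous.intervalIntegrable (by fun_prop) _ _
  rw [← intervalIntegral.integral_add_adjacent_intervals (hint (-L) 0) (hint 0 L), add_comm,
    ← intervalIntegral.intervalIntegral_conj, ← intervalIntegral.integral_const_mul]
  congr 1
  have := intervalIntegral.integral_comp_neg (a := 0) (b := L)
    (fun v : ℝ => (v : ℂ) ^ k * Complex.exp (Complex.I * v ^ 3))
  rw [neg_zero] at this
  rw [← this]
  refine intervalIntegral.integral_congr fun v _ => ?_
  simp only [← Complex.exp_conj, map_mul, map_pow, Complex.conj_I, Complex.conj_ofReal]
  rw [← mul_assoc, ← mul_pow]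
  push_cast
  ring_nf

/-- The two-sided Airy moments `∫ v^k e^{iv³} dv`, `k = 0, 1`. -/
noncomputable def airyMoment (k : ℕ) : ℂ :=
  Complex.I ^ k * (Real.Gamma (((k : ℝ) + 1) / 3) / Real.sqrt 3 : ℝ)

/-- The sum is twice the real part for `k = 0` and `2i` times the imaginary part for `k = 1`. Both
`(2/3) cos(π/6)` and `(2/3) sin(π/3)` equal `1/√3`. -/
theorem airyMoment_eq {k : ℕ} (hk : k < 2) :
    (1 / 3) * (Complex.I ^ (((k : ℂ) + 1) / 3) * Complex.Gamma (((k : ℂ) + 1) / 3)) + (-1) ^ k *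
      (starRingEnd ℂ)
        ((1 / 3) * (Complex.I ^ (((k : ℂ) + 1) / 3) * Complex.Gamma (((k : ℂ) + 1) / 3)))
      = airyMoment k := by
  have ha : ((k : ℂ) + 1) / 3 = ((((k : ℝ) + 1) / 3 : ℝ) : ℂ) := by push_cast; ring
  have h3 : Real.sqrt 3 ^ 2 = 3 := Real.sq_sqrt (by norm_num)
  have h3' : Real.sqrt 3 ≠ 0 := by positivity
  have h3c : ((Real.sqrt 3 : ℝ) : ℂ) ^ 2 = 3 := by exact_mod_cast h3
  have h3c' : ((Real.sqrt 3 : ℝ) : ℂ) ≠ 0 := by exact_mod_cast h3'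
  rw [ha, I_cpow, Complex.Gamma_ofReal, airyMoment]
  interval_cases k
  · simp only [CharP.cast_eq_zero, zero_add]
    rw [show Real.pi * (1 / 3) / 2 = Real.pi / 6 by ring, Real.cos_pi_div_six,
      Real.sin_pi_div_six]
    simp only [map_mul, map_add, Complex.conj_I, Complex.conj_ofReal, map_div₀, map_one,
      map_ofNat, pow_zero]
    push_cast
    field_simp
    linear_combination 2 * (Real.Gamma (1 / 3) : ℂ) * h3c
  · norm_num only [Nat.cast_one]
    rw [show Real.pi * (2 / 3) / 2 = Real.pi / 3 by ring, Real.cos_pi_div_three,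
      Real.sin_pi_div_three]
    simp only [map_mul, map_add, Complex.conj_I, Complex.conj_ofReal, map_div₀, map_one,
      map_ofNat, pow_one]
    push_cast
    field_simp
    ring_nf
    rw [h3c]
    ring

theorem norm_integral_symm_pow_mul_cexp_sub_le {k : ℕ} (hk : k < 2) {L : ℝ} (hL : 0 < L) :
    ‖(∫ v in (-L)..L, (v : ℂ) ^ k * Complex.exp (Complex.I * v ^ 3)) - airyMoment k‖
      ≤ 2 * L ^ ((k : ℤ) - 2) := by
  have h := norm_integral_pow_mul_cexp_I_cube_sub_le hk hL
  rw [integral_symm_pow_mul_cexp, ← airyMoment_eq hk, add_sub_add_comm, ← mul_sub, ← map_sub]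
  refine (norm_add_le _ _).trans ?_
  rw [norm_mul, norm_pow, norm_neg, norm_one, one_pow, one_mul, RCLike.norm_conj]
  linarith

/-- Rescaling `v` by `l^{1/3}` produces `l^{-(k+1)/3}`; the tail beyond `l^{1/3}L` contributes
`l^{(k-2)/3}`. The product is `l⁻¹` for either `k`. -/
theorem exists_norm_integral_pow_mul_cexp_sub_le {k : ℕ} (hk : k < 2) {L : ℝ} (hL : 0 < L) :
    ∃ K, ∀ l : ℝ, 0 < l →
      ‖(∫ v in (-L)..L, (v : ℂ) ^ k * Complex.exp (Complex.I * (l * v ^ 3)))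
        - ((l ^ (-((k + 1) / 3) : ℝ) : ℝ) : ℂ) * airyMoment k‖ ≤ K * l⁻¹ := by
  refine ⟨2 * L ^ ((k : ℤ) - 2), fun l hl => ?_⟩
  set r := l ^ (1 / 3 : ℝ) with hr
  have hr0 : 0 < r := Real.rpow_pos_of_pos hl _
  have hr3 : r ^ 3 = l := by
    rw [hr, ← Real.rpow_natCast, ← Real.rpow_mul hl.le]; norm_num
  have hrk : l ^ (-((k + 1) / 3) : ℝ) = (r ^ (k + 1))⁻¹ := by
    rw [hr, ← Real.rpow_natCast, ← Real.rpow_mul hl.le, ← Real.rpow_neg hl.le]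
    congr 1
    push_cast
    ring
  have hrc : (r : ℂ) ≠ 0 := by exact_mod_cast hr0.ne'
  have hsub : ∫ v in (-L)..L, (v : ℂ) ^ k * Complex.exp (Complex.I * (l * v ^ 3)) =
      ((r ^ (k + 1))⁻¹ : ℝ) *
        ∫ v in (-(r * L))..(r * L), (v : ℂ) ^ k * Complex.exp (Complex.I * v ^ 3) := by
    have := intervalIntegral.integral_comp_mul_left (a := -L) (b := L)
      (fun v : ℝ => (v : ℂ) ^ k * Complex.exp (Complex.I * v ^ 3)) hr0.ne'
    rw [mul_neg] at this
    rw [← smul_inv_smul₀ hr0.ne' (∫ v in (-(r * L))..(r * L), _), ← this, Complex.real_smul,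
      ← mul_assoc, ← intervalIntegral.integral_const_mul]
    refine intervalIntegral.integral_congr fun v _ => ?_
    rw [← hr3]
    push_cast
    rw [mul_pow, mul_pow, pow_succ]
    field_simp
    ring
  rw [hsub, hrk, ← mul_sub, norm_mul, Complex.norm_real, Real.norm_eq_abs,
    abs_of_pos (by positivity)]
  calc (r ^ (k + 1))⁻¹ * _ ≤ (r ^ (k + 1))⁻¹ * (2 * (r * L) ^ ((k : ℤ) - 2)) :=
        mul_le_mul_of_nonneg_left
          (norm_integral_symm_pow_mul_cexp_sub_le hk (mul_pos hr0 hL)) (by positivity)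
    _ = 2 * L ^ ((k : ℤ) - 2) * l⁻¹ := by
        have : (r ^ (k + 1))⁻¹ * r ^ ((k : ℤ) - 2) = l⁻¹ := by
          rw [← hr3, ← zpow_natCast, ← zpow_natCast, ← zpow_neg, ← zpow_neg, ← zpow_add₀ hr0.ne']
          congr 1
          push_cast
          ring
        rw [mul_zpow, ← this]
        ring

end AiryIntegrals

/-! ### Hadamard quotients and the cubic normal form -/

section HadamardQuotient

variable {E : Type*} [NormedAddCommGroup E] [NormedSpace ℝ E]

theorem hasDerivAt_of_smooth {g : ℝ → E} (hg : ContDiff ℝ (⊤ : ℕ∞) g) (x : ℝ) :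
    HasDerivAt g (deriv g x) x :=
  (hg.differentiable (by simp) x).hasDerivAt

theorem smooth_deriv {g : ℝ → E} (hg : ContDiff ℝ (⊤ : ℕ∞) g) :
    ContDiff ℝ (⊤ : ℕ∞) (deriv g) := (contDiff_infty_iff_deriv.1 hg).2

theorem deriv_even_of_odd {g : ℝ → E} (hg : ∀ x, g (-x) = -g x) (x : ℝ) :
    deriv g (-x) = deriv g x := by
  have h := deriv_comp_neg g x
  rw [funext hg, deriv.fun_neg] at h
  exact (neg_injective h).symm

theorem deriv_odd_of_even {g : ℝ → E} (hg : ∀ x, g (-x) = g x) (x : ℝ) :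
    deriv g (-x) = -deriv g x := by
  have h := deriv_comp_neg g x
  rw [funext hg] at h
  rw [h, neg_neg]

theorem eq_zero_of_odd {g : ℝ → E} (hg : ∀ x, g (-x) = -g x) : g 0 = 0 := by
  have h := hg 0
  rw [neg_zero] at h
  have h2 : (2 : ℝ) • g 0 = 0 := by rw [two_smul]; nth_rewrite 2 [h]; exact add_neg_cancel _
  exact (smul_eq_zero.1 h2).resolve_left two_ne_zero

variable [CompleteSpace E]

/-- Differentiation under the integral replaces `h` by `h'` and `j` by `j + 1`, so the induction
must run over all `h` and `j` at once. -/
theorem contDiff_integral_pow_smul_comp_mul {h : ℝ → E} (hh : ContDiff ℝ (⊤ : ℕ∞) h) (j : ℕ) :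
    ContDiff ℝ (⊤ : ℕ∞) (fun x => ∫ t in (0 : ℝ)..1, t ^ j • h (t * x)) := by
  rw [contDiff_infty]
  intro n
  induction n generalizing h j with
  | zero =>
    rw [Nat.cast_zero, contDiff_zero]
    have hc := hh.continuous
    have hF : Continuous (Function.uncurry fun (x t : ℝ) => t ^ j • h (t * x)) := by
      simp only [Function.uncurry_def]
      fun_prop
    exact intervalIntegral.continuous_parametric_intervalIntegral_of_continuous'
      (μ := volume) hF 0 1
  | succ n ih =>
    have hc := hh.continuous
    have hc' := (smooth_deriv hh).continuous
    have hd : ∀ x, HasDerivAt (fun x => ∫ t in (0 : ℝ)..1, t ^ j • h (t * x))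
        (∫ t in (0 : ℝ)..1, t ^ (j + 1) • deriv h (t * x)) x := by
      refine hasDerivAt_intervalIntegral_of_continuous ?_ ?_ (fun x t => ?_) 0 1
      · simp only [Function.uncurry_def]
        fun_prop
      · simp only [Function.uncurry_def]
        fun_prop
      · have h1 : HasDerivAt (fun x : ℝ => t * x) t x := by
          simpa using (hasDerivAt_id x).const_mul t
        refine (((hasDerivAt_of_smooth hh (t * x)).scomp x h1).fun_const_smul (t ^ j)).congr_deriv ?_
        rw [smul_smul, pow_succ]
    push_cast
    refine contDiff_succ_iff_deriv.2 ⟨fun x => (hd x).differentiableAt, by simp, ?_⟩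
    rw [funext fun x => (hd x).deriv]
    exact ih (smooth_deriv hh) (j + 1)

theorem eq_add_smul_integral_deriv {g : ℝ → E} (hg : ContDiff ℝ (⊤ : ℕ∞) g) (x : ℝ) :
    g x = g 0 + x • ∫ t in (0 : ℝ)..1, deriv g (t * x) := by
  have hd : ∀ t ∈ uIcc (0 : ℝ) 1, HasDerivAt (fun t : ℝ => g (t * x)) (x • deriv g (t * x)) t :=
    fun t _ => (hasDerivAt_of_smooth hg (t * x)).scomp t (by
      simpa using (hasDerivAt_id t).mul_const x)
  have hc := (smooth_deriv hg).continuous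
  have := intervalIntegral.integral_eq_sub_of_hasDerivAt hd
    (Continuous.intervalIntegrable (by fun_prop) _ _)
  rw [intervalIntegral.integral_smul, one_mul, zero_mul] at this
  rw [this, add_sub_cancel]

/-- Hadamard's lemma. -/
theorem exists_smooth_quotient {g : ℝ → E} (hg : ContDiff ℝ (⊤ : ℕ∞) g) (h0 : g 0 = 0) :
    ∃ q : ℝ → E, ContDiff ℝ (⊤ : ℕ∞) q ∧ (∀ x, g x = x • q x) ∧ q 0 = deriv g 0 := by
  refine ⟨fun x => ∫ t in (0 : ℝ)..1, deriv g (t * x), ?_, fun x => ?_, ?_⟩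
  · simpa using contDiff_integral_pow_smul_comp_mul (smooth_deriv hg) 0
  · simpa [h0] using eq_add_smul_integral_deriv hg x
  · simp

theorem exists_smooth_quotient_sq {g : ℝ → E} (hg : ContDiff ℝ (⊤ : ℕ∞) g) (h0 : g 0 = 0)
    (h1 : deriv g 0 = 0) :
    ∃ q : ℝ → E, ContDiff ℝ (⊤ : ℕ∞) q ∧ (∀ x, g x = x ^ 2 • q x) ∧
      q 0 = (1 / 2 : ℝ) • deriv (deriv g) 0 := by
  obtain ⟨r, hr, hgr, hr0⟩ := exists_smooth_quotient hg h0
  obtain ⟨q, hq, hrq, hq0⟩ := exists_smooth_quotient hr (hr0.trans h1)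
  refine ⟨q, hq, fun x => by rw [hgr, hrq, smul_smul, sq], ?_⟩
  have d1 : ∀ x, deriv g x = r x + x • deriv r x := fun x => by
    rw [funext hgr]
    refine (((hasDerivAt_id x).smul (hasDerivAt_of_smooth hr x)).congr_deriv ?_).deriv
    rw [one_smul, add_comm]; rfl
  have d2 : deriv (deriv g) 0 = (2 : ℝ) • deriv r 0 := by
    rw [funext d1]
    refine (((hasDerivAt_of_smooth hr 0).add ((hasDerivAt_id (0 : ℝ)).smul
      (hasDerivAt_of_smooth (smooth_deriv hr) 0))).congr_deriv ?_).deriv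
    simp [two_smul]
  rw [hq0, d2, smul_smul]
  norm_num

/-- An odd phase with vanishing first derivative has a cubic normal form. -/
theorem exists_cubic_factorization {ψ : ℝ → ℝ} (hψ : ContDiff ℝ (⊤ : ℕ∞) ψ)
    (hodd : ∀ x, ψ (-x) = -ψ x) (h1 : deriv ψ 0 = 0) :
    ∃ p q : ℝ → ℝ, ContDiff ℝ (⊤ : ℕ∞) p ∧ ContDiff ℝ (⊤ : ℕ∞) q ∧
      (∀ x, deriv ψ x = x ^ 2 * p x) ∧ (∀ x, ψ x = x ^ 3 * q x) ∧
      p 0 = iteratedDeriv 3 ψ 0 / 2 ∧ q 0 = iteratedDeriv 3 ψ 0 / 6 ∧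
      (∀ x, p (-x) = p x) ∧ (∀ x, q (-x) = q x) := by
  have hev := deriv_even_of_odd hodd
  have hodd2 := deriv_odd_of_even hev
  obtain ⟨p, hp, hdp, hp0⟩ := exists_smooth_quotient_sq (smooth_deriv hψ) h1 (eq_zero_of_odd hodd2)
  have hp0' : p 0 = iteratedDeriv 3 ψ 0 / 2 := by
    rw [hp0, iteratedDeriv_succ, iteratedDeriv_succ, iteratedDeriv_one, smul_eq_mul]
    ring
  -- Integrating `ψ' = x²p` along the segment gives `q(x) = ∫ t² p(tx) dt`, whence `q(0) = p(0)/3`.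
  have hfac : ∀ x, ψ x = x ^ 3 * ∫ t in (0 : ℝ)..1, t ^ 2 • p (t * x) := fun x => by
    rw [eq_add_smul_integral_deriv hψ x, eq_zero_of_odd hodd, zero_add, smul_eq_mul, pow_succ',
      mul_assoc]
    congr 1
    rw [← intervalIntegral.integral_const_mul]
    refine intervalIntegral.integral_congr fun t _ => ?_
    simp only [hdp, smul_eq_mul]
    ring
  refine ⟨p, fun x => ∫ t in (0 : ℝ)..1, t ^ 2 • p (t * x), hp,
    contDiff_integral_pow_smul_comp_mul hp 2, hdp, hfac, hp0', ?_, ?_, ?_⟩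
  · simp only [mul_zero, smul_eq_mul, intervalIntegral.integral_mul_const, integral_pow, hp0']
    norm_num
    ring
  · intro x
    rcases eq_or_ne x 0 with rfl | hx
    · rw [neg_zero]
    · have := hev x
      rw [hdp, hdp, neg_sq] at this
      exact mul_left_cancel₀ (pow_ne_zero 2 hx) this
  · intro x
    rcases eq_or_ne x 0 with rfl | hx
    · rw [neg_zero]
    · have := hodd x
      rw [hfac (-x), hfac x, show (-x) ^ 3 = -x ^ 3 by ring, neg_mul] at this
      exact mul_left_cancel₀ (pow_ne_zero 3 hx) (neg_injective this)

/-- A smooth even function that is positive at `0` agrees near `0` with a positive one. -/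
theorem exists_smooth_pos_extension {q : ℝ → ℝ} (hq : ContDiff ℝ (⊤ : ℕ∞) q) (h0 : 0 < q 0)
    (hev : ∀ x, q (-x) = q x) :
    ∃ Q : ℝ → ℝ, ContDiff ℝ (⊤ : ℕ∞) Q ∧ (∀ x, 0 < Q x) ∧ (∀ x, Q (-x) = Q x) ∧
      ∃ δ, 0 < δ ∧ ∀ x, |x| ≤ δ → Q x = q x := by
  obtain ⟨r, hr, hball⟩ := Metric.eventually_nhds_iff.1
    (hq.continuous.continuousAt.eventually (lt_mem_nhds h0))
  -- A convex combination of `q` and the constant `q(0)`, both positive on the support of the bump.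
  -- Roots and inverses of the result are smooth on the whole line.
  let χ : ContDiffBump (0 : ℝ) := ⟨r / 2, r, by linarith, by linarith⟩
  refine ⟨fun x => χ x * q x + (1 - χ x) * q 0, ?_, fun x => ?_, fun x => ?_, r / 2, by linarith,
    fun x hx => ?_⟩
  · exact (χ.contDiff.mul hq).add ((contDiff_const.sub χ.contDiff).mul contDiff_const)
  · rcases lt_or_ge (dist x 0) r with hx | hx
    · have h1 := hball hx
      have h2 := χ.nonneg (x := x)
      have h3 := χ.le_one (x := x)
      rcases h2.eq_or_lt with h | h
      · simp only [← h]; simpa using h0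
      · have := mul_pos h h1
        have := mul_nonneg (sub_nonneg.2 h3) h0.le
        linarith
    · simp only [χ.zero_of_le_dist hx]
      simpa using h0
  · simp only [hev, χ.neg]
  · have : χ x = 1 := χ.one_of_mem_closedBall (by simpa using hx)
    simp [this]

end HadamardQuotient

/-! ### Stationary phase at a cubic point -/

section StationaryPhase

variable {E : Type*} [NormedAddCommGroup E] [NormedSpace ℂ E] [CompleteSpace E]

/-- An amplitude divisible by `φ'` can be integrated by parts even across stationary points, since
the quotient `R` stays regular. -/
theorem exists_norm_integral_le_of_eq_deriv_smul {φ φ' : ℝ → ℝ} {R R' D : ℝ → E} {a b : ℝ}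
    (hφ : ∀ x, HasDerivAt φ (φ' x) x) (hφ' : Continuous φ')
    (hR : ∀ x, HasDerivAt R (R' x) x) (hR' : Continuous R')
    (hD : ∀ x ∈ uIcc a b, D x = (φ' x : ℂ) • R x) :
    ∃ K, ∀ l : ℝ, 0 < l →
      ‖∫ x in a..b, Complex.exp (Complex.I * (l * φ x : ℝ)) • D x‖ ≤ K * l⁻¹ := by
  obtain ⟨C, hC⟩ := isCompact_uIcc.exists_bound_of_continuousOn (hR'.continuousOn (s := uIcc a b))
  refine ⟨‖R b‖ + ‖R a‖ + C * |b - a|, fun l hl => ?_⟩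
  have hlc : (l : ℂ) ≠ 0 := by exact_mod_cast hl.ne'
  have hφc : Continuous φ := continuous_iff_continuousAt.2 fun x => (hφ x).continuousAt
  have hparts := intervalIntegral.integral_smul_deriv_eq_deriv_smul (a := a) (b := b)
    (u := fun x => Complex.exp (Complex.I * (l * φ x : ℝ)))
    (fun x _ => hasDerivAt_cexp_I_mul ((hφ x).const_mul l)) (fun x _ => hR x)
    (Continuous.intervalIntegrable (by fun_prop) _ _) (hR'.intervalIntegrable _ _)
  have hI : ∫ x in a..b, (Complex.I * (l * φ' x : ℝ) * Complex.exp (Complex.I * (l * φ x : ℝ))) • R x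
      = (Complex.I * l) • ∫ x in a..b, Complex.exp (Complex.I * (l * φ x : ℝ)) • D x := by
    rw [← intervalIntegral.integral_smul]
    refine intervalIntegral.integral_congr fun x hx => ?_
    simp only [hD x hx, smul_smul]
    congr 1
    push_cast
    ring
  rw [hI] at hparts
  have hbound : ‖∫ x in a..b, Complex.exp (Complex.I * (l * φ x : ℝ)) • R' x‖ ≤ C * |b - a| := by
    refine intervalIntegral.norm_integral_le_of_norm_le_const fun x hx => ?_
    rw [norm_smul, Complex.norm_exp_I_mul_ofReal, one_mul]
    exact hC x (uIoc_subset_uIcc hx)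
  have hmain : ‖(Complex.I * l) • ∫ x in a..b, Complex.exp (Complex.I * (l * φ x : ℝ)) • D x‖
      ≤ ‖R b‖ + ‖R a‖ + C * |b - a| := by
    have h3 : (Complex.I * l) • ∫ x in a..b, Complex.exp (Complex.I * (l * φ x : ℝ)) • D x
      = Complex.exp (Complex.I * (l * φ b : ℝ)) • R b - Complex.exp (Complex.I * (l * φ a : ℝ)) • R a
        - ∫ x in a..b, Complex.exp (Complex.I * (l * φ x : ℝ)) • R' x := by
      rw [hparts]; abel
    rw [h3]
    refine (norm_sub_le _ _).trans (add_le_add ((norm_sub_le _ _).trans (le_of_eq ?_)) hbound)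
    simp only [norm_smul, Complex.norm_exp_I_mul_ofReal, one_mul]
  rw [norm_smul, norm_mul, Complex.norm_I, one_mul, Complex.norm_real, Real.norm_eq_abs,
    abs_of_pos hl] at hmain
  rw [← div_eq_mul_inv, le_div_iff₀ hl, mul_comm]
  exact hmain

/-- No stationary points: decay of order one. -/
theorem exists_norm_integral_le_of_deriv_ne_zero {φ : ℝ → ℝ} {B : ℝ → E} {a b : ℝ}
    (hφ : ContDiff ℝ (⊤ : ℕ∞) φ) (hB : ContDiff ℝ (⊤ : ℕ∞) B)
    {P : ℝ → ℝ} (hP : ContDiff ℝ (⊤ : ℕ∞) P) (hP0 : ∀ x, P x ≠ 0)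
    (hφP : ∀ x ∈ uIcc a b, deriv φ x = P x) :
    ∃ K, ∀ l : ℝ, 0 < l →
      ‖∫ x in a..b, Complex.exp (Complex.I * (l * φ x : ℝ)) • B x‖ ≤ K * l⁻¹ := by
  have hR : ContDiff ℝ (⊤ : ℕ∞) fun x => (P x)⁻¹ • B x := (hP.inv hP0).smul hB
  refine exists_norm_integral_le_of_eq_deriv_smul (fun x => hasDerivAt_of_smooth hφ x)
    (smooth_deriv hφ).continuous (fun x => hasDerivAt_of_smooth hR x) (smooth_deriv hR).continuous
    fun x hx => ?_
  rw [Complex.coe_smul, smul_smul, hφP x hx, mul_inv_cancel₀ (hP0 x), one_smul]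

/-- Coefficients of the stationary phase expansion at a cubic stationary point `aξ³/6`. -/
noncomputable def airyCoeff (a : ℝ) (k : ℕ) : ℂ :=
  ((SignType.sign a : ℝ) ^ k * (|a| / 6) ^ (-((k + 1) / 3) : ℝ) : ℝ) * airyMoment k

theorem exists_airy_expansion_of_pos {ψ : ℝ → ℝ} (hψ : ContDiff ℝ (⊤ : ℕ∞) ψ)
    (hodd : ∀ x, ψ (-x) = -ψ x) (h1 : deriv ψ 0 = 0) (ha : 0 < iteratedDeriv 3 ψ 0) :
    ∃ δ₀, 0 < δ₀ ∧ ∀ δ, 0 < δ → δ ≤ δ₀ → ∀ B : ℝ → E, ContDiff ℝ (⊤ : ℕ∞) B →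
      ∃ K, ∀ l : ℝ, 0 < l →
        ‖(∫ x in (-δ)..δ, Complex.exp (Complex.I * (l * ψ x : ℝ)) • B x)
          - (((l ^ (-(1 / 3) : ℝ) : ℝ) : ℂ) * airyCoeff (iteratedDeriv 3 ψ 0) 0) • B 0
          - (((l ^ (-(2 / 3) : ℝ) : ℝ) : ℂ) * airyCoeff (iteratedDeriv 3 ψ 0) 1) • deriv B 0‖
          ≤ K * l⁻¹ := by
  obtain ⟨p, q, hp, hq, hdp, hfac, hp0, hq0, hpe, hqe⟩ := exists_cubic_factorization hψ hodd h1
  set a := iteratedDeriv 3 ψ 0 with ha'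
  obtain ⟨P, hP, hPpos, -, δ₁, hδ₁, hPp⟩ := exists_smooth_pos_extension hp
    (by rw [hp0]; positivity) hpe
  obtain ⟨Q, hQ, hQpos, hQe, δ₂, hδ₂, hQq⟩ := exists_smooth_pos_extension hq
    (by rw [hq0]; positivity) hqe
  refine ⟨min δ₁ δ₂, lt_min hδ₁ hδ₂, fun δ hδ hδle B hB => ?_⟩
  have hmem : ∀ x ∈ uIcc (-δ) δ, |x| ≤ δ := fun x hx => by
    rw [uIcc_of_le (by linarith)] at hx
    exact abs_le.2 hx
  have hQ0 : Q 0 = a / 6 := by rw [hQq 0 (by simpa using hδ₂.le), hq0]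
  -- `u = x Q^{1/3}` is a smooth coordinate with `u³ = ψ` near `0`.
  set w : ℝ → ℝ := fun x => Q x ^ (1 / 3 : ℝ) with hw
  have hwsm : ContDiff ℝ (⊤ : ℕ∞) w := hQ.rpow_const_of_ne fun x => (hQpos x).ne'
  have hwpos : ∀ x, 0 < w x := fun x => Real.rpow_pos_of_pos (hQpos x) _
  set u : ℝ → ℝ := fun x => x * w x with hu
  have husm : ContDiff ℝ (⊤ : ℕ∞) u := contDiff_id.mul hwsm
  have huodd : ∀ x, u (-x) = -u x := fun x => by
    simp only [hu, hw, hQe]; ring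
  have hu3 : ∀ x ∈ uIcc (-δ) δ, u x ^ 3 = ψ x := fun x hx => by
    have hx' := (hmem x hx).trans (hδle.trans (min_le_right _ _))
    simp only [hu, hw]
    rw [mul_pow, ← Real.rpow_natCast (Q x ^ (1 / 3 : ℝ)), ← Real.rpow_mul (hQpos x).le, hfac,
      ← hQq x hx']
    norm_num
  set ρ := w 0 with hρ
  have hρ0 : ρ ≠ 0 := (hwpos 0).ne'
  have hu0 : u 0 = 0 := by simp [hu]
  have hu'0 : deriv u 0 = ρ := by
    have := ((hasDerivAt_id' (0 : ℝ)).fun_mul (hasDerivAt_of_smooth hwsm 0)).deriv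
    rw [one_mul, zero_mul, add_zero] at this
    exact this
  have hu''0 : deriv (deriv u) 0 = 0 :=
    eq_zero_of_odd (deriv_odd_of_even (deriv_even_of_odd huodd))
  have hu'sm := smooth_deriv husm
  -- With `u(0) = 0`, `u'(0) = ρ` and, by oddness, `u''(0) = 0`, these coefficients make `D` and
  -- `D'` vanish at `0`. Then `D = x²R`, and `ψ' = x²P` gives `D = ψ' P⁻¹R`.
  set D : ℝ → E := fun x => B x - (ρ⁻¹ * deriv u x) • B 0
    - ((ρ ^ 2)⁻¹ * (u x * deriv u x)) • deriv B 0 with hD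
  have hDsm : ContDiff ℝ (⊤ : ℕ∞) D :=
    (hB.sub ((contDiff_const.mul hu'sm).smul contDiff_const)).sub
      ((contDiff_const.mul (husm.mul hu'sm)).smul contDiff_const)
  have hD0 : D 0 = 0 := by
    simp [hD, hu0, hu'0, inv_mul_cancel₀ hρ0]
  have hD'0 : deriv D 0 = 0 := by
    have e1 := ((hasDerivAt_of_smooth hu'sm 0).const_mul ρ⁻¹).smul_const (B 0)
    have e2 := (((hasDerivAt_of_smooth husm 0).fun_mul (hasDerivAt_of_smooth hu'sm 0)).const_mul
      (ρ ^ 2)⁻¹).smul_const (deriv B 0)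
    rw [(((hasDerivAt_of_smooth hB 0).fun_sub e1).fun_sub e2).deriv, hu0, hu'0, hu''0]
    have : (ρ ^ 2)⁻¹ * (ρ * ρ + 0 * 0) = 1 := by field_simp; ring
    rw [this]
    simp
  obtain ⟨R, hR, hDR, -⟩ := exists_smooth_quotient_sq hDsm hD0 hD'0
  have hRP : ContDiff ℝ (⊤ : ℕ∞) fun x => (P x)⁻¹ • R x :=
    (hP.inv fun x => (hPpos x).ne').smul hR
  obtain ⟨K, hK⟩ := exists_norm_integral_le_of_eq_deriv_smul (a := -δ) (b := δ) (D := D)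
    (fun x => hasDerivAt_of_smooth hψ x) (smooth_deriv hψ).continuous
    (fun x => hasDerivAt_of_smooth hRP x) (smooth_deriv hRP).continuous fun x hx => by
      have hx' := (hmem x hx).trans (hδle.trans (min_le_left _ _))
      rw [Complex.coe_smul, smul_smul, hdp, ← hPp x hx', mul_assoc, mul_inv_cancel₀ (hPpos x).ne',
        mul_one, hDR]
  have hL : 0 < u δ := mul_pos hδ (hwpos δ)
  obtain ⟨K0, hK0⟩ := exists_norm_integral_pow_mul_cexp_sub_le (k := 0) (by norm_num) hL
  obtain ⟨K1, hK1⟩ := exists_norm_integral_pow_mul_cexp_sub_le (k := 1) (by norm_num) hL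
  refine ⟨K + (K0 * (ρ⁻¹ * ‖B 0‖) + K1 * ((ρ ^ 2)⁻¹ * ‖deriv B 0‖)), fun l hl => ?_⟩
  have hBc := hB.continuous
  have huc := husm.continuous
  have hu'c := hu'sm.continuous
  have hψc := hψ.continuous
  have hDc := hDsm.continuous
  -- The factor `u'` makes the substitution `v = u(x)` exact; no monotonicity of `u` is needed.
  have hsubst : ∀ k : ℕ, ∫ x in (-δ)..δ, Complex.exp (Complex.I * (l * ψ x : ℝ)) *
      ((u x ^ k * deriv u x : ℝ) : ℂ)
      = ∫ v in (-u δ)..(u δ), (v : ℂ) ^ k * Complex.exp (Complex.I * (l * v ^ 3)) := fun k => by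
    have := intervalIntegral.integral_deriv_smul_comp (a := -δ) (b := δ)
      (g := fun v : ℝ => (v : ℂ) ^ k * Complex.exp (Complex.I * (l * v ^ 3)))
      (fun x _ => hasDerivAt_of_smooth husm x) hu'c.continuousOn (by fun_prop)
    rw [huodd] at this
    rw [← this]
    refine intervalIntegral.integral_congr fun x hx => ?_
    simp only [Function.comp, Complex.real_smul, ← hu3 x hx]
    push_cast
    ring
  have hsplit : ∫ x in (-δ)..δ, Complex.exp (Complex.I * (l * ψ x : ℝ)) • B x =
      (∫ x in (-δ)..δ, Complex.exp (Complex.I * (l * ψ x : ℝ)) • D x)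
      + (∫ v in (-u δ)..(u δ), (v : ℂ) ^ 0 * Complex.exp (Complex.I * (l * v ^ 3))) •
          ((ρ⁻¹ : ℝ) : ℂ) • B 0
      + (∫ v in (-u δ)..(u δ), (v : ℂ) ^ 1 * Complex.exp (Complex.I * (l * v ^ 3))) •
          (((ρ ^ 2)⁻¹ : ℝ) : ℂ) • deriv B 0 := by
    rw [← hsubst, ← hsubst, ← intervalIntegral.integral_smul_const,
      ← intervalIntegral.integral_smul_const, ← intervalIntegral.integral_add,
      ← intervalIntegral.integral_add]
    · refine intervalIntegral.integral_congr fun x _ => ?_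
      simp only [hD, ← Complex.coe_smul, smul_sub, smul_smul, pow_zero, one_mul, pow_one]
      push_cast
      rw [show ∀ s t : ℂ, Complex.exp (Complex.I * (l * ψ x)) * s * t
        = Complex.exp (Complex.I * (l * ψ x)) * (t * s) from fun s t => by ring,
        show ∀ s t : ℂ, Complex.exp (Complex.I * (l * ψ x)) * s * t
        = Complex.exp (Complex.I * (l * ψ x)) * (t * s) from fun s t => by ring]
      abel
    all_goals
      apply Continuous.intervalIntegrable
      fun_prop
  have ha6 : 0 < a / 6 := by positivity
  have hρpow : ∀ k : ℕ, (a / 6) ^ (-((k + 1) / 3) : ℝ) = (ρ ^ (k + 1))⁻¹ := fun k => by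
    rw [hρ, hw]
    simp only
    rw [hQ0, ← Real.rpow_natCast, ← Real.rpow_mul ha6.le, ← Real.rpow_neg ha6.le]
    congr 1
    push_cast
    ring
  have hc0 : airyCoeff a 0 = ((ρ⁻¹ : ℝ) : ℂ) * airyMoment 0 := by
    rw [airyCoeff, sign_pos ha, abs_of_pos ha, hρpow]
    simp
  have hc1 : airyCoeff a 1 = (((ρ ^ 2)⁻¹ : ℝ) : ℂ) * airyMoment 1 := by
    rw [airyCoeff, sign_pos ha, abs_of_pos ha, hρpow]
    simp
  have h0 := hK0 l hl
  have h1' := hK1 l hl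
  rw [show (-((((0 : ℕ) : ℝ) + 1) / 3) : ℝ) = -(1 / 3) by norm_num] at h0
  rw [show (-((((1 : ℕ) : ℝ) + 1) / 3) : ℝ) = -(2 / 3) by norm_num] at h1'
  rw [hsplit, hc0, hc1]
  set I0 := ∫ v in (-u δ)..(u δ), (v : ℂ) ^ 0 * Complex.exp (Complex.I * (l * v ^ 3))
  set I1 := ∫ v in (-u δ)..(u δ), (v : ℂ) ^ 1 * Complex.exp (Complex.I * (l * v ^ 3))
  set ID := ∫ x in (-δ)..δ, Complex.exp (Complex.I * (l * ψ x : ℝ)) • D x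
  have hre : ID + I0 • ((ρ⁻¹ : ℝ) : ℂ) • B 0 + I1 • (((ρ ^ 2)⁻¹ : ℝ) : ℂ) • deriv B 0
      - (((l ^ (-(1 / 3) : ℝ) : ℝ) : ℂ) * (((ρ⁻¹ : ℝ) : ℂ) * airyMoment 0)) • B 0
      - (((l ^ (-(2 / 3) : ℝ) : ℝ) : ℂ) * ((((ρ ^ 2)⁻¹ : ℝ) : ℂ) * airyMoment 1)) • deriv B 0
      = ID + ((I0 - ((l ^ (-(1 / 3) : ℝ) : ℝ) : ℂ) * airyMoment 0) • ((ρ⁻¹ : ℝ) : ℂ) • B 0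
        + (I1 - ((l ^ (-(2 / 3) : ℝ) : ℝ) : ℂ) * airyMoment 1) •
          (((ρ ^ 2)⁻¹ : ℝ) : ℂ) • deriv B 0) := by
    module
  rw [hre, add_mul]
  have hρpos : 0 < ρ := hwpos 0
  refine (norm_add_le _ _).trans (add_le_add (hK l hl) ((norm_add_le _ _).trans ?_))
  rw [norm_smul, norm_smul, norm_smul, norm_smul, Complex.norm_real, Complex.norm_real,
    Real.norm_of_nonneg (by positivity), Real.norm_of_nonneg (by positivity), add_mul]
  refine add_le_add ?_ ?_
  · calc _ ≤ K0 * l⁻¹ * (ρ⁻¹ * ‖B 0‖) := mul_le_mul_of_nonneg_right h0 (by positivity)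
      _ = _ := by ring
  · calc _ ≤ K1 * l⁻¹ * ((ρ ^ 2)⁻¹ * ‖deriv B 0‖) :=
        mul_le_mul_of_nonneg_right h1' (by positivity)
      _ = _ := by ring

/-- The sign change at `k = 1` matters on the doubly resonant ray, where it makes the two
second-order terms enter with opposite signs. -/
theorem airyCoeff_neg (a : ℝ) (k : ℕ) : airyCoeff (-a) k = (-1) ^ k * airyCoeff a k := by
  rw [airyCoeff, airyCoeff, Left.sign_neg, abs_neg]
  push_cast
  rw [neg_pow]
  ring

/-- Two-term stationary phase expansion at a cubic stationary point of an odd phase. -/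
theorem exists_airy_expansion {ψ : ℝ → ℝ} (hψ : ContDiff ℝ (⊤ : ℕ∞) ψ)
    (hodd : ∀ x, ψ (-x) = -ψ x) (h1 : deriv ψ 0 = 0) (ha : iteratedDeriv 3 ψ 0 ≠ 0) :
    ∃ δ₀, 0 < δ₀ ∧ ∀ δ, 0 < δ → δ ≤ δ₀ → ∀ B : ℝ → E, ContDiff ℝ (⊤ : ℕ∞) B →
      ∃ K, ∀ l : ℝ, 0 < l →
        ‖(∫ x in (-δ)..δ, Complex.exp (Complex.I * (l * ψ x : ℝ)) • B x)
          - (((l ^ (-(1 / 3) : ℝ) : ℝ) : ℂ) * airyCoeff (iteratedDeriv 3 ψ 0) 0) • B 0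
          - (((l ^ (-(2 / 3) : ℝ) : ℝ) : ℂ) * airyCoeff (iteratedDeriv 3 ψ 0) 1) • deriv B 0‖
          ≤ K * l⁻¹ := by
  rcases ha.lt_or_gt with h | h
  -- Reflecting `x` replaces `ψ` by `-ψ` and `B(x)` by `B(-x)`; the sign of `B'(0)` is absorbed by
  -- `airyCoeff_neg`.
  · have h3 : iteratedDeriv 3 (fun x => -ψ x) 0 = -iteratedDeriv 3 ψ 0 := iteratedDeriv_fun_neg _ _ _
    obtain ⟨δ₀, hδ₀, hexp⟩ := exists_airy_expansion_of_pos (E := E) hψ.neg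
      (fun x => by rw [hodd]) (by rw [deriv.fun_neg, h1, neg_zero])
      (by rw [h3]; exact neg_pos.2 h)
    refine ⟨δ₀, hδ₀, fun δ hδ hδle B hB => ?_⟩
    obtain ⟨K, hK⟩ := hexp δ hδ hδle (fun x => B (-x)) (hB.comp contDiff_neg)
    refine ⟨K, fun l hl => ?_⟩
    have := hK l hl
    rw [h3, airyCoeff_neg, airyCoeff_neg, deriv_comp_neg, neg_zero] at this
    have hint := intervalIntegral.integral_comp_neg (a := -δ) (b := δ)
      (fun x => Complex.exp (Complex.I * (l * ψ x : ℝ)) • B x)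
    simp only [hodd, neg_neg] at hint
    rw [hint] at this
    simpa using this
  · exact exists_airy_expansion_of_pos hψ hodd h1 h

end StationaryPhase

/-! ### The phase at frequency zero -/

section Phase

theorem hasDerivAt_theta_zero {m : ℝ} (hm : 0 < m) : HasDerivAt (theta m) (Real.sin m / m) 0 := by
  have hw0 : omegaFreq m 0 = m := by simp [omegaFreq, Real.sqrt_sq hm.le]
  have hg : ContDiff ℝ 1 (fun ξ => Real.sin (omegaFreq m ξ) /
      Real.sqrt (m ^ 2 + ξ ^ 2 * Real.cos (omegaFreq m ξ) ^ 2)) :=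
    (Real.contDiff_sin.comp (contDiff_omegaFreq hm.ne')).div (contDiff_discr hm.ne')
      fun ξ => (Real.sqrt_pos.2 (discr_pos hm.ne' ξ)).ne'
  have h := ((hasDerivAt_id' (0 : ℝ)).fun_mul
    (hg.differentiable one_ne_zero 0).hasDerivAt).arctan
  simp only [mul_div_assoc'] at h
  refine h.congr_deriv ?_
  simp [hw0, Real.sqrt_sq hm.le]

/-- The two group velocities `∓2θ'(0)` therefore coincide exactly when `sin m = 0`. -/
theorem deriv_theta_zero {m : ℝ} (hm : 0 < m) : deriv (theta m) 0 = Real.sin m / m :=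
  (hasDerivAt_theta_zero hm).deriv

theorem smooth_theta {m : ℝ} (hm : 0 < m) : ContDiff ℝ (⊤ : ℕ∞) (theta m) :=
  contDiff_theta hm.ne'

theorem smooth_linear_phase {m : ℝ} (hm : 0 < m) (c d : ℝ) :
    ContDiff ℝ (⊤ : ℕ∞) (fun ξ => c * theta m ξ + d * ξ) :=
  (contDiff_const.mul (smooth_theta hm)).add (contDiff_const.mul contDiff_id)

theorem linear_phase_odd (m c d ξ : ℝ) :
    c * theta m (-ξ) + d * (-ξ) = -(c * theta m ξ + d * ξ) := by
  rw [theta_neg]; ring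

theorem deriv_linear_phase {m : ℝ} (hm : 0 < m) (c d : ℝ) :
    deriv (fun ξ => c * theta m ξ + d * ξ) = fun ξ => c * deriv (theta m) ξ + d := by
  funext ξ
  have := ((hasDerivAt_of_smooth (smooth_theta hm) ξ).const_mul c).fun_add
    ((hasDerivAt_id' ξ).const_mul d)
  rw [this.deriv, mul_one]

theorem iteratedDeriv_three_linear_phase {m : ℝ} (hm : 0 < m) (c d : ℝ) :
    iteratedDeriv 3 (fun ξ => c * theta m ξ + d * ξ) 0 = c * iteratedDeriv 3 (theta m) 0 := by
  have h1 := smooth_deriv (smooth_theta hm)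
  have h2 : deriv (fun ξ => c * deriv (theta m) ξ + d) = fun ξ => c * deriv (deriv (theta m)) ξ := by
    funext ξ
    rw [(((hasDerivAt_of_smooth h1 ξ).const_mul c).add_const d).deriv]
  simp only [iteratedDeriv_succ, iteratedDeriv_zero]
  rw [deriv_linear_phase hm, h2,
    ((hasDerivAt_of_smooth (smooth_deriv h1) 0).const_mul c).deriv]

end Phase

/-! ### Splitting into branches and the Airy constant -/

section Branches

theorem cexp_smul_matrixOp_eq (ξ x θ : ℝ) (n : ℕ) (s : ℝ) (v : Spinor) :
    Complex.exp (Complex.I * ξ * x) • Complex.exp (Complex.I * (n * (s * θ))) • v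
      = Complex.exp (Complex.I * ((x * ξ + n * (s * θ) : ℝ) : ℂ)) • v := by
  rw [smul_smul, ← Complex.exp_add]
  congr 2
  push_cast
  ring

theorem continuous_branchProj {m : ℝ} (hm : m ≠ 0) (ε : ℝ) :
    Continuous fun ξ => matrixOp (branchProj m ε ξ) :=
  (contDiff_branchProj hm ε (n := 0)).continuous

/-- The two branches of the monodromy. -/
theorem IsBandProfile.monodromy_iterate_eq_branches {δ m : ℝ} (hm : 0 < m) (hδ : 0 < δ)
    {g h : ℝ → Spinor} (hg : IsBandProfile δ g h) {ε : ℝ} (hε : ε = 1 ∨ ε = -1) (n : ℕ) (x : ℝ) :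
    (monodromy m)^[n] g x =
      (1 / (2 * (Real.pi : ℂ))) • (∫ ξ in (-δ)..δ,
        Complex.exp (Complex.I * ((x * ξ + n * (2 * ε * theta m ξ) : ℝ) : ℂ)) •
          matrixOp (branchProj m ε ξ) (h ξ))
      + (1 / (2 * (Real.pi : ℂ))) • (∫ ξ in (-δ)..δ,
        Complex.exp (Complex.I * ((x * ξ + n * (2 * (-ε) * theta m ξ) : ℝ) : ℂ)) •
          matrixOp (branchProj m (-ε) ξ) (h ξ)) := by
  have hθ := (smooth_theta hm).continuous
  have hh := hg.smooth.continuous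
  have hP := fun s => (continuous_branchProj hm.ne' s).clm_apply hh
  have hphase : ∀ s : ℝ, Continuous fun ξ : ℝ =>
      Complex.exp (Complex.I * ((x * ξ + n * (2 * s * theta m ξ) : ℝ) : ℂ)) :=
    fun s => continuous_cexp_I_mul (by fun_prop)
  have hmain : (monodromy m)^[n] g x =
      (1 / (2 * (Real.pi : ℂ))) • (∫ ξ in (-δ)..δ,
        Complex.exp (Complex.I * ((x * ξ + n * (2 * 1 * theta m ξ) : ℝ) : ℂ)) •
          matrixOp (branchProj m 1 ξ) (h ξ))
      + (1 / (2 * (Real.pi : ℂ))) • (∫ ξ in (-δ)..δ,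
        Complex.exp (Complex.I * ((x * ξ + n * (2 * (-1) * theta m ξ) : ℝ) : ℂ)) •
          matrixOp (branchProj m (-1) ξ) (h ξ)) := by
    rw [hg.monodromy_iterate_apply hm.ne' hδ, ← smul_add, ← intervalIntegral.integral_add]
    · congr 1
      refine intervalIntegral.integral_congr fun ξ _ => ?_
      simp only [← cexp_smul_matrixOp_eq, monodromySymbol_pow hm.ne', map_add, map_smul, add_apply,
        smul_apply, smul_add]
      push_cast
      ring_nf
    · exact ((hphase 1).smul (hP 1)).intervalIntegrable _ _
    · exact ((hphase (-1)).smul (hP (-1))).intervalIntegrable _ _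
  rcases hε with rfl | rfl
  · exact hmain
  · rw [hmain, add_comm, neg_neg]

/-- Its trace is `1`. -/
theorem branchProj_zero_ne_zero {m : ℝ} (hm : 0 < m) (ε : ℝ) : branchProj m ε 0 ≠ 0 := by
  intro h
  have h0 := congrFun (congrFun h 0) 0
  have h1 := congrFun (congrFun h 1) 1
  rw [branchProj, branchGen_zero hm] at h0 h1
  simp at h0 h1
  have : (2 : ℂ) = 0 := by linear_combination h0 + h1
  norm_num at this

/-- The derivative at frequency zero of the spectral projection. -/
noncomputable def branchProjDeriv (m ε : ℝ) : Matrix (Fin 2) (Fin 2) ℂ :=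
  matrixOp.symm (deriv (fun ξ => matrixOp (branchProj m ε ξ)) 0)

theorem hasDerivAt_clm_apply_complex {E F : Type*} [NormedAddCommGroup E] [NormedSpace ℂ E]
    [NormedAddCommGroup F] [NormedSpace ℂ F] {A : ℝ → E →L[ℂ] F} {A' : E →L[ℂ] F} {v : ℝ → E}
    {v' : E} {x : ℝ} (hA : HasDerivAt A A' x) (hv : HasDerivAt v v' x) :
    HasDerivAt (fun x => A x (v x)) (A' (v x) + A x v') x := by
  have h := ((ContinuousLinearMap.restrictScalarsL ℂ E F ℝ ℝ).hasFDerivAt.comp_hasDerivAt x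
    hA).clm_apply hv
  exact h

theorem deriv_branchProj_apply {m : ℝ} (hm : 0 < m) (ε : ℝ) {h : ℝ → Spinor}
    (hh : ContDiff ℝ (⊤ : ℕ∞) h) :
    deriv (fun ξ => matrixOp (branchProj m ε ξ) (h ξ)) 0 =
      matrixOp (branchProjDeriv m ε) (h 0) + matrixOp (branchProj m ε 0) (deriv h 0) := by
  rw [(hasDerivAt_clm_apply_complex
    (hasDerivAt_of_smooth (contDiff_branchProj hm.ne' ε) 0) (hasDerivAt_of_smooth hh 0)).deriv,
    branchProjDeriv, StarAlgEquiv.apply_symm_apply]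

theorem airyMoment_ne_zero (k : ℕ) : airyMoment k ≠ 0 := by
  have : 0 < Real.Gamma (((k : ℝ) + 1) / 3) := Real.Gamma_pos_of_pos (by positivity)
  exact mul_ne_zero (pow_ne_zero _ Complex.I_ne_zero)
    (by exact_mod_cast (div_pos this (by positivity)).ne')

theorem airyCoeff_ne_zero {a : ℝ} (ha : a ≠ 0) (k : ℕ) : airyCoeff a k ≠ 0 := by
  refine mul_ne_zero ?_ (airyMoment_ne_zero k)
  have h1 : (0 : ℝ) < (|a| / 6) ^ (-((k + 1) / 3) : ℝ) :=
    Real.rpow_pos_of_pos (by have := abs_pos.2 ha; positivity) _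
  have h2 : (SignType.sign a : ℝ) ≠ 0 := by
    rcases ha.lt_or_gt with h | h
    · simp [sign_neg h]
    · simp [sign_pos h]
  exact_mod_cast mul_ne_zero (pow_ne_zero _ h2) h1.ne'

theorem airyAtZero_pos : 0 < airyAtZero := by
  have := Real.Gamma_pos_of_pos (show (0 : ℝ) < 2 / 3 by norm_num)
  unfold airyAtZero
  positivity

/-- The reflection formula `Γ(1/3)Γ(2/3) = 2π/√3` trades `Γ(1/3)` for `1/Γ(2/3)`, and
`(2|a|/6)^{-1/3} = 3^{1/3}|a|^{-1/3}` supplies the power of `3` in `Ai(0)`. -/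
theorem airyCoeff_zero_eq {m ε : ℝ} (hε : ε = 1 ∨ ε = -1) :
    (1 / (2 * (Real.pi : ℂ))) * airyCoeff (2 * ε * iteratedDeriv 3 (theta m) 0) 0
      = (airyConst m : ℝ) := by
  set a := iteratedDeriv 3 (theta m) 0 with ha
  have habs : |2 * ε * a| = 2 * |a| := by
    rcases hε with rfl | rfl <;> simp [abs_mul]
  have hG : Real.Gamma (1 / 3) * Real.Gamma (2 / 3) = 2 * Real.pi / Real.sqrt 3 := by
    have h := Real.Gamma_mul_Gamma_one_sub (1 / 3)
    rw [show (1 - 1 / 3 : ℝ) = 2 / 3 by norm_num, show Real.pi * (1 / 3) = Real.pi / 3 by ring,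
      Real.sin_pi_div_three] at h
    rw [h]
    field_simp
  have hG2 : 0 < Real.Gamma (2 / 3) := Real.Gamma_pos_of_pos (by norm_num)
  have h3 : Real.sqrt 3 * Real.sqrt 3 = 3 := Real.mul_self_sqrt (by norm_num)
  have h3' : 0 < Real.sqrt 3 := by positivity
  have hpow : (3 : ℝ) ^ (1 / 3 : ℝ) * (3 : ℝ) ^ (2 / 3 : ℝ) = 3 := by
    rw [← Real.rpow_add (by norm_num)]; norm_num
  have key : 1 / (2 * Real.pi) * ((|2 * ε * a| / 6) ^ (-(1 / 3) : ℝ) *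
      (Real.Gamma (1 / 3) / Real.sqrt 3)) = airyConst m := by
    rw [habs, airyConst, airyAtZero, ← ha, show 2 * |a| / 6 = |a| * 3⁻¹ by ring,
      Real.mul_rpow (abs_nonneg a) (by norm_num), Real.inv_rpow (by norm_num),
      ← Real.rpow_neg (by norm_num), neg_neg]
    have hG1 : Real.Gamma (1 / 3) = 2 * Real.pi / Real.sqrt 3 / Real.Gamma (2 / 3) := by
      rw [← hG]; field_simp
    have hp2 : (3 : ℝ) ^ (2 / 3 : ℝ) = 3 / (3 : ℝ) ^ (1 / 3 : ℝ) := by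
      rw [eq_div_iff (by positivity), mul_comm, hpow]
    rw [hG1, hp2]
    have : 0 < (3 : ℝ) ^ (1 / 3 : ℝ) := by positivity
    field_simp
    rw [sq, h3]
    ring
  rw [← key, airyCoeff, airyMoment]
  norm_num only [Nat.cast_zero, pow_zero, zero_add, one_mul]
  push_cast
  ring_nf

end Branches

/-! ### Dispersive bound and branch asymptotics -/

section Dispersion

/-- Near `0` an odd function with positive derivative grows at least linearly. -/
theorem exists_linear_lower_bound {g : ℝ → ℝ} (hg : ContDiff ℝ (⊤ : ℕ∞) g) (h0 : g 0 = 0)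
    (h1 : 0 < deriv g 0) :
    ∃ c δ₀, 0 < c ∧ 0 < δ₀ ∧ ∀ x ∈ Icc 0 δ₀, c * x ≤ g x := by
  obtain ⟨r, hr, hgr, hr0⟩ := exists_smooth_quotient hg h0
  have hlt : deriv g 0 / 2 < r 0 := by rw [hr0]; linarith
  obtain ⟨δ, hδ, hball⟩ := Metric.eventually_nhds_iff.1
    (hr.continuous.continuousAt.eventually (lt_mem_nhds hlt))
  refine ⟨deriv g 0 / 2, δ / 2, by positivity, by positivity, fun x hx => ?_⟩
  rw [hgr, smul_eq_mul, mul_comm x]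
  refine mul_le_mul_of_nonneg_right (hball ?_).le hx.1
  rw [Real.dist_0_eq_abs, abs_of_nonneg hx.1]
  linarith [hx.2]

theorem exists_branch_kernel_bound {m : ℝ} (hm : 0 < m) (ha : iteratedDeriv 3 (theta m) 0 ≠ 0) :
    ∃ δ₀, 0 < δ₀ ∧ ∀ δ, 0 < δ → δ ≤ δ₀ → ∀ ε : ℝ, ε = 1 ∨ ε = -1 → ∃ K, ∀ n : ℕ, 1 ≤ n → ∀ y : ℝ,
      ‖∫ ξ in (-δ)..δ, Complex.exp (Complex.I * ((y * ξ + n * (2 * ε * theta m ξ) : ℝ) : ℂ)) •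
        matrixOp (branchProj m ε ξ)‖ ≤ K * (n : ℝ) ^ (-(1 / 3) : ℝ) := by
  -- The sign `s` makes the third derivative of `φ = sθ` positive. The phase is then `yξ + τφ` with
  -- `τ = 2nεs`, so `|τ| = 2n`, and `y` stays arbitrary.
  obtain ⟨s, hs, hsa⟩ : ∃ s : ℝ, (s = 1 ∨ s = -1) ∧ 0 < s * iteratedDeriv 3 (theta m) 0 := by
    rcases ha.lt_or_gt with h | h
    · exact ⟨-1, Or.inr rfl, by linarith⟩
    · exact ⟨1, Or.inl rfl, by linarith⟩
  have hss : s * s = 1 := by rcases hs with rfl | rfl <;> norm_num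
  set φ : ℝ → ℝ := fun ξ => s * theta m ξ + 0 * ξ with hφ
  have hφs : ContDiff ℝ (⊤ : ℕ∞) φ := smooth_linear_phase hm s 0
  have hodd : ∀ x, φ (-x) = -φ x := linear_phase_odd m s 0
  have h3 : deriv (deriv (deriv φ)) 0 = s * iteratedDeriv 3 (theta m) 0 := by
    rw [← iteratedDeriv_three_linear_phase hm s 0]
    simp only [iteratedDeriv_succ, iteratedDeriv_zero]
    rfl
  have hφ' := smooth_deriv hφs
  have hφ'' := smooth_deriv hφ'
  obtain ⟨c, δ₀, hc, hδ₀, hlow⟩ := exists_linear_lower_bound hφ''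
    (eq_zero_of_odd (deriv_odd_of_even (deriv_even_of_odd hodd))) (by rw [h3]; exact hsa)
  refine ⟨δ₀, hδ₀, fun δ hδ hδle ε hε => ?_⟩
  obtain ⟨K, hK⟩ := exists_norm_intervalIntegral_le_cube_root hδ.le hc hodd
    (fun x => hasDerivAt_of_smooth hφs x) (fun x => hasDerivAt_of_smooth hφ' x) hφ''.continuous
    (fun x hx => hlow x ⟨hx.1, hx.2.trans hδle⟩) (contDiff_branchProj hm.ne' ε)
  refine ⟨K * (2 : ℝ) ^ (-(1 / 3) : ℝ), fun n hn y => ?_⟩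
  have hn0 : (0 : ℝ) < n := by exact_mod_cast hn
  have hτ : |(2 * n * ε * s : ℝ)| = 2 * n := by
    rcases hε with rfl | rfl <;> rcases hs with rfl | rfl <;> simp [abs_mul]
  have := hK (2 * n * ε * s) (by
    rw [← abs_pos, hτ]; positivity) y
  rw [hτ, Real.mul_rpow (by norm_num) hn0.le, ← mul_assoc] at this
  refine le_trans (le_of_eq ?_) this
  congr 1
  refine intervalIntegral.integral_congr fun ξ _ => ?_
  simp only [hφ]
  congr 4
  linear_combination (-2 * n * ε * theta m ξ) * hss

/-- The branch operators are convolutions with their kernels. -/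
theorem norm_branch_integral_le {m δ : ℝ} (hm : 0 < m) (hδ : 0 < δ) (ε : ℝ) (n : ℕ) {K : ℝ}
    (hK : ∀ y : ℝ, ‖∫ ξ in (-δ)..δ,
      Complex.exp (Complex.I * ((y * ξ + n * (2 * ε * theta m ξ) : ℝ) : ℂ)) •
        matrixOp (branchProj m ε ξ)‖ ≤ K) {f : ℝ → Spinor} (hf : Integrable f)
    (hfc : Continuous f) (x : ℝ) :
    ‖∫ ξ in (-δ)..δ, Complex.exp (Complex.I * ((x * ξ + n * (2 * ε * theta m ξ) : ℝ) : ℂ)) •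
      matrixOp (branchProj m ε ξ) (fourierT f ξ)‖ ≤ K * ∫ y, ‖f y‖ := by
  have hθ := (smooth_theta hm).continuous
  have hP := continuous_branchProj hm.ne' ε
  obtain ⟨D, hD⟩ := (isCompact_Icc (a := -δ) (b := δ)).exists_bound_of_continuousOn hP.continuousOn
  -- Inserting the definition of `f̂` and exchanging the integrals leaves the kernel at `x - y`
  -- applied to `f(y)`.
  set G : ℝ → ℝ → Spinor := fun ξ y =>
    Complex.exp (Complex.I * (((x - y) * ξ + n * (2 * ε * theta m ξ) : ℝ) : ℂ)) •
      matrixOp (branchProj m ε ξ) (f y) with hG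
  have hGc : Continuous (Function.uncurry G) := by
    have h1 : Continuous fun p : ℝ × ℝ => Complex.exp
        (Complex.I * (((x - p.2) * p.1 + n * (2 * ε * theta m p.1) : ℝ) : ℂ)) := by fun_prop
    exact h1.smul ((hP.comp continuous_fst).clm_apply (hfc.comp continuous_snd))
  have hGi : Integrable (Function.uncurry G) ((volume.restrict (Ioc (-δ) δ)).prod volume) := by
    have hdom : Integrable (fun p : ℝ × ℝ => D * ‖f p.2‖)
        ((volume.restrict (Ioc (-δ) δ)).prod volume) := (hf.norm.const_mul D).comp_snd _
    refine hdom.mono' hGc.aestronglyMeasurable ?_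
    have hmem : ∀ᵐ p : ℝ × ℝ ∂((volume.restrict (Ioc (-δ) δ)).prod volume), p.1 ∈ Ioc (-δ) δ :=
      Measure.quasiMeasurePreserving_fst.ae (ae_restrict_mem measurableSet_Ioc)
    filter_upwards [hmem] with p hp
    simp only [Function.uncurry_def, hG, norm_smul, Complex.norm_exp_I_mul_ofReal, one_mul]
    exact (ContinuousLinearMap.le_opNorm _ _).trans
      (mul_le_mul_of_nonneg_right (hD _ (Ioc_subset_Icc_self hp)) (norm_nonneg _))
  have hle : -δ ≤ δ := by linarith
  have e1 : ∫ ξ in (-δ)..δ, Complex.exp (Complex.I * ((x * ξ + n * (2 * ε * theta m ξ) : ℝ) : ℂ)) •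
      matrixOp (branchProj m ε ξ) (fourierT f ξ) = ∫ ξ in Ioc (-δ) δ, ∫ y, G ξ y := by
    rw [intervalIntegral.integral_of_le hle]
    refine integral_congr_ae (.of_forall fun ξ => ?_)
    have hfi : Integrable fun y : ℝ => Complex.exp (-(Complex.I * ξ * y)) • f y := by
      refine hf.norm.mono' ?_ (.of_forall fun y => ?_)
      · have hexp : Continuous fun y : ℝ => Complex.exp (-(Complex.I * ξ * y)) := by fun_prop
        exact (hexp.smul hfc).aestronglyMeasurable
      · rw [norm_smul, show -(Complex.I * ξ * y) = Complex.I * ((-(ξ * y) : ℝ) : ℂ) by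
          push_cast; ring, Complex.norm_exp_I_mul_ofReal, one_mul]
    simp only [fourierT]
    rw [← ContinuousLinearMap.integral_comp_comm _ hfi, ← integral_smul]
    refine integral_congr_ae (.of_forall fun y => ?_)
    simp only [hG, map_smul, smul_smul, ← Complex.exp_add]
    congr 2
    push_cast
    ring
  rw [e1, integral_integral_swap hGi, ← integral_const_mul]
  refine norm_integral_le_of_norm_le (hf.norm.const_mul K) (.of_forall fun y => ?_)
  have e2 : ∫ ξ in Ioc (-δ) δ, G ξ y = (∫ ξ in (-δ)..δ,
      Complex.exp (Complex.I * (((x - y) * ξ + n * (2 * ε * theta m ξ) : ℝ) : ℂ)) •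
        matrixOp (branchProj m ε ξ)) (f y) := by
    rw [← intervalIntegral.integral_of_le hle, ContinuousLinearMap.intervalIntegral_apply]
    · rfl
    · have hexp : Continuous fun ξ : ℝ => Complex.exp
          (Complex.I * (((x - y) * ξ + n * (2 * ε * theta m ξ) : ℝ) : ℂ)) := by fun_prop
      exact (hexp.smul hP).intervalIntegrable _ _
  rw [e2]
  exact (ContinuousLinearMap.le_opNorm _ _).trans
    (mul_le_mul_of_nonneg_right (hK _) (norm_nonneg _))

theorem exists_dispersive_bound {m : ℝ} (hm : 0 < m) (ha : iteratedDeriv 3 (theta m) 0 ≠ 0) :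
    ∃ δ₀, 0 < δ₀ ∧ ∀ δ, 0 < δ → δ ≤ δ₀ →
      ∃ K : ℝ, ∀ f : 𝓢(ℝ, Spinor), BandLimited δ f → ∀ n : ℕ, 1 ≤ n → ∀ x : ℝ,
        ‖(monodromy m)^[n] f x‖ ≤ K * (n : ℝ) ^ (-(1 / 3) : ℝ) * ∫ y : ℝ, ‖f y‖ := by
  obtain ⟨δ₀, hδ₀, hker⟩ := exists_branch_kernel_bound hm ha
  refine ⟨δ₀, hδ₀, fun δ hδ hδle => ?_⟩
  obtain ⟨K1, hK1⟩ := hker δ hδ hδle 1 (Or.inl rfl)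
  obtain ⟨K2, hK2⟩ := hker δ hδ hδle (-1) (Or.inr rfl)
  refine ⟨‖(1 / (2 * (Real.pi : ℂ)))‖ * (K1 + K2), fun f hf n hn x => ?_⟩
  rw [hf.isBandProfile.monodromy_iterate_eq_branches hm hδ (Or.inl rfl)]
  refine (norm_add_le _ _).trans ?_
  rw [norm_smul, norm_smul, ← mul_add]
  have h1 := norm_branch_integral_le hm hδ 1 n (hK1 n hn) (f.integrable) f.continuous x
  have h2 := norm_branch_integral_le hm hδ (-1) n (hK2 n hn) (f.integrable) f.continuous x
  refine (mul_le_mul_of_nonneg_left (add_le_add h1 h2) (norm_nonneg _)).trans (le_of_eq ?_)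
  ring

/-- The contribution of the branch whose group velocity matches the ray. -/
theorem exists_resonant_branch_expansion {m : ℝ} (hm : 0 < m)
    (ha : iteratedDeriv 3 (theta m) 0 ≠ 0) {ε : ℝ} (hε : ε = 1 ∨ ε = -1) :
    ∃ δ₀, 0 < δ₀ ∧ ∀ δ, 0 < δ → δ ≤ δ₀ → ∀ h : ℝ → Spinor, ContDiff ℝ (⊤ : ℕ∞) h →
      ∃ K, ∀ n : ℕ, 1 ≤ n →
        ‖(1 / (2 * (Real.pi : ℂ))) • (∫ ξ in (-δ)..δ, Complex.exp (Complex.I *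
            ((n * (-2 * ε * deriv (theta m) 0) * ξ + n * (2 * ε * theta m ξ) : ℝ) : ℂ)) •
              matrixOp (branchProj m ε ξ) (h ξ))
          - ((airyConst m * (n : ℝ) ^ (-(1 / 3) : ℝ) : ℝ) : ℂ) • matrixOp (branchProj m ε 0) (h 0)
          - (((n : ℝ) ^ (-(2 / 3) : ℝ) : ℝ) : ℂ) •
            (matrixOp ((1 / (2 * (Real.pi : ℂ)) *
                airyCoeff (2 * ε * iteratedDeriv 3 (theta m) 0) 1) • branchProjDeriv m ε) (h 0)
              + matrixOp ((1 / (2 * (Real.pi : ℂ)) *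
                airyCoeff (2 * ε * iteratedDeriv 3 (theta m) 0) 1) • branchProj m ε 0)
                  (deriv h 0))‖ ≤ K * (n : ℝ)⁻¹ := by
  have hε0 : (2 * ε : ℝ) ≠ 0 := by rcases hε with rfl | rfl <;> norm_num
  -- The slope of the ray is exactly the one that cancels the derivative of `2εθ` at `0`.
  obtain ⟨δ₀, hδ₀, hexp⟩ := exists_airy_expansion (E := Spinor)
    (smooth_linear_phase hm (2 * ε) (-2 * ε * deriv (theta m) 0)) (linear_phase_odd m _ _)
    (by rw [deriv_linear_phase hm]; ring)
    (by rw [iteratedDeriv_three_linear_phase hm]; exact mul_ne_zero hε0 ha)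
  refine ⟨δ₀, hδ₀, fun δ hδ hδle h hh => ?_⟩
  obtain ⟨K, hK⟩ := hexp δ hδ hδle _ ((contDiff_branchProj hm.ne' ε).complex_clm_apply hh)
  refine ⟨‖(1 / (2 * (Real.pi : ℂ)))‖ * K, fun n hn => ?_⟩
  have hn0 : (0 : ℝ) < n := by exact_mod_cast hn
  have := mul_le_mul_of_nonneg_left (hK n hn0) (norm_nonneg (1 / (2 * (Real.pi : ℂ))))
  rw [iteratedDeriv_three_linear_phase hm, deriv_branchProj_apply hm ε hh, ← norm_smul,
    ← mul_assoc] at this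
  refine le_trans (le_of_eq ?_) this
  congr 1
  rw [smul_sub, smul_sub]
  refine congrArg₂ (· - ·) (congrArg₂ (· - ·) ?_ ?_) ?_
  · congr 1
    refine intervalIntegral.integral_congr fun ξ _ => ?_
    congr 4
    ring
  · rw [smul_smul]
    congr 1
    rw [mul_left_comm, airyCoeff_zero_eq hε]
    push_cast
    ring
  · simp only [map_smul, smul_apply, ← smul_add, smul_smul]
    congr 1
    ring

/-- The other branch is nonstationary when the two group velocities differ. -/
theorem exists_nonresonant_branch_bound {m : ℝ} (hm : 0 < m) (hs : Real.sin m ≠ 0)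
    {ε : ℝ} (hε : ε = 1 ∨ ε = -1) :
    ∃ δ₀, 0 < δ₀ ∧ ∀ δ, 0 < δ → δ ≤ δ₀ → ∀ h : ℝ → Spinor, ContDiff ℝ (⊤ : ℕ∞) h →
      ∃ K, ∀ n : ℕ, 1 ≤ n →
        ‖(1 / (2 * (Real.pi : ℂ))) • (∫ ξ in (-δ)..δ, Complex.exp (Complex.I *
            ((n * (-2 * ε * deriv (theta m) 0) * ξ + n * (2 * (-ε) * theta m ξ) : ℝ) : ℂ)) •
              matrixOp (branchProj m (-ε) ξ) (h ξ))‖ ≤ K * (n : ℝ)⁻¹ := by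
  set φ : ℝ → ℝ := fun ξ => (2 * (-ε)) * theta m ξ + (-2 * ε * deriv (theta m) 0) * ξ with hφ
  have hφs : ContDiff ℝ (⊤ : ℕ∞) φ := smooth_linear_phase hm _ _
  have hev := deriv_even_of_odd (g := φ) (linear_phase_odd m _ _)
  have hφ0 : deriv φ 0 ≠ 0 := by
    rw [hφ, deriv_linear_phase hm]
    have : Real.sin m / m ≠ 0 := div_ne_zero hs hm.ne'
    simp only [deriv_theta_zero hm]
    rw [show 2 * -ε * (Real.sin m / m) + -2 * ε * (Real.sin m / m) = -4 * ε * (Real.sin m / m) by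
      ring]
    exact mul_ne_zero (by rcases hε with rfl | rfl <;> norm_num) this
  -- The derivative of the phase at `0` is `-4ε sin m / m ≠ 0`; near `0` it agrees with a smooth
  -- function without zeros.
  obtain ⟨P, δ₀, hP, hP0, hδ₀, hPφ⟩ : ∃ (P : ℝ → ℝ) (δ₀ : ℝ), ContDiff ℝ (⊤ : ℕ∞) P ∧
      (∀ x, P x ≠ 0) ∧ 0 < δ₀ ∧ ∀ x, |x| ≤ δ₀ → deriv φ x = P x := by
    rcases hφ0.lt_or_gt with h | h
    · obtain ⟨Q, hQ, hQpos, -, δ₀, hδ₀, hQq⟩ := exists_smooth_pos_extension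
        (smooth_deriv hφs).neg (neg_pos.2 h) (fun x => by rw [hev])
      exact ⟨fun x => -Q x, δ₀, hQ.neg, fun x => (neg_neg_of_pos (hQpos x)).ne, hδ₀,
        fun x hx => by simp only [hQq x hx, neg_neg]⟩
    · obtain ⟨Q, hQ, hQpos, -, δ₀, hδ₀, hQq⟩ := exists_smooth_pos_extension
        (smooth_deriv hφs) h hev
      exact ⟨Q, δ₀, hQ, fun x => (hQpos x).ne', hδ₀, fun x hx => (hQq x hx).symm⟩
  refine ⟨δ₀, hδ₀, fun δ hδ hδle h hh => ?_⟩
  obtain ⟨K, hK⟩ := exists_norm_integral_le_of_deriv_ne_zero (a := -δ) (b := δ) hφs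
    ((contDiff_branchProj hm.ne' (-ε)).complex_clm_apply hh) hP hP0 fun x hx => by
      rw [uIcc_of_le (by linarith)] at hx
      exact hPφ x ((abs_le.2 hx).trans hδle)
  refine ⟨‖(1 / (2 * (Real.pi : ℂ)))‖ * K, fun n hn => ?_⟩
  have hn0 : (0 : ℝ) < n := by exact_mod_cast hn
  rw [norm_smul, mul_assoc ‖_‖ K]
  refine mul_le_mul_of_nonneg_left (le_trans (le_of_eq ?_) (hK n hn0)) (norm_nonneg _)
  congr 1
  refine intervalIntegral.integral_congr fun ξ _ => ?_
  simp only [hφ]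
  congr 4
  ring

end Dispersion

/-! ### Expansion along the rays -/

section Rays

theorem isHermitian_branchProj_zero {m : ℝ} (hm : 0 < m) (ε : ℝ) :
    (branchProj m ε 0).IsHermitian := by
  rw [branchProj, branchGen_zero hm]
  ext i j
  fin_cases i <;> fin_cases j <;> simp [← Complex.cos_conj, ← Complex.sin_conj] <;> ring

/-- Hermitian projections with product `0` have orthogonal ranges, so Pythagoras applies to `v = P_ε
v + P_{-ε} v`. -/
theorem norm_sq_branchProj_add {m : ℝ} (hm : 0 < m) {ε : ℝ} (hε : ε = 1 ∨ ε = -1) (v : Spinor) :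
    ‖matrixOp (branchProj m ε 0) v‖ ^ 2 + ‖matrixOp (branchProj m (-ε) 0) v‖ ^ 2 = ‖v‖ ^ 2 := by
  have hsq : ε ^ 2 = 1 := by rcases hε with rfl | rfl <;> norm_num
  have hsum : matrixOp (branchProj m ε 0) v + matrixOp (branchProj m (-ε) 0) v = v := by
    rw [← add_apply, ← map_add, branchProj_add_neg, map_one]
    rfl
  have horth : inner ℂ (matrixOp (branchProj m ε 0) v) (matrixOp (branchProj m (-ε) 0) v) = 0 := by
    rw [← ContinuousLinearMap.adjoint_inner_right, ← ContinuousLinearMap.star_eq_adjoint,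
      ← map_star, Matrix.star_eq_conjTranspose, (isHermitian_branchProj_zero hm ε).eq,
      ← mul_apply_eq_comp, ← map_mul, branchProj_mul_neg hm.ne' hsq]
    simp
  have := norm_add_sq_eq_norm_sq_add_norm_sq_of_inner_eq_zero _ _ horth
  rw [hsum] at this
  rw [sq, sq, sq, this]

/-- Of two orthogonal projections with sum `1`, one keeps at least half of the squared norm. -/
theorem exists_branchProj_norm_bounds {m : ℝ} (hm : 0 < m) (v : Spinor) :
    ∃ ε : ℝ, (ε = 1 ∨ ε = -1) ∧ ‖v‖ / Real.sqrt 2 ≤ ‖matrixOp (branchProj m ε 0) v‖ ∧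
      ‖matrixOp (branchProj m ε 0) v‖ ≤ ‖v‖ := by
  have hpy := norm_sq_branchProj_add hm (Or.inl rfl) v
  have h2 : (0 : ℝ) < Real.sqrt 2 := Real.sqrt_pos.2 two_pos
  have key : ∀ a b : ℝ, 0 ≤ a → a ^ 2 + b ^ 2 = ‖v‖ ^ 2 → b ^ 2 ≤ a ^ 2 →
      ‖v‖ / Real.sqrt 2 ≤ a ∧ a ≤ ‖v‖ := by
    intro a b ha hab hba
    constructor
    · rw [div_le_iff₀ h2]
      refine le_of_sq_le_sq ?_ (by positivity)
      rw [mul_pow, Real.sq_sqrt two_pos.le]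
      linarith
    · exact le_of_sq_le_sq (by nlinarith [sq_nonneg b]) (norm_nonneg _)
  rcases le_total (‖matrixOp (branchProj m (-1) 0) v‖ ^ 2) (‖matrixOp (branchProj m 1 0) v‖ ^ 2)
    with h | h
  · exact ⟨1, Or.inl rfl, key _ _ (norm_nonneg _) hpy h⟩
  · exact ⟨-1, Or.inr rfl, key _ _ (norm_nonneg _) (by rw [add_comm]; exact hpy) h⟩

theorem polarization_ne_zero {m : ℝ} (hm : 0 < m) (ε : ℝ) : polarization m ε ≠ 0 := by
  by_cases hs : Real.sin m = 0
  · rw [polarization, if_pos hs]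
    exact one_ne_zero
  · rw [polarization_eq_branchProj hm hs]
    exact branchProj_zero_ne_zero hm ε

theorem airyConst_pos {m : ℝ} (ha : iteratedDeriv 3 (theta m) 0 ≠ 0) : 0 < airyConst m :=
  mul_pos airyAtZero_pos (Real.rpow_pos_of_pos (abs_pos.2 ha) _)

/-- For `sin m ≠ 0` only branch `ε` is resonant; for `sin m = 0` both are, on `x = 0`. The matrices
are fixed before `δ`, so `δ` may later be shrunk without changing them. -/
theorem exists_ray_expansion {m : ℝ} (hm : 0 < m) (ha : iteratedDeriv 3 (theta m) 0 ≠ 0) {ε : ℝ}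
    (hε : ε = 1 ∨ ε = -1) :
    ∃ δ₀, 0 < δ₀ ∧ ∃ D₀ D₁ : Matrix (Fin 2) (Fin 2) ℂ, D₁ ≠ 0 ∧ ∀ δ, 0 < δ → δ ≤ δ₀ →
      ∀ g h : ℝ → Spinor, IsBandProfile δ g h → ∃ K : ℝ, ∀ n : ℕ, 1 ≤ n →
        ‖(monodromy m)^[n] g (n * (-2 * ε * deriv (theta m) 0))
          - ((airyConst m * (n : ℝ) ^ (-(1 / 3) : ℝ) : ℝ) : ℂ) • matrixOp (polarization m ε) (h 0)
          - (((n : ℝ) ^ (-(2 / 3) : ℝ) : ℝ) : ℂ) •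
              (matrixOp D₀ (h 0) + matrixOp D₁ (deriv h 0))‖ ≤ K * (n : ℝ)⁻¹ := by
  obtain ⟨δ₁, hδ₁, H₁⟩ := exists_resonant_branch_expansion hm ha hε
  set κ : ℝ → ℂ := fun ε => 1 / (2 * (Real.pi : ℂ)) *
    airyCoeff (2 * ε * iteratedDeriv 3 (theta m) 0) 1 with hκ
  have hε0 : ε ≠ 0 := by rcases hε with rfl | rfl <;> norm_num
  have hκ0 : κ ε ≠ 0 := mul_ne_zero (by simp [Real.pi_ne_zero])
    (airyCoeff_ne_zero (mul_ne_zero (mul_ne_zero two_ne_zero hε0) ha) 1)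
  by_cases hs : Real.sin m = 0
  · have hε' : -ε = 1 ∨ -ε = -1 := by rcases hε with rfl | rfl <;> norm_num
    obtain ⟨δ₂, hδ₂, H₂⟩ := exists_resonant_branch_expansion hm ha hε'
    have hκneg : κ (-ε) = -κ ε := by
      simp only [hκ]
      rw [show 2 * -ε * iteratedDeriv 3 (theta m) 0 = -(2 * ε * iteratedDeriv 3 (theta m) 0) by ring,
        airyCoeff_neg]
      ring
    refine ⟨min δ₁ δ₂, lt_min hδ₁ hδ₂,
      κ ε • branchProjDeriv m ε + κ (-ε) • branchProjDeriv m (-ε),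
      κ ε • branchProj m ε 0 + κ (-ε) • branchProj m (-ε) 0, ?_, fun δ hδ hle g h hg => ?_⟩
    -- The opposite signs of `κ` leave the difference of the two projections, `ε` times `branchGen`,
    -- which is nonzero because its square is `1`.
    · have hP : κ ε • branchProj m ε 0 + κ (-ε) • branchProj m (-ε) 0
          = (κ ε * ε) • branchGen m 0 := by
        rw [hκneg, branchProj, branchProj]
        module
      rw [hP]
      refine smul_ne_zero (mul_ne_zero hκ0 (by exact_mod_cast hε0)) fun h0 => ?_
      have := branchGen_mul_self hm.ne' 0
      rw [h0, mul_zero] at this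
      exact zero_ne_one this
    · obtain ⟨K₁, hK₁⟩ := H₁ δ hδ (hle.trans (min_le_left _ _)) h hg.smooth
      obtain ⟨K₂, hK₂⟩ := H₂ δ hδ (hle.trans (min_le_right _ _)) h hg.smooth
      refine ⟨K₁ + K₂, fun n hn => ?_⟩
      rw [hg.monodromy_iterate_eq_branches hm hδ hε, add_mul]
      have k₁ := hK₁ n hn
      have k₂ := hK₂ n hn
      have hθ : deriv (theta m) 0 = 0 := by rw [deriv_theta_zero hm, hs, zero_div]
      simp only [hθ, mul_zero, zero_mul] at k₁ k₂ ⊢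
      refine le_trans (le_of_eq ?_) ((norm_add_le _ _).trans (add_le_add k₁ k₂))
      congr 1
      rw [polarization, if_pos hs, ← branchProj_add_neg m ε 0]
      simp only [map_add, add_apply, smul_add, hκ]
      abel
  · obtain ⟨δ₂, hδ₂, H₂⟩ := exists_nonresonant_branch_bound hm hs hε
    refine ⟨min δ₁ δ₂, lt_min hδ₁ hδ₂, κ ε • branchProjDeriv m ε, κ ε • branchProj m ε 0,
      smul_ne_zero hκ0 (branchProj_zero_ne_zero hm ε), fun δ hδ hle g h hg => ?_⟩
    obtain ⟨K₁, hK₁⟩ := H₁ δ hδ (hle.trans (min_le_left _ _)) h hg.smooth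
    obtain ⟨K₂, hK₂⟩ := H₂ δ hδ (hle.trans (min_le_right _ _)) h hg.smooth
    refine ⟨K₁ + K₂, fun n hn => ?_⟩
    rw [hg.monodromy_iterate_eq_branches hm hδ hε, add_mul, polarization_eq_branchProj hm hs,
      add_sub_right_comm, add_sub_right_comm]
    exact (norm_add_le _ _).trans (add_le_add (hK₁ n hn) (hK₂ n hn))

theorem fourierT_zero (f : ℝ → Spinor) : fourierT f 0 = ∫ x, f x := by
  simp [fourierT]

/-- A two-term expansion in powers of `n ^ (-1/3)` implies the one-term expansion. -/
theorem norm_leading_term_le {E : Type*} [NormedAddCommGroup E] [NormedSpace ℂ E] {u : ℕ → E}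
    {w : E} {K : ℝ} (h : ∀ n : ℕ, 1 ≤ n →
      ‖u n - (((n : ℝ) ^ (-(2 / 3) : ℝ) : ℝ) : ℂ) • w‖ ≤ K * (n : ℝ)⁻¹) (n : ℕ) (hn : 1 ≤ n) :
    ‖u n‖ ≤ (K + ‖w‖) * (n : ℝ) ^ (-(2 / 3) : ℝ) := by
  have hK : 0 ≤ K := by simpa using (norm_nonneg _).trans (h 1 le_rfl)
  have hn1 : (1 : ℝ) ≤ n := by exact_mod_cast hn
  have hinv : (n : ℝ)⁻¹ ≤ (n : ℝ) ^ (-(2 / 3) : ℝ) := by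
    rw [← Real.rpow_neg_one]
    exact Real.rpow_le_rpow_of_exponent_le hn1 (by norm_num)
  have hpos : 0 ≤ (n : ℝ) ^ (-(2 / 3) : ℝ) := by positivity
  calc ‖u n‖ ≤ ‖u n - (((n : ℝ) ^ (-(2 / 3) : ℝ) : ℝ) : ℂ) • w‖
        + ‖(((n : ℝ) ^ (-(2 / 3) : ℝ) : ℝ) : ℂ) • w‖ := by
        simpa using norm_add_le (u n - (((n : ℝ) ^ (-(2 / 3) : ℝ) : ℝ) : ℂ) • w)
          ((((n : ℝ) ^ (-(2 / 3) : ℝ) : ℝ) : ℂ) • w)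
    _ ≤ K * (n : ℝ) ^ (-(2 / 3) : ℝ) + (n : ℝ) ^ (-(2 / 3) : ℝ) * ‖w‖ := by
        refine add_le_add ((h n hn).trans (mul_le_mul_of_nonneg_left hinv hK)) ?_
        rw [norm_smul, Complex.norm_real, Real.norm_of_nonneg hpos]
    _ = (K + ‖w‖) * (n : ℝ) ^ (-(2 / 3) : ℝ) := by ring

/-- For one of the two rays the polarization keeps at least half of the squared norm. -/
theorem exists_polarization_norm_eq {m : ℝ} (hm : 0 < m) (v : Spinor) :
    ∃ ε c : ℝ, (ε = 1 ∨ ε = -1) ∧ 1 / Real.sqrt 2 ≤ c ∧ c ≤ 1 ∧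
      ‖matrixOp (polarization m ε) v‖ = c * ‖v‖ := by
  have h2 : 1 / Real.sqrt 2 ≤ 1 := by
    rw [div_le_one (Real.sqrt_pos.2 two_pos)]
    exact Real.one_le_sqrt.2 one_le_two
  by_cases hs : Real.sin m = 0
  · refine ⟨1, 1, Or.inl rfl, h2, le_rfl, ?_⟩
    rw [polarization, if_pos hs, map_one, one_mul]
    rfl
  rcases eq_or_ne v 0 with rfl | hv
  · exact ⟨1, 1, Or.inl rfl, h2, le_rfl, by simp⟩
  have hv0 : 0 < ‖v‖ := norm_pos_iff.2 hv
  obtain ⟨ε, hε, hlow, hup⟩ := exists_branchProj_norm_bounds hm v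
  refine ⟨ε, ‖matrixOp (branchProj m ε 0) v‖ / ‖v‖, hε, ?_, (div_le_one hv0).2 hup, ?_⟩
  · rw [le_div_iff₀ hv0, one_div_mul_eq_div]
    exact hlow
  · rw [polarization_eq_branchProj hm hs, div_mul_cancel₀ _ hv0.ne']

end Rays

/-! ### The main theorem -/

theorem theorem1 (m : ℝ) (hm : 0 < m) (hmS : m ∉ exceptionalMasses) :
    ∃ δ : ℝ, 0 < δ ∧
      -- the Fourier formulas give the solution operator, and `𝒰(2n) = Mⁿ`
      (∀ f : 𝓢(ℝ, Spinor), BandLimited δ f →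
        IsDiracSolution m f (fun t => switchedFlow m t f) ∧
        ∀ n : ℕ, switchedFlow m (2 * n) f = (monodromy m)^[n] f) ∧
      -- the dispersive upper bound, with a constant that does not depend on `f` or `n`
      (∃ K : ℝ, ∀ f : 𝓢(ℝ, Spinor), BandLimited δ f → ∀ n : ℕ, 1 ≤ n → ∀ x : ℝ,
        ‖(monodromy m)^[n] f x‖ ≤ K * (n : ℝ) ^ (-(1 / 3) : ℝ) * ∫ y : ℝ, ‖f y‖) ∧
      -- the expansion along the rays `x_n = n s₀`, `s₀ = -2εθ'(0)`
      (0 < airyConst m ∧ (Real.sin m ≠ 0 → deriv (theta m) 0 ≠ 0) ∧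
        ∀ ε : ℝ, ε = 1 ∨ ε = -1 →
        polarization m ε ≠ 0 ∧
        (∀ f : 𝓢(ℝ, Spinor), BandLimited δ f → ∃ K : ℝ, ∀ n : ℕ, 1 ≤ n →
          ‖(monodromy m)^[n] f (n * (-2 * ε * deriv (theta m) 0))
            - ((airyConst m * (n : ℝ) ^ (-(1 / 3) : ℝ) : ℝ) : ℂ) •
                Matrix.toEuclideanLin (polarization m ε) (∫ y : ℝ, f y)‖
            ≤ K * (n : ℝ) ^ (-(2 / 3) : ℝ)) ∧
        -- the leading error term depends on the derivative of the Fourier transform at `0`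
        (∃ D₀ D₁ : Matrix (Fin 2) (Fin 2) ℂ, D₁ ≠ 0 ∧
          ∀ f : 𝓢(ℝ, Spinor), BandLimited δ f → ∃ K : ℝ, ∀ n : ℕ, 1 ≤ n →
          ‖(monodromy m)^[n] f (n * (-2 * ε * deriv (theta m) 0))
            - ((airyConst m * (n : ℝ) ^ (-(1 / 3) : ℝ) : ℝ) : ℂ) •
                Matrix.toEuclideanLin (polarization m ε) (∫ y : ℝ, f y)
            - (((n : ℝ) ^ (-(2 / 3) : ℝ) : ℝ) : ℂ) •
                (Matrix.toEuclideanLin D₀ (fourierT f 0)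
                  + Matrix.toEuclideanLin D₁ (deriv (fourierT f) 0))‖
            ≤ K * (n : ℝ)⁻¹)) ∧
      -- the modulus along one of the two rays
      (∀ f : 𝓢(ℝ, Spinor), BandLimited δ f →
        ∃ s₀ C : ℝ, (s₀ = -2 * deriv (theta m) 0 ∨ s₀ = 2 * deriv (theta m) 0) ∧
          airyConst m / Real.sqrt 2 ≤ C ∧ C ≤ airyConst m ∧
          ∃ K : ℝ, ∀ n : ℕ, 1 ≤ n →
            |‖(monodromy m)^[n] f (n * s₀)‖
              - C * ‖∫ y : ℝ, f y‖ * (n : ℝ) ^ (-(1 / 3) : ℝ)| ≤ K * (n : ℝ) ^ (-(2 / 3) : ℝ)) := by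
  have ha : iteratedDeriv 3 (theta m) 0 ≠ 0 := fun h => hmS ⟨hm, h⟩
  obtain ⟨δ₁, hδ₁, hdisp⟩ := exists_dispersive_bound hm ha
  obtain ⟨δ₂, hδ₂, A₀, A₁, hA, hplus⟩ := exists_ray_expansion hm ha (ε := 1) (Or.inl rfl)
  obtain ⟨δ₃, hδ₃, B₀, B₁, hB, hminus⟩ := exists_ray_expansion hm ha (ε := -1) (Or.inr rfl)
  -- One bandwidth for the dispersive bound and both rays; it depends on `m` alone.
  set δ := min δ₁ (min δ₂ δ₃) with hδdef
  have hδ : 0 < δ := lt_min hδ₁ (lt_min hδ₂ hδ₃)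
  have hle₁ : δ ≤ δ₁ := min_le_left _ _
  have hle₂ : δ ≤ δ₂ := (min_le_right _ _).trans (min_le_left _ _)
  have hle₃ : δ ≤ δ₃ := (min_le_right _ _).trans (min_le_right _ _)
  have second : ∀ ε : ℝ, ε = 1 ∨ ε = -1 → ∃ D₀ D₁ : Matrix (Fin 2) (Fin 2) ℂ, D₁ ≠ 0 ∧
      ∀ f : 𝓢(ℝ, Spinor), BandLimited δ f → ∃ K : ℝ, ∀ n : ℕ, 1 ≤ n →
        ‖(monodromy m)^[n] f (n * (-2 * ε * deriv (theta m) 0))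
          - ((airyConst m * (n : ℝ) ^ (-(1 / 3) : ℝ) : ℝ) : ℂ) •
              Matrix.toEuclideanLin (polarization m ε) (∫ y : ℝ, f y)
          - (((n : ℝ) ^ (-(2 / 3) : ℝ) : ℝ) : ℂ) •
              (Matrix.toEuclideanLin D₀ (fourierT f 0)
                + Matrix.toEuclideanLin D₁ (deriv (fourierT f) 0))‖ ≤ K * (n : ℝ)⁻¹ := by
    rintro ε (rfl | rfl)
    · refine ⟨A₀, A₁, hA, fun f hf => ?_⟩
      rw [← fourierT_zero]
      exact hplus δ hδ hle₂ f _ hf.isBandProfile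
    · refine ⟨B₀, B₁, hB, fun f hf => ?_⟩
      rw [← fourierT_zero]
      exact hminus δ hδ hle₃ f _ hf.isBandProfile
  have first : ∀ ε : ℝ, ε = 1 ∨ ε = -1 → ∀ f : 𝓢(ℝ, Spinor), BandLimited δ f →
      ∃ K : ℝ, ∀ n : ℕ, 1 ≤ n →
        ‖(monodromy m)^[n] f (n * (-2 * ε * deriv (theta m) 0))
          - ((airyConst m * (n : ℝ) ^ (-(1 / 3) : ℝ) : ℝ) : ℂ) •
              Matrix.toEuclideanLin (polarization m ε) (∫ y : ℝ, f y)‖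
          ≤ K * (n : ℝ) ^ (-(2 / 3) : ℝ) := by
    intro ε hε f hf
    obtain ⟨D₀, D₁, -, h⟩ := second ε hε
    obtain ⟨K, hK⟩ := h f hf
    exact ⟨_, norm_leading_term_le hK⟩
  have hc := airyConst_pos ha
  refine ⟨δ, hδ, fun f hf => ⟨hf.isBandProfile.isDiracSolution hm.ne' hδ,
    fun n => hf.isBandProfile.switchedFlow_two_mul hm.ne' n⟩, hdisp δ hδ hle₁, ⟨hc, fun hs => ?_,
    fun ε hε => ⟨polarization_ne_zero hm ε, first ε hε, second ε hε⟩⟩, fun f hf => ?_⟩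
  · rw [deriv_theta_zero hm]
    exact div_ne_zero hs hm.ne'
  -- The ray is chosen according to `∫ f`: it is one on which the polarization keeps a fraction `c ≥
  -- 1/√2` of its norm. The reverse triangle inequality then passes from the vector expansion to its
  -- modulus.
  · obtain ⟨ε, c, hε, hc1, hc2, hnorm⟩ := exists_polarization_norm_eq hm (∫ y : ℝ, f y)
    obtain ⟨K, hK⟩ := first ε hε f hf
    refine ⟨-2 * ε * deriv (theta m) 0, airyConst m * c, ?_, ?_, ?_, K, fun n hn => ?_⟩
    · rcases hε with rfl | rfl
      · left; ring
      · right; ring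
    · rw [← mul_one_div]
      exact mul_le_mul_of_nonneg_left hc1 hc.le
    · exact mul_le_of_le_one_right hc.le hc2
    · refine le_trans ?_ (hK n hn)
      refine le_trans (le_of_eq ?_) (abs_norm_sub_norm_le _ _)
      have hp : 0 ≤ airyConst m * (n : ℝ) ^ (-(1 / 3) : ℝ) := by positivity
      rw [norm_smul, Complex.norm_real, Real.norm_of_nonneg hp, ← matrixOp_apply, hnorm]
      congr 2
      ring
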